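/- **Theorem (local Plücker formulas for $SO(2n+1,\mathbb C)$).** Let $V=\mathbb C^{2n+1}$ carry the nondegenerate symmetric bilinear form $Q$ which, in a basis $e_1,\dots,e_n,u,f_n,\dots,f_1$, is given by $Q(e_i,f_i)=Q(u,u)=1$, all other products being $0$. Let $G=SO(V,Q)=SO(2n+1,\mathbb C)$ with Lie algebra $\mathfrak g$, let $B\subset G$ (with Lie algebra $\mathfrak b$) be the stabilizer of the isotropic flag $\langle e_1\rangle\subset\dots\subset\langle e_1,\dots,e_n\rangle$, and let $K=G\cap U(2n+1)$ be the compact form. Let $\mathcal N$ be the $G$-invariant distribution on $G/B$ with $$\mathcal N(B)=\{x\in\mathfrak g : [x,[\mathfrak b,\mathfrak b]]\subset\mathfrak b\}/\mathfrak b\subset \mathfrak g/\mathfrak b=T_B(G/B).$$ Let $V_i=\bigwedge^iV$ with highest weight vector $v_i=e_1\wedge\dots\wedge e_i$ for $1\le i<n$, and let $V_n=\bigwedge^\bullet W$, $W=\langle e_1,\dots,e_n\rangle$, be the spin representation, with highest weight vector $v_n=e_1\wedge\dots\wedge e_n$. Let $\pi_i:G/B\to\mathbb P(V_i)$, $[g]\mapsto[g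 v_i]$ (for $i=n$, $g$ is first lifted to $\mathrm{Spin}(2n+1,\mathbb C)$). Give each $V_i$ and each $\bigwedge^kV$ a $K$-invariant Hermitian inner product (for the spin representation, invariant under the preimage of $K$ in $\mathrm{Spin}(2n+1,\mathbb C)$) and let $FS=i\partial\bar\partial\log\|v\|^2$ be the associated Fubini–Study form on the projective space. Let $S$ be a Riemann surface and $f:S\to G/B$ a holomorphic integral curve of $\mathcal N$. Put $\varphi_i=(\pi_i\circ f)^*FS$. These are smooth nonnegative $(1,1)$-forms; write $\varphi_i=h_i\,i\,dz\wedge d\bar z$ in a local coordinate $z$, and let $\theta_i=-i\partial\bar\partial\log h_i$ be the curvature form of the metric $\varphi_i$, defined where $\varphi_i\neq0$. Then, for each $i=1,\dots,n$, at every point where $\varphi_i\ne 0$, $$\theta_i=\sum_{j=1}^n C_{ij}\,\varphi_j ,$$ where $C$ is the Cartan matrix of type $B_n$ ($C_{ii}=2$; $C_{i,i+1}=C_{i+1,i}=-1$ for $i<n-1$; $C_{n-1,n}=-2$, $C_{n,n-1}=-1$; other entries $0$). Moreover, these formulas are the pullbacks of the first $n$ classical Plücker formulas on the variety $Fl(V)$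 of complete flags. Let $\iota:G/B\to Fl(V)$ send $[g]$ to the complete flag spanned by $ge_1,\dots,ge_n,gu,gf_n,\dots,gf_1$. For $1\le k\le 2n$ let $\hat\varphi_k$ be the pullback to $Fl(V)$ of the Fubini–Study form of $\mathbb P(\bigwedge^kV)$ under $(F_\bullet)\mapsto[\bigwedge^kF_k]$, and let $\hat\vartheta_k=-i\partial\bar\partial\log\|s\|^2$ ($s$ a local nonvanishing holomorphic section) be the curvature of the line bundle on $Fl(V)$ with fibre $\mathrm{Hom}(F_k/F_{k-1},F_{k+1}/F_k)$ (the bundle of the simple root $L_k-L_{k+1}$ of $\mathfrak{sl}(2n+1,\mathbb C)$), with the metric induced by the Hermitian metric of $V$ for which the given basis is orthonormal. Then, for $1\le i\le n$: 1. $\theta_i=(\iota\circ f)^*\hat\vartheta_i$ at every point where $\varphi_i\neq0$; 2. $(\iota\circ f)^*\hat\vartheta_i=\sum_{j=1}^{2n}A_{ij}\,(\iota\circ f)^*\hat\varphi_j$ on all of $S$, where $A$ is the Cartan matrix of type $A_{2n}$; 3. $(\iota\circ f)^*\hat\varphi_i=\varphi_i$ if $i<n$, and $(\iota\circ f)^*\hat\varphi_n=(\iota\circ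 f)^*\hat\varphi_{n+1}=2\varphi_n$. -/

import Mathlib

open scoped Manifold ContDiff LinearAlgebra.Projectivization
open Laplacian

noncomputable section

namespace LocalPlucker

/-! ### The groups and the flag varieties -/

/-- The space `V = ℂ^(2n+1)`. Its standard basis is written
`b_0, …, b_{2n} = e_1, …, e_n, u, f_n, …, f_1`. -/
abbrev V (n : ℕ) : Type := Fin (2 * n + 1) → ℂ

/-- Square complex matrices of size `2n+1`. -/
abbrev Mat (n : ℕ) : Type := Matrix (Fin (2 * n + 1)) (Fin (2 * n + 1)) ℂ

/-- The Gram matrix of the nondegenerate symmetric bilinear form `Q` on `V`: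
`Q(e_i, f_i) = Q(f_i, e_i) = 1`, `Q(u, u) = 1`, and all other products of basis vectors vanish. -/
def gram (n : ℕ) : Mat n := Matrix.of fun a b => if b = Fin.rev a then 1 else 0

/-- The group `SL(2n+1, ℂ)`. -/
abbrev SL (n : ℕ) : Type := Matrix.SpecialLinearGroup (Fin (2 * n + 1)) ℂ

/-- `G = SO(2n+1, ℂ)`: the matrices of determinant one which preserve `Q`. -/
def SO (n : ℕ) : Subgroup (SL n) where
  carrier := {g | g.1.transpose * gram n * g.1 = gram n}
  one_mem' := by simp [Set.mem_ofPred_eq]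
  mul_mem' := by
    intro a b ha hb
    rw [Set.mem_ofPred_eq] at *
    have h : (a * b).1 = a.1 * b.1 := rfl
    rw [h, Matrix.transpose_mul]
    calc _ = b.1.transpose * (a.1.transpose * gram n * a.1) * b.1 := by
          simp only [Matrix.mul_assoc]
      _ = _ := by rw [ha, hb]
  inv_mem' := by
    intro a ha
    rw [Set.mem_ofPred_eq] at *
    have h : a.1 * (a⁻¹).1 = 1 := congrArg Subtype.val (mul_inv_cancel a)
    have h' : (a⁻¹).1.transpose * a.1.transpose = 1 := by
      rw [← Matrix.transpose_mul, h, Matrix.transpose_one]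
    calc (a⁻¹).1.transpose * gram n * (a⁻¹).1
        = (a⁻¹).1.transpose * (a.1.transpose * gram n * a.1) * (a⁻¹).1 := by rw [ha]
      _ = ((a⁻¹).1.transpose * a.1.transpose) * gram n * (a.1 * (a⁻¹).1) := by
          simp only [Matrix.mul_assoc]
      _ = gram n := by rw [h, h', Matrix.one_mul, Matrix.mul_one]

/-- The span `E_k` of the first `k` vectors of the standard basis of `V`. It is isotropic for
`k ≤ n`, and `E_{2n+1-k}` is the orthogonal complement of `E_k`. -/
def stdFlag (n k : ℕ) : Submodule ℂ (V n) :=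
  Submodule.span ℂ {v | ∃ j : Fin (2 * n + 1), j.val < k ∧ v = Pi.single j 1}

/-- The Borel subgroup of `SL(2n+1, ℂ)`: the stabilizer of the complete flag
`E_1 ⊂ E_2 ⊂ ⋯ ⊂ E_{2n+1} = V`. -/
def borelSL (n : ℕ) : Subgroup (SL n) where
  carrier := {g | ∀ k, (stdFlag n k).map (Matrix.toLin' g.1) = stdFlag n k}
  one_mem' := by intro k; simp
  mul_mem' := by
    intro a b ha hb k
    have h : (a * b).1 = a.1 * b.1 := rfl
    rw [h, Matrix.toLin'_mul, Submodule.map_comp, hb k, ha k]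
  inv_mem' := by
    intro a ha k
    have h : (a⁻¹).1 * a.1 = 1 := congrArg Subtype.val (inv_mul_cancel a)
    conv_lhs => rw [← ha k]
    rw [← Submodule.map_comp, ← Matrix.toLin'_mul, h]
    simp

/-- The Borel subgroup `B` of `G = SO(2n+1, ℂ)`: the stabilizer in `G` of the standard isotropic
flag `E_1 ⊂ ⋯ ⊂ E_n` (an element of `G` which stabilizes it also stabilizes the orthogonal
complements `E_{n+1} ⊂ ⋯ ⊂ E_{2n+1}`). -/
def borel (n : ℕ) : Subgroup (SO n) := (borelSL n).subgroupOf (SO n)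

/-- The flag variety `G/B` of `G = SO(2n+1, ℂ)`. -/
abbrev FlagSO (n : ℕ) : Type := SO n ⧸ borel n

/-- The variety `Fl(V)` of complete flags in `V`, as the quotient `SL(2n+1, ℂ)/B_SL`;
the class of `g` is the flag `g E_1 ⊂ g E_2 ⊂ ⋯`. -/
abbrev FlV (n : ℕ) : Type := SL n ⧸ borelSL n

/-- The embedding `i : G/B → Fl(V)`, `[g] ↦ [g]`. -/
def incl (n : ℕ) : FlagSO n → FlV n :=
  Quotient.map' (fun g : SO n => (g : SL n)) (by
    intro a b h
    rw [QuotientGroup.leftRel_apply] at h ⊢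
    exact h)

/-! ### Holomorphic integral curves -/

/-- The Lie algebra `𝔤 = 𝔰𝔬(2n+1, ℂ)` of `G`. -/
def so (n : ℕ) : Set (Mat n) := {X | X.transpose * gram n + gram n * X = 0}

/-- The Lie algebra `𝔟` of `B`. -/
def borelLie (n : ℕ) : Set (Mat n) :=
  {X | X ∈ so n ∧ ∀ k, (stdFlag n k).map (Matrix.toLin' X) ≤ stdFlag n k}

/-- The preimage `{x ∈ 𝔤 | [x, [𝔟, 𝔟]] ⊂ 𝔟}` in `𝔤` of the subspace `𝒩(B) ⊂ 𝔤/𝔟 = T_B(G/B)`. -/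
def distN (n : ℕ) : Set (Mat n) :=
  {X | X ∈ so n ∧ ∀ Y ∈ borelLie n, ∀ Z ∈ borelLie n, ⁅X, ⁅Y, Z⁆⁆ ∈ borelLie n}

section Curves

variable {S : Type*} [TopologicalSpace S] [ChartedSpace ℂ S]

/-- A map from an open subset `U` of a Riemann surface to `SL(2n+1, ℂ)` is holomorphic if its
matrix entries are. -/
def IsHolomorphicFrame {n : ℕ} (U : Set S) (g : S → SL n) : Prop :=
  IsOpen U ∧ ∀ a b, MDifferentiableOn 𝓘(ℂ, ℂ) 𝓘(ℂ, ℂ) (fun x => (g x).1 a b) U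

/-- `g : U → G` is a holomorphic lift of `f : S → G/B` over the open set `U`. -/
def IsLift {n : ℕ} (f : S → FlagSO n) (U : Set S) (g : S → SO n) : Prop :=
  IsHolomorphicFrame U (fun x => (g x : SL n)) ∧ ∀ x ∈ U, f x = (g x : FlagSO n)

/-- `g : U → SL(2n+1, ℂ)` is a holomorphic lift of `F : S → Fl(V)` over the open set `U`. -/
def IsLiftSL {n : ℕ} (F : S → FlV n) (U : Set S) (g : S → SL n) : Prop :=
  IsHolomorphicFrame U g ∧ ∀ x ∈ U, F x = (g x : FlV n)

/-- Holomorphic maps `f : S → G/B`. The complex structure of `G/B` is the one for which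
`G → G/B` is a holomorphic principal bundle, so a map to `G/B` is holomorphic if and only if it
lifts locally to a holomorphic map to `G`. -/
def IsHolomorphicCurve {n : ℕ} (f : S → FlagSO n) : Prop :=
  ∀ p : S, ∃ (U : Set S) (g : S → SO n), p ∈ U ∧ IsLift f U g

/-- The derivative of a matrix valued map at `x` along the tangent vector `ξ`. -/
def matDeriv {n : ℕ} (g : S → SL n) (x : S) (ξ : TangentSpace 𝓘(ℂ, ℂ) x) : Mat n :=
  Matrix.of fun a b => mfderiv 𝓘(ℂ, ℂ) 𝓘(ℂ, ℂ) (fun y => (g y).1 a b) x ξ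

/-- `f : S → G/B` is an integral curve of the `G`-invariant distribution `𝒩`, whose value at `B`
is `𝒩(B)`: for a local lift `g` of `f`, the vectors `df(ξ) = d(g B)(ξ)`, moved back to the base
point `B` by `g⁻¹`, lie in `𝒩(B)`; they are the classes of `g⁻¹ dg(ξ)` in `𝔤/𝔟`. -/
def IsIntegralCurveOfN {n : ℕ} (f : S → FlagSO n) : Prop :=
  ∀ (U : Set S) (g : S → SO n), IsLift f U g → ∀ x ∈ U, ∀ ξ : TangentSpace 𝓘(ℂ, ℂ) x,
    ((g x)⁻¹ : SO n).1.1 * matDeriv (fun y => (g y : SL n)) x ξ ∈ distN n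

end Curves

/-! ### The morphisms to the projectivized exterior powers -/

/-- The vector `b_0 ∧ ⋯ ∧ b_{k-1}` of `⋀^k V`, of highest weight `L_1 + ⋯ + L_k` if `k ≤ n`. -/
def extVec (n k : ℕ) (hk : k ≤ 2 * n + 1) : ⋀[ℂ]^k (V n) :=
  exteriorPower.ιMulti ℂ k fun j => Pi.single (Fin.castLE hk j) 1

theorem ιMulti_single_ne_zero {m k : ℕ} (hk : k ≤ m) :
    (exteriorPower.ιMulti ℂ k fun j : Fin k => (Pi.single (Fin.castLE hk j) 1 : Fin m → ℂ)) ≠ 0 := by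
  intro h
  have := congrArg (exteriorPower.pairingDual ℂ (Fin m → ℂ) k
    (exteriorPower.ιMulti ℂ k fun j => LinearMap.proj (Fin.castLE hk j))) h
  rw [exteriorPower.pairingDual_ιMulti_ιMulti, map_zero] at this
  have h1 : (Matrix.of fun i j : Fin k => (LinearMap.proj (Fin.castLE hk j) : (Fin m → ℂ) →ₗ[ℂ] ℂ)
      (Pi.single (Fin.castLE hk i) 1)) = 1 := by
    ext i j
    simp [Matrix.one_apply, Pi.single_apply, eq_comm]
  rw [h1, Matrix.det_one] at this
  exact one_ne_zero this

/-- The action of `SL(2n+1, ℂ)` on `⋀^k V`. -/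
def extAct {n : ℕ} (k : ℕ) (g : SL n) : ⋀[ℂ]^k (V n) →ₗ[ℂ] ⋀[ℂ]^k (V n) :=
  exteriorPower.map k (Matrix.toLin' g.1)

theorem extAct_extVec_ne_zero {n k : ℕ} (hk : k ≤ 2 * n + 1) (g : SL n) :
    extAct k g (extVec n k hk) ≠ 0 := by
  intro h
  have h2 : ∃ M : Mat n, M * g.1 = 1 :=
    ⟨(g⁻¹ : SL n).1, congrArg Subtype.val (inv_mul_cancel g)⟩
  obtain ⟨M, hM⟩ := h2
  have h1 := congrArg (exteriorPower.map k (Matrix.toLin' M)) h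
  rw [extAct, ← LinearMap.comp_apply, ← exteriorPower.map_comp, ← Matrix.toLin'_mul, hM,
    Matrix.toLin'_one, exteriorPower.map_id, map_zero] at h1
  exact ιMulti_single_ne_zero hk h1

/-- The morphism `π_k : G/B → ℙ(⋀^k V)`, `[g] ↦ [g · (e_1 ∧ ⋯ ∧ e_k)]`. (The stabilizer `B` acts
on the highest weight vector by scalars, so any representative `g` gives the same point.) -/
def piExt {n : ℕ} (k : ℕ) (hk : k ≤ 2 * n + 1) (P : FlagSO n) : ℙ ℂ (⋀[ℂ]^k (V n)) :=
  Projectivization.mk ℂ (extAct k (Quotient.out P : SO n).1 (extVec n k hk))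
    (extAct_extVec_ne_zero hk _)

/-- The morphism `Fl(V) → Gr(k, V) → ℙ(⋀^k V)`, the projection to the Grassmannian followed by
the Plücker embedding: `[g] ↦ [g b_0 ∧ ⋯ ∧ g b_{k-1}]`. -/
def plucker {n : ℕ} (k : ℕ) (hk : k ≤ 2 * n + 1) (P : FlV n) : ℙ ℂ (⋀[ℂ]^k (V n)) :=
  Projectivization.mk ℂ (extAct k (Quotient.out P : SL n) (extVec n k hk))
    (extAct_extVec_ne_zero hk _)

/-! ### The spin representation -/

/-- The quadratic form `v ↦ Q(v, v)`. -/
def quadForm (n : ℕ) : QuadraticForm ℂ (V n) := (Matrix.toBilin' (gram n)).toQuadraticMap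

/-- The space `W = ⟨e_1, …, e_n⟩`, in coordinates. -/
abbrev W (n : ℕ) : Type := Fin n → ℂ

/-- The space `⋀^• W` of spinors. -/
abbrev Spinor (n : ℕ) : Type := ExteriorAlgebra ℂ (W n)

/-- The index of `e_{i+1}` in the basis of `V`. -/
def idxE {n : ℕ} (i : Fin n) : Fin (2 * n + 1) := ⟨i.val, by omega⟩

/-- The index of `u` in the basis of `V`. -/
def idxU (n : ℕ) : Fin (2 * n + 1) := ⟨n, by omega⟩

/-- The component in `W` of a vector of `V = W ⊕ ⟨u⟩ ⊕ W'`, `W' = ⟨f_1, …, f_n⟩`. -/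
def partW (n : ℕ) : V n →ₗ[ℂ] W n := LinearMap.funLeft ℂ ℂ idxE

/-- The functional `Q(v, ·)` on `W`, for `v ∈ V`. It depends on the component of `v` in `W'`. -/
def partW' (n : ℕ) : V n →ₗ[ℂ] Module.Dual ℂ (W n) :=
  ∑ i : Fin n, (LinearMap.proj (Fin.rev (idxE i)) : V n →ₗ[ℂ] ℂ).smulRight
    (LinearMap.proj i : W n →ₗ[ℂ] ℂ)

/-- Clifford multiplication by `v = w + t u + w'` on `⋀^• W`: exterior multiplication by `w`,
plus `t` times the parity involution, plus the contraction with `2 Q(w', ·)`. -/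
def cliff (n : ℕ) : V n →ₗ[ℂ] Module.End ℂ (Spinor n) :=
  (LinearMap.mul ℂ (Spinor n)).comp ((ExteriorAlgebra.ι ℂ).comp (partW n))
    + (LinearMap.proj (idxU n) : V n →ₗ[ℂ] ℂ).smulRight
        (CliffordAlgebra.involute (Q := (0 : QuadraticForm ℂ (W n)))).toLinearMap
    + (2 : ℂ) • (CliffordAlgebra.contractLeft (Q := (0 : QuadraticForm ℂ (W n)))).comp (partW' n)

theorem involute_contractLeft {n : ℕ} (d : Module.Dual ℂ (W n)) (s : Spinor n) :
    CliffordAlgebra.involute (Q := (0 : QuadraticForm ℂ (W n)))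
        (CliffordAlgebra.contractLeft (Q := (0 : QuadraticForm ℂ (W n))) d s)
      = - CliffordAlgebra.contractLeft (Q := (0 : QuadraticForm ℂ (W n))) d
          (CliffordAlgebra.involute (Q := (0 : QuadraticForm ℂ (W n))) s) := by
  induction s using CliffordAlgebra.left_induction with
  | algebraMap r => simp [CliffordAlgebra.contractLeft_algebraMap]
  | add x y hx hy => simp only [map_add, hx, hy, neg_add]
  | ι_mul x v hx =>
    simp only [CliffordAlgebra.contractLeft_ι_mul, map_sub, map_smul, map_mul,
      CliffordAlgebra.involute_ι, hx, neg_mul, map_neg, mul_neg]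
    abel

theorem cliff_apply {n : ℕ} (v : V n) (s : Spinor n) :
    cliff n v s = ExteriorAlgebra.ι ℂ (partW n v) * s
      + v (idxU n) • CliffordAlgebra.involute (Q := (0 : QuadraticForm ℂ (W n))) s
      + (2 : ℂ) • CliffordAlgebra.contractLeft (Q := (0 : QuadraticForm ℂ (W n)))
          (partW' n v) s := rfl

theorem partW'_apply {n : ℕ} (v : V n) (w : W n) :
    partW' n v w = ∑ i, v (Fin.rev (idxE i)) * w i := by
  simp [partW', LinearMap.sum_apply]

theorem quadForm_apply {n : ℕ} (v : V n) :
    quadForm n v = v (idxU n) * v (idxU n) + 2 * partW' n v (partW n v) := by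
  have h0 : quadForm n v = ∑ a, v a * v (Fin.rev a) := by
    simp [quadForm, gram, Matrix.toBilin'_apply']
    simp [dotProduct, Matrix.mulVec]
  have hn : n + 1 + n = 2 * n + 1 := by omega
  have h1 : ∀ i : Fin n, finCongr hn (Fin.castAdd n (Fin.castAdd 1 i)) = idxE i := by
    intro i; ext; simp [idxE]
  have h2 : ∀ i : Fin n, finCongr hn (Fin.natAdd (n + 1) (Fin.rev i)) = Fin.rev (idxE i) := by
    intro i; ext; simp [idxE]; omega
  have h3 : finCongr hn (Fin.castAdd n (Fin.natAdd n 0)) = idxU n := by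
    ext; simp [idxU]
  have h4 : Fin.rev (idxU n) = idxU n := by
    ext; simp [idxU]; omega
  rw [h0, ← (finCongr hn).sum_comp, Fin.sum_univ_add, Fin.sum_univ_add, partW'_apply,
    ← Equiv.sum_comp Fin.revPerm (fun i : Fin n => v (finCongr hn (Fin.natAdd (n + 1) i)) * _)]
  simp only [Fin.revPerm_apply, h1, h2, h3, h4, Fin.rev_rev, Finset.univ_unique,
    Finset.sum_singleton, Fin.default_eq_zero, partW, LinearMap.funLeft_apply, two_mul]
  simp only [mul_comm (v (idxE _))]
  ring

theorem cliff_sq {n : ℕ} (v : V n) :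
    cliff n v * cliff n v = algebraMap ℂ _ (quadForm n v) := by
  refine LinearMap.ext fun s => ?_
  rw [Module.End.mul_apply, Module.algebraMap_end_apply, quadForm_apply, cliff_apply v (cliff n v s),
    cliff_apply v s]
  have e1 : ExteriorAlgebra.ι ℂ (partW n v) * (ExteriorAlgebra.ι ℂ (partW n v) * s) = 0 := by
    rw [← mul_assoc, ExteriorAlgebra.ι_sq_zero, zero_mul]
  have e2 : CliffordAlgebra.contractLeft (Q := (0 : QuadraticForm ℂ (W n))) (partW' n v)
      (ExteriorAlgebra.ι ℂ (partW n v) * s) = partW' n v (partW n v) • s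
      - ExteriorAlgebra.ι ℂ (partW n v) *
        CliffordAlgebra.contractLeft (Q := (0 : QuadraticForm ℂ (W n))) (partW' n v) s :=
    CliffordAlgebra.contractLeft_ι_mul _ _ _
  have e3 : CliffordAlgebra.involute (Q := (0 : QuadraticForm ℂ (W n)))
      (ExteriorAlgebra.ι ℂ (partW n v)) = - ExteriorAlgebra.ι ℂ (partW n v) :=
    CliffordAlgebra.involute_ι _
  simp only [map_add, map_smul, map_mul, mul_add, e1, e2, e3, involute_contractLeft,
    CliffordAlgebra.contractLeft_contractLeft, CliffordAlgebra.involute_involute, mul_smul_comm, neg_mul]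
  module

/-- The Clifford algebra `C(Q)` acting on `⋀^• W`. -/
def spinRep (n : ℕ) : CliffordAlgebra (quadForm n) →ₐ[ℂ] Module.End ℂ (Spinor n) :=
  CliffordAlgebra.lift (quadForm n) ⟨cliff n, cliff_sq⟩

/-- The group `Spin(2n+1, ℂ)`, inside the even Clifford algebra. -/
abbrev Spin (n : ℕ) : Type := spinGroup (quadForm n)

/-- `x ∈ Spin(2n+1, ℂ)` lies above `g ∈ SO(2n+1, ℂ)` under the double cover `Spin → SO`:
`x v x⁻¹ = g v` for all `v ∈ V`. -/
def Covers {n : ℕ} (x : Spin n) (g : SO n) : Prop :=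
  ∀ v : V n, (x : CliffordAlgebra (quadForm n)) * CliffordAlgebra.ι (quadForm n) v
    = CliffordAlgebra.ι (quadForm n) (Matrix.toLin' g.1.1 v) * x

/-- The highest weight vector `e_1 ∧ ⋯ ∧ e_n` of the spin representation `⋀^• W`,
of weight `(L_1 + ⋯ + L_n)/2`. -/
def spinVec (n : ℕ) : Spinor n :=
  ExteriorAlgebra.ιMulti ℂ n fun j => (Pi.single j 1 : W n)

theorem spinRep_spinVec_ne_zero {n : ℕ} (x : Spin n) :
    spinRep n (x : CliffordAlgebra (quadForm n)) (spinVec n) ≠ 0 := by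
  intro h
  have h1 := congrArg (spinRep n (star (x : CliffordAlgebra (quadForm n)))) h
  rw [← Module.End.mul_apply, ← map_mul, spinGroup.coe_star_mul_self, map_one,
    Module.End.one_apply, map_zero] at h1
  apply ιMulti_single_ne_zero (le_refl n)
  apply Subtype.ext
  rw [exteriorPower.ιMulti_apply_coe]
  exact h1

/-- The morphism `π_n : G/B → ℙ(⋀^• W)` of the spin representation, `[g] ↦ [x · (e_1 ∧ ⋯ ∧ e_n)]`
for `x ∈ Spin(2n+1, ℂ)` above `g`. (Every `g` has such an `x`, unique up to sign, and the preimage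
of `B` acts on the highest weight vector by scalars, so any choice of `g` and `x` gives the same
point.) -/
def piSpin {n : ℕ} (P : FlagSO n) : ℙ ℂ (Spinor n) :=
  Projectivization.mk ℂ
    (spinRep n (Classical.epsilon fun x : Spin n => ∃ g : SO n, (g : FlagSO n) = P ∧ Covers x g :
      Spin n) (spinVec n))
    (spinRep_spinVec_ne_zero _)

/-! ### Invariant Hermitian metrics -/

/-- The compact form `K = SO(2n+1, ℂ) ∩ U(2n+1)` of `G`. -/
def IsCompactElt {n : ℕ} (g : SO n) : Prop := g.1.1 ∈ Matrix.unitaryGroup (Fin (2 * n + 1)) ℂ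

/-- A Hermitian inner product on `⋀^k V` is invariant under `K`. -/
def IsInvariantExt {n k : ℕ} (H : InnerProductSpace.Core ℂ (⋀[ℂ]^k (V n))) : Prop :=
  ∀ g : SO n, IsCompactElt g → ∀ s t, H.inner (extAct k g.1 s) (extAct k g.1 t) = H.inner s t

/-- A Hermitian inner product on the spin representation is invariant under (the preimage in
`Spin(2n+1, ℂ)` of) `K`. -/
def IsInvariantSpin {n : ℕ} (H : InnerProductSpace.Core ℂ (Spinor n)) : Prop :=
  ∀ (g : SO n) (x : Spin n), IsCompactElt g → Covers x g → ∀ s t,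
    H.inner (spinRep n (x : CliffordAlgebra (quadForm n)) s)
      (spinRep n (x : CliffordAlgebra (quadForm n)) t) = H.inner s t

/-! ### Metric forms and curvature forms

A `(1,1)`-form on a Riemann surface is written `h · i dz ∧ dz̄` in a local coordinate `z`, and is
represented by its coefficient `h`, in every local coordinate. -/

/-- The operator `∂² / ∂z ∂z̄`, that is, the coefficient of `i ∂∂̄ u` with respect to
`i dz ∧ dz̄`. -/
def ddbar (u : ℂ → ℝ) (z : ℂ) : ℝ := (1 / 4) * Δ u z

/-- The potential `log (‖v‖² / |ℓ(v)|²)`, `[v] = Q`, of the Fubini–Study form `i ∂∂̄ log ‖v‖²` of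
`ℙ(E)`, on the affine chart `ℓ ≠ 0` which contains the point `P = [v₀]`, where `ℓ = ⟨v₀, ·⟩`. -/
def fsPotential {E : Type*} [AddCommGroup E] [Module ℂ E] (H : InnerProductSpace.Core ℂ E)
    (P Q : ℙ ℂ E) : ℝ :=
  Real.log ((H.inner Q.rep Q.rep).re / ‖H.inner P.rep Q.rep‖ ^ 2)

section Forms

variable {S : Type*} [TopologicalSpace S] [ChartedSpace ℂ S]

/-- The pullback `F^* FS` of the Fubini–Study form under `F : S → ℙ(E)`: its coefficient at the
point with coordinate `z` in the local coordinate `c`. -/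
def fsForm {E : Type*} [AddCommGroup E] [Module ℂ E] (H : InnerProductSpace.Core ℂ E)
    (F : S → ℙ ℂ E) (c : OpenPartialHomeomorph S ℂ) (z : ℂ) : ℝ :=
  ddbar (fun w => fsPotential H (F (c.symm z)) (F (c.symm w))) z

/-- The curvature form `-i ∂∂̄ log h` of the metric with the form `h · i dz ∧ dz̄`. -/
def curvature (h : ℂ → ℝ) (z : ℂ) : ℝ := - ddbar (fun w => Real.log (h w)) z

/-- The metrics `φ_1, …, φ_n` on the curve `f : S → G/B`: the form `φ_{i+1}` is `(π_{i+1} ∘ f)^* FS`,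
where `π_{i+1}` maps to the projectivization of the fundamental representation `⋀^{i+1} V` for
`i + 1 < n`, and of the spin representation for `i + 1 = n`. -/
def metric {n : ℕ} (H : ∀ k, InnerProductSpace.Core ℂ (⋀[ℂ]^k (V n)))
    (Hs : InnerProductSpace.Core ℂ (Spinor n)) (f : S → FlagSO n)
    (c : OpenPartialHomeomorph S ℂ) (i : Fin n) : ℂ → ℝ :=
  if i.val + 1 < n then fsForm (H (i.val + 1)) (piExt (i.val + 1) (by omega) ∘ f) c
  else fsForm Hs (piSpin ∘ f) c

/-- The forms `F^* φ̂_1, …, F^* φ̂_{2n}` for a curve `F : S → Fl(V)`, where `φ̂_k` is the pullback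
to `Fl(V)` of the Fubini–Study form of `ℙ(⋀^k V)`. -/
def metricFl {n : ℕ} (H : ∀ k, InnerProductSpace.Core ℂ (⋀[ℂ]^k (V n))) (F : S → FlV n)
    (c : OpenPartialHomeomorph S ℂ) (j : Fin (2 * n)) : ℂ → ℝ :=
  fsForm (H (j.val + 1)) (plucker (j.val + 1) (by omega) ∘ F) c

/-- For the flag `F_1 ⊂ F_2 ⊂ ⋯` spanned by the columns `g_0, g_1, …` of `g`: the norm of the class
of `g_j` in `F_{j+1}/F_j`, for the quotient norm of the standard Hermitian norm of `V`. -/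
def gradedNorm {n : ℕ} (g : SL n) (j : Fin (2 * n + 1)) : ℝ :=
  Metric.infDist (WithLp.toLp 2 (fun a => g.1 a j) : EuclideanSpace ℂ (Fin (2 * n + 1)))
    (Submodule.span ℂ {v : EuclideanSpace ℂ (Fin (2 * n + 1)) |
      ∃ l < j, v = WithLp.toLp 2 (fun a => g.1 a l)})

/-- The curvature `θ(𝒩_i) = -i ∂∂̄ log ‖s‖²` of the line bundle on `Fl(V)` of the simple root
`L_i - L_{i+1}` of `𝔰𝔩(2n+1)`, pulled back to a curve `F : S → Fl(V)`. The fibre of the bundle at the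
flag `F_1 ⊂ F_2 ⊂ ⋯` is `Hom(F_i/F_{i-1}, F_{i+1}/F_i)`, with the invariant metric induced by the
standard Hermitian metric of `V`. The curvature is computed from the local holomorphic section `s`
which, for a local holomorphic lift `g` of `F` to `SL(2n+1, ℂ)`, maps the class of the `i`-th column
of `g` to that of the next column (the index `i` starts from `0` here). -/
def rootCurvature {n : ℕ} (g : S → SL n) (c : OpenPartialHomeomorph S ℂ) (i : Fin (2 * n))
    (z : ℂ) : ℝ :=
  - ddbar (fun w => Real.log
    ((gradedNorm (g (c.symm w)) i.succ / gradedNorm (g (c.symm w)) i.castSucc) ^ 2)) z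

end Forms

end LocalPlucker

end

open LocalPlucker

namespace LocalPlucker

/-! ### Calculus of the operator `∂²/∂z∂z̄` on logarithms of norms. -/

section DDbar
open Filter Topology

/-! Everything reduces to the positive functions `tau_k` of a local holomorphic lift `G` of the
curve to `SO(2n+1)`: `tau_k` is the squared norm of `G b_0 ∧ ⋯ ∧ G b_{k-1}`, up to a constant. Put
`Φ_k = ∂∂̄ log tau_k`. The proof computes `Φ_k` in two ways.

The group picture: by the Iwasawa decomposition `G = KB` a `K`-invariant norm on the orbit of a
highest weight vector is determined by the character through which `B` acts on it. Hence any
invariant Fubini–Study form on `ℙ(⋀^k V)` pulls back to `Φ_k` (`inner_extAct_extVec`,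
`fsForm_plucker`).

The differential picture: commuting with `[𝔟, 𝔟]` into `𝔟` leaves only the negative simple roots
modulo `𝔟`, so on an integral curve `A = G⁻¹G'` is a Hessenberg matrix
(`apply_eq_zero_of_mem_distN`). The derivative of `G b_0 ∧ ⋯ ∧ G b_m` is then a multiple of itself
plus one subdiagonal entry of `A` times the vector with `b_m` replaced by `b_{m+1}`. The
Fubini–Study form is a Gram determinant of these two vectors, and `Φ_k = const · |A_{k,k-1}|²
tau_{k-1} tau_{k+1} / tau_k²` (`fsForm_plucker_eq`). Applying `-∂∂̄ log`, where the holomorphic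
entry of `A` contributes nothing, gives `2Φ_k - Φ_{k-1} - Φ_{k+1}`. The same expression is the
curvature of the root line bundle, whose section has squared norm `tau_{k-1} tau_{k+1} / tau_k²`
(`rootCurvature_eq`). These are the formulas of type `A`.

Two facts specific to the orthogonal group fold `A_{2n}` into `B_n`. The middle quotient of an
orthogonal flag has graded norm one (`gradedNorm_middle`), so `tau_{n+1} = tau_n`. The highest
weight of the spin representation is half that of `⋀^n V`, so `φ_n = Φ_n / 2` (`fsForm_spin`).
Substituting `Φ_{n+1} = Φ_n = 2φ_n` produces the last rows of the Cartan matrix of type `B_n`.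

The spin statement needs the double cover to be surjective (Cartan–Dieudonné) and a holomorphic
section of the spin line that avoids choosing a holomorphic lift to `Spin`: the Clifford product of
the first `n` columns of `G`, applied to a fixed spinor. -/

theorem two_le_infty : (2 : WithTop ℕ∞) ≤ ∞ := by
  exact WithTop.coe_le_coe.2 (le_top : (2 : ℕ∞) ≤ ⊤)

theorem ddbar_congr {u v : ℂ → ℝ} {z : ℂ} (h : u =ᶠ[𝓝 z] v) : ddbar u z = ddbar v z := by
  simp only [ddbar, (InnerProductSpace.laplacian_congr_nhds h).eq_of_nhds]

theorem ddbar_add {u v : ℂ → ℝ} {z : ℂ} (hu : ContDiffAt ℝ ∞ u z) (hv : ContDiffAt ℝ ∞ v z) :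
    ddbar (fun w => u w + v w) z = ddbar u z + ddbar v z := by
  have := ContDiffAt.laplacian_add (hu.of_le two_le_infty : ContDiffAt ℝ 2 u z)
    (hv.of_le two_le_infty : ContDiffAt ℝ 2 v z)
  simp only [ddbar]
  rw [← mul_add, ← this]
  rfl

theorem ddbar_const_mul {u : ℂ → ℝ} {z : ℂ} (c : ℝ) (hu : ContDiffAt ℝ ∞ u z) :
    ddbar (fun w => c * u w) z = c * ddbar u z := by
  have := InnerProductSpace.laplacian_smul c
    (hu.of_le two_le_infty : ContDiffAt ℝ 2 u z)
  simp only [ddbar]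
  have h2 : (fun w => c * u w) = c • u := rfl
  rw [h2, this, smul_eq_mul]
  ring

theorem ddbar_const (c : ℝ) (z : ℂ) : ddbar (fun _ => c) z = 0 := by
  simp [ddbar]

theorem ddbar_log_norm {f : ℂ → ℂ} {z : ℂ} (hf : AnalyticAt ℂ f z) (h0 : f z ≠ 0) :
    ddbar (fun w => Real.log ‖f w‖) z = 0 := by
  have := (hf.harmonicAt_log_norm h0).2.eq_of_nhds
  simp only [ddbar, Pi.zero_apply] at this ⊢
  rw [this, mul_zero]

theorem contDiffAt_log_norm {f : ℂ → ℂ} {z : ℂ} (hf : AnalyticAt ℂ f z) (h0 : f z ≠ 0) :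
    ContDiffAt ℝ ∞ (fun w => Real.log ‖f w‖) z := by
  have h1 : ContDiffAt ℝ ∞ f z := (hf.contDiffAt (n := ∞)).restrict_scalars ℝ
  exact (h1.norm ℝ h0).log (norm_ne_zero_iff.2 h0)

variable {E : Type*} [NormedAddCommGroup E] [InnerProductSpace ℂ E]

theorem contDiffAt_norm_sq_comp {s : ℂ → E} {z : ℂ} (hs : ContDiffAt ℂ ∞ s z) :
    ContDiffAt ℝ ∞ (fun w => ‖s w‖ ^ 2) z := by
  let _ : InnerProductSpace ℝ E := InnerProductSpace.rclikeToReal ℂ E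
  have h1 : ContDiffAt ℝ ∞ s z := hs.restrict_scalars ℝ
  exact h1.norm_sq ℝ

theorem fderiv_log_norm_sq {s : ℂ → E} {s' : E} {w : ℂ} (hs : HasDerivAt s s' w)
    (h0 : s w ≠ 0) (ξ : ℂ) :
    fderiv ℝ (fun w => Real.log (‖s w‖ ^ 2)) w ξ
      = 2 * (inner ℂ (s w) (ξ • s')).re / ‖s w‖ ^ 2 := by
  let _ : InnerProductSpace ℝ E := InnerProductSpace.rclikeToReal ℂ E
  have h1 := hs.hasFDerivAt.restrictScalars ℝ
  have h2 := (h1.norm_sq).log (by simpa using h0)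
  rw [h2.fderiv]
  simp [real_inner_eq_re_inner ℂ, inner_smul_right]
  ring

/-- The direction `ξ` is kept general because the Laplacian is the sum of the cases `ξ = 1` and `ξ =
I`. -/
theorem laplacian_log_norm_sq_aux {s s1 : ℂ → E} {s2 : E} {z : ℂ}
    (hs : ∀ᶠ w in 𝓝 z, HasDerivAt s (s1 w) w) (hs1 : HasDerivAt s1 s2 z) (h0 : s z ≠ 0)
    (hc : ContDiffAt ℝ 2 (fun w => Real.log (‖s w‖ ^ 2)) z) (ξ : ℂ) :
    iteratedFDeriv ℝ 2 (fun w => Real.log (‖s w‖ ^ 2)) z ![ξ, ξ]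
      = 2 * ((inner ℂ (s z) (ξ ^ 2 • s2)).re + ‖ξ • s1 z‖ ^ 2) / ‖s z‖ ^ 2
        - (2 * (inner ℂ (s z) (ξ • s1 z)).re) ^ 2 / ‖s z‖ ^ 4 := by
  let _ : InnerProductSpace ℝ E := InnerProductSpace.rclikeToReal ℂ E
  have hz := hs.self_of_nhds
  have hne : ∀ᶠ w in 𝓝 z, s w ≠ 0 := hz.continuousAt.eventually_ne h0
  set f := fun w => Real.log (‖s w‖ ^ 2) with hf
  have hd : DifferentiableAt ℝ (fderiv ℝ f) z :=
    (hc.fderiv_right (m := 1) (by norm_num)).differentiableAt (by norm_num)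
  have e1 : iteratedFDeriv ℝ 2 f z ![ξ, ξ] = fderiv ℝ (fun w => fderiv ℝ f w ξ) z ξ := by
    rw [iteratedFDeriv_two_apply, fderiv_clm_apply hd (by fun_prop)]
    simp
  have e2 : (fun w => fderiv ℝ f w ξ) =ᶠ[𝓝 z]
      fun w => 2 * (inner ℝ (s w) (ξ • s1 w)) / ‖s w‖ ^ 2 := by
    filter_upwards [hs, hne] with w h1 h2
    rw [hf, fderiv_log_norm_sq h1 h2, real_inner_eq_re_inner ℂ]
    rfl
  have h1 := hz.hasFDerivAt.restrictScalars ℝ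
  have h2 := (hs1.const_smul ξ).hasFDerivAt.restrictScalars ℝ
  have hn : ‖s z‖ ≠ 0 := norm_ne_zero_iff.2 h0
  have h3 := ((h1.inner ℝ h2).const_mul 2).mul
    ((hasDerivAt_inv (pow_ne_zero 2 hn)).comp_hasFDerivAt z h1.norm_sq)
  rw [e1, e2.fderiv_eq]
  have h4 := congrArg (fun L => L ξ) h3.fderiv
  refine Eq.trans ?_ (h4.trans ?_)
  · congr 2
  have h5 : (inner ℂ (ξ • s1 z) (ξ • s1 z)).re = ‖ξ • s1 z‖ ^ 2 :=
    (norm_sq_eq_re_inner (𝕜 := ℂ) _).symm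
  simp [real_inner_eq_re_inner ℂ, -inner_self_eq_norm_sq_to_K,
    h5, pow_two ξ, mul_smul]
  simp only [inner_smul_right, Complex.mul_re, Complex.mul_im]
  field_simp
  ring

theorem ddbar_log_norm_sq {s s1 : ℂ → E} {s2 : E} {z : ℂ}
    (hs : ∀ᶠ w in 𝓝 z, HasDerivAt s (s1 w) w) (hs1 : HasDerivAt s1 s2 z) (h0 : s z ≠ 0)
    (hc : ContDiffAt ℝ ∞ (fun w => Real.log (‖s w‖ ^ 2)) z) :
    ddbar (fun w => Real.log (‖s w‖ ^ 2)) z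
      = (‖s z‖ ^ 2 * ‖s1 z‖ ^ 2 - ‖inner ℂ (s z) (s1 z)‖ ^ 2) / ‖s z‖ ^ 4 := by
  have hc' := hc.of_le two_le_infty
  have hn : ‖s z‖ ≠ 0 := norm_ne_zero_iff.2 h0
  rw [ddbar, InnerProductSpace.laplacian_eq_iteratedFDeriv_complexPlane]
  beta_reduce
  -- The term with `s2` carries the factor `ξ ^ 2`, so it cancels between the two directions. What
  -- remains is a Gram determinant.
  rw [laplacian_log_norm_sq_aux hs hs1 h0 hc' 1, laplacian_log_norm_sq_aux hs hs1 h0 hc' Complex.I,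
    ← Complex.normSq_eq_norm_sq, Complex.normSq_apply]
  simp [norm_smul]
  field_simp
  ring

theorem ddbar_log_norm_sq_of_contDiffAt {s : ℂ → E} {s' : E} {z : ℂ} (hs : ContDiffAt ℂ ∞ s z)
    (hd : HasDerivAt s s' z) (h0 : s z ≠ 0) :
    ddbar (fun w => Real.log (‖s w‖ ^ 2)) z
      = (‖s z‖ ^ 2 * ‖s'‖ ^ 2 - ‖inner ℂ (s z) s'‖ ^ 2) / ‖s z‖ ^ 4 := by
  have hs2 : ContDiffAt ℂ 2 s z := hs.of_le two_le_infty
  have h1 : ∀ᶠ w in 𝓝 z, HasDerivAt s (deriv s w) w := by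
    filter_upwards [hs2.eventually (by simp)] with w hw
    exact (hw.differentiableAt (by norm_num)).hasDerivAt
  have h2 : DifferentiableAt ℂ (deriv s) z := by
    have h3 : DifferentiableAt ℂ (fderiv ℂ s) z :=
      (hs2.fderiv_right (m := 1) (by norm_num)).differentiableAt (by norm_num)
    exact h3.clm_apply (differentiableAt_const (1 : ℂ))
  have h4 : ContDiffAt ℝ ∞ (fun w => Real.log (‖s w‖ ^ 2)) z :=
    (contDiffAt_norm_sq_comp hs).log (pow_ne_zero 2 (norm_ne_zero_iff.2 h0))
  rw [ddbar_log_norm_sq h1 h2.hasDerivAt h0 h4, hd.deriv]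

end DDbar

/-! ### Holomorphic sections given by multilinear maps of the columns. -/

section Multilinear

/-- Expanding the arguments in the standard basis gives a finite sum, so no finiteness of the target
is needed. -/
theorem multilinearMap_continuous_of_pi {k N : ℕ} {E : Type*} [NormedAddCommGroup E]
    [NormedSpace ℂ E] (M : MultilinearMap ℂ (fun _ : Fin k => Fin N → ℂ) E) : Continuous M := by
  have h : (M : (Fin k → Fin N → ℂ) → E) = fun x => ∑ r : Fin k → Fin N,
      (∏ j, x j (r j)) • M (fun j => Pi.single (r j) 1) := by
    funext x
    have h1 : x = fun j => ∑ a, x j a • (Pi.single a (1 : ℂ) : Fin N → ℂ) := by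
      funext j
      exact pi_eq_sum_univ' (x j)
    conv_lhs => rw [h1]
    rw [M.map_sum]
    exact Finset.sum_congr rfl fun r _ => M.map_smul_univ _ _
  rw [h]
  fun_prop

variable {k N : ℕ} {E : Type*} [NormedAddCommGroup E] [NormedSpace ℂ E]

theorem contDiffAt_multilinearMap_comp
    (M : MultilinearMap ℂ (fun _ : Fin k => Fin N → ℂ) E) {x : ℂ → Fin k → Fin N → ℂ} {z : ℂ}
    (hx : ∀ j a, AnalyticAt ℂ (fun w => x w j a) z) :
    ContDiffAt ℂ ∞ (fun w => M (x w)) z := by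
  have h1 : ContDiffAt ℂ ∞ x z :=
    contDiffAt_pi.2 fun j => contDiffAt_pi.2 fun a => (hx j a).contDiffAt
  exact ContDiffAt.comp z
    (ContinuousMultilinearMap.contDiff ⟨M, multilinearMap_continuous_of_pi M⟩).contDiffAt h1

theorem hasDerivAt_multilinearMap_comp
    (M : MultilinearMap ℂ (fun _ : Fin k => Fin N → ℂ) E) {x : ℂ → Fin k → Fin N → ℂ} {z : ℂ}
    {x' : Fin k → Fin N → ℂ} (hx : ∀ j a, HasDerivAt (fun w => x w j a) (x' j a) z) :
    HasDerivAt (fun w => M (x w)) (∑ j, M (Function.update (x z) j (x' j))) z := by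
  have h1 : HasDerivAt x x' z :=
    hasDerivAt_pi.2 fun j => hasDerivAt_pi.2 fun a => hx j a
  have h2 := (ContinuousMultilinearMap.hasFDerivAt
    ⟨M, multilinearMap_continuous_of_pi M⟩ (x z)).comp_hasDerivAt z h1
  rw [ContinuousMultilinearMap.linearDeriv_apply] at h2
  exact h2

end Multilinear

/-! ### Pullbacks of Fubini–Study forms. -/

section FubiniStudy
open Filter Topology

variable {S : Type*} [TopologicalSpace S]
variable {E : Type*} [AddCommGroup E] [Module ℂ E]

/-- The potential is unchanged when a representative is rescaled, so the chosen representatives may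
be replaced by the section `s`. The denominator then contributes `log |ℓ(s)|` with `ℓ(s)`
holomorphic and nonzero, which is harmonic. -/
theorem fsForm_eq (H : InnerProductSpace.Core ℂ E) (F : S → ℙ ℂ E) (c : OpenPartialHomeomorph S ℂ)
    {z : ℂ} {s : ℂ → E}
    (hs : ∀ᶠ w in 𝓝 z, ∃ h, F (c.symm w) = Projectivization.mk ℂ (s w) h)
    (hl : ∀ v, AnalyticAt ℂ (fun w => H.inner v (s w)) z)
    (hc : ContDiffAt ℝ ∞ (fun w => Real.log (H.inner (s w) (s w)).re) z) :
    fsForm H F c z = ddbar (fun w => Real.log (H.inner (s w) (s w)).re) z := by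
  let _ : InnerProductSpace.Core ℂ E := H
  have rep : ∀ w, (∃ h, F (c.symm w) = Projectivization.mk ℂ (s w) h) →
      ∃ a : ℂ, a ≠ 0 ∧ (F (c.symm w)).rep = a • s w ∧ s w ≠ 0 := by
    rintro w ⟨h, hw⟩
    obtain ⟨a, ha⟩ := Projectivization.exists_smul_eq_mk_rep ℂ (s w) h
    exact ⟨a, a.ne_zero, by rw [hw, ← ha]; rfl, h⟩
  obtain ⟨a₀, ha₀, hr₀, hz⟩ := rep z hs.self_of_nhds
  set P := F (c.symm z) with hP
  have hpos : ∀ v : E, v ≠ 0 → H.inner v v ≠ 0 := fun v hv h => hv (H.definite v h)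
  have hℓ0 : H.inner P.rep (s z) ≠ 0 := by
    rw [hr₀, H.smul_left]
    exact mul_ne_zero (by simpa using ha₀) (hpos _ hz)
  have hev : (fun w => fsPotential H P (F (c.symm w))) =ᶠ[𝓝 z] fun w =>
      Real.log (H.inner (s w) (s w)).re + (-2) * Real.log ‖H.inner P.rep (s w)‖ := by
    filter_upwards [hs, (hl P.rep).continuousAt.eventually_ne hℓ0] with w hw hw0
    obtain ⟨a, ha, hr, hsw⟩ := rep w hw
    have hre : (H.inner (s w) (s w)).re ≠ 0 := by
      intro h0
      apply hpos _ hsw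
      have him : (H.inner (s w) (s w)).im = 0 := InnerProductSpace.Core.inner_self_im (𝕜 := ℂ) (s w)
      exact Complex.ext h0 him
    have e1 : H.inner P.rep (a • s w) = a * H.inner P.rep (s w) :=
      InnerProductSpace.Core.inner_smul_right (𝕜 := ℂ) _ _
    have e2 : (H.inner (a • s w) (a • s w)).re = ‖a‖ ^ 2 * (H.inner (s w) (s w)).re := by
      have e3 : H.inner (s w) (a • s w) = a * H.inner (s w) (s w) :=
        InnerProductSpace.Core.inner_smul_right (𝕜 := ℂ) _ _
      rw [H.smul_left, e3, ← mul_assoc, Complex.conj_mul', ← Complex.ofReal_pow,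
        Complex.re_ofReal_mul]
    have ha' : ‖a‖ ≠ 0 := norm_ne_zero_iff.2 ha
    have hn : ‖H.inner P.rep (s w)‖ ≠ 0 := norm_ne_zero_iff.2 hw0
    rw [fsPotential, hr, e1, e2, norm_mul, mul_pow, mul_div_mul_left _ _ (pow_ne_zero 2 ha'),
      Real.log_div hre (pow_ne_zero 2 hn), Real.log_pow]
    push_cast
    ring
  rw [fsForm, ← hP, ddbar_congr hev, ddbar_add hc, ddbar_const_mul, ddbar_log_norm (hl _) hℓ0]
  · ring
  · exact contDiffAt_log_norm (hl _) hℓ0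
  · exact contDiffAt_const.mul (contDiffAt_log_norm (hl _) hℓ0)

/-- The data of a holomorphic section of multilinear type over a projective curve. -/
theorem fsForm_multilinear (H : InnerProductSpace.Core ℂ E) (F : S → ℙ ℂ E)
    (c : OpenPartialHomeomorph S ℂ) {z : ℂ} {k N : ℕ}
    (M : MultilinearMap ℂ (fun _ : Fin k => Fin N → ℂ) E) {x : ℂ → Fin k → Fin N → ℂ}
    (hx : ∀ j a, AnalyticAt ℂ (fun w => x w j a) z)
    (hs : ∀ᶠ w in 𝓝 z, ∃ h, F (c.symm w) = Projectivization.mk ℂ (M (x w)) h) :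
    ContDiffAt ℝ ∞ (fun w => Real.log (H.inner (M (x w)) (M (x w))).re) z ∧
    fsForm H F c z = ddbar (fun w => Real.log (H.inner (M (x w)) (M (x w))).re) z ∧
    ∀ x' : Fin k → Fin N → ℂ, (∀ j a, HasDerivAt (fun w => x w j a) (x' j a) z) →
      ∀ s' : E, s' = ∑ j, M (Function.update (x z) j (x' j)) →
      fsForm H F c z = ((H.inner (M (x z)) (M (x z))).re * (H.inner s' s').re
        - ‖H.inner (M (x z)) s'‖ ^ 2) / (H.inner (M (x z)) (M (x z))).re ^ 2 := by
  let _ : NormedAddCommGroup E := H.toNormedAddCommGroup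
  let _ : InnerProductSpace ℂ E := InnerProductSpace.ofCore H.toCore
  have hin : ∀ v : E, (H.inner v v).re = ‖v‖ ^ 2 := fun v => (norm_sq_eq_re_inner (𝕜 := ℂ) v).symm
  have h0 : M (x z) ≠ 0 := hs.self_of_nhds.choose
  have hcd := contDiffAt_multilinearMap_comp M hx
  have hc : ContDiffAt ℝ ∞ (fun w => Real.log (H.inner (M (x w)) (M (x w))).re) z := by
    simp only [hin]
    exact (contDiffAt_norm_sq_comp hcd).log (pow_ne_zero 2 (norm_ne_zero_iff.2 h0))
  have hl : ∀ v, AnalyticAt ℂ (fun w => H.inner v (M (x w))) z := by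
    intro v
    have h1 : ContDiffAt ℂ ∞ (fun w => H.inner v (M (x w))) z :=
      (innerSL ℂ v).contDiff.contDiffAt.comp z hcd
    have h2 : ∀ᶠ w in 𝓝 z, DifferentiableAt ℂ (fun w => H.inner v (M (x w))) w := by
      filter_upwards [(h1.of_le two_le_infty).eventually (by simp)] with w hw
      exact hw.differentiableAt (by norm_num)
    exact Complex.analyticAt_iff_eventually_differentiableAt.2 h2
  have hfs := fsForm_eq H F c hs hl hc
  refine ⟨hc, hfs, ?_⟩
  rintro x' hx' s' rfl
  rw [hfs]
  simp only [hin]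
  rw [ddbar_log_norm_sq_of_contDiffAt hcd (hasDerivAt_multilinearMap_comp M hx') h0, ← pow_mul]

end FubiniStudy
-- The distribution and the simple roots.
section LieAlgebra

variable {n : ℕ}

theorem mem_stdFlag_iff {k : ℕ} {v : V n} :
    v ∈ stdFlag n k ↔ ∀ a : Fin (2 * n + 1), k ≤ a.val → v a = 0 := by
  constructor
  · intro hv a ha
    have h : stdFlag n k ≤ LinearMap.ker (LinearMap.proj a : V n →ₗ[ℂ] ℂ) := by
      refine Submodule.span_le.2 ?_
      rintro _ ⟨j, hj, rfl⟩
      have : a ≠ j := by rintro rfl; omega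
      simp [this]
    exact h hv
  · intro h
    rw [pi_eq_sum_univ' v]
    refine Submodule.sum_mem _ fun a _ => ?_
    by_cases ha : k ≤ a.val
    · rw [h a ha, zero_smul]; exact Submodule.zero_mem _
    · exact Submodule.smul_mem _ _ (Submodule.subset_span ⟨a, by omega, rfl⟩)

theorem single_mem_stdFlag (a : Fin (2 * n + 1)) :
    (Pi.single a 1 : V n) ∈ stdFlag n (a.val + 1) :=
  Submodule.subset_span ⟨a, by omega, rfl⟩

theorem apply_eq_zero_of_mem_borelSL {g : SL n} (hg : g ∈ borelSL n) {a b : Fin (2 * n + 1)}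
    (h : b < a) : g.1 a b = 0 := by
  have h1 : Matrix.toLin' g.1 (Pi.single b 1) ∈ stdFlag n (b.val + 1) := by
    rw [← hg (b.val + 1)]
    exact Submodule.mem_map_of_mem (single_mem_stdFlag b)
  have h2 := mem_stdFlag_iff.1 h1 a (by have := Fin.lt_def.1 h; omega)
  simpa using h2

theorem mem_borelLie_iff {X : Mat n} :
    X ∈ borelLie n ↔ X ∈ so n ∧ ∀ a b, b < a → X a b = 0 := by
  refine and_congr_right fun _ => ⟨fun h a b hab => ?_, fun h k => ?_⟩
  · have h1 := h (b.val + 1) (Submodule.mem_map_of_mem (single_mem_stdFlag b))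
    have h2 := mem_stdFlag_iff.1 h1 a (by have := Fin.lt_def.1 hab; omega)
    simpa using h2
  · rintro _ ⟨v, hv, rfl⟩
    have hv' := mem_stdFlag_iff.1 hv
    refine mem_stdFlag_iff.2 fun a ha => ?_
    rw [Matrix.toLin'_apply]
    refine (Finset.sum_eq_zero fun b _ => ?_ : ∑ b, X a b * v b = 0)
    by_cases hb : k ≤ b.val
    · rw [hv' b hb, mul_zero]
    · rw [h a b (Fin.lt_def.2 (by omega)), zero_mul]

theorem transpose_mul_gram (X : Mat n) (a b : Fin (2 * n + 1)) :
    (X.transpose * gram n) a b = X (Fin.rev b) a := by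
  rw [Matrix.mul_apply, Finset.sum_eq_single (Fin.rev b)]
  · simp [gram]
  · intro c _ hc
    have : b ≠ Fin.rev c := by rintro rfl; simp at hc
    simp [gram, this]
  · simp

theorem gram_mul (X : Mat n) (a b : Fin (2 * n + 1)) :
    (gram n * X) a b = X (Fin.rev a) b := by
  rw [Matrix.mul_apply, Finset.sum_eq_single (Fin.rev a)]
  · simp [gram]
  · intro c _ hc
    simp [gram, hc]
  · simp

theorem mul_gram (X : Mat n) (a b : Fin (2 * n + 1)) :
    (X * gram n) a b = X a (Fin.rev b) := by
  have h := transpose_mul_gram X.transpose a b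
  rwa [Matrix.transpose_transpose] at h

theorem gram_mul_gram : gram n * gram n = 1 := by
  ext a b
  rw [gram_mul]
  simp [gram, Matrix.one_apply, eq_comm]

theorem mem_so_iff {X : Mat n} : X ∈ so n ↔ ∀ a b, X (Fin.rev b) a + X (Fin.rev a) b = 0 := by
  constructor
  · intro h a b
    have h1 := congrFun (congrFun h a) b
    rwa [Matrix.add_apply, transpose_mul_gram, gram_mul] at h1
  · intro h
    ext a b
    rw [Matrix.add_apply, transpose_mul_gram, gram_mul]
    exact h a b

/-- The root vector `E_{ab} - E_{b'a'}` of `𝔰𝔬(2n+1)`, where `a' = 2n - a`. -/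
def rootVec (a b : Fin (2 * n + 1)) : Mat n :=
  Matrix.single a b 1 - Matrix.single (Fin.rev b) (Fin.rev a) 1

/-- A regular element of the diagonal Cartan subalgebra of `𝔰𝔬(2n+1)`. -/
def regularElt (n : ℕ) : Mat n := Matrix.diagonal fun a => (n : ℂ) - a.val

theorem rootVec_mem_borelLie {a b : Fin (2 * n + 1)} (h : a < b) : rootVec a b ∈ borelLie n := by
  refine mem_borelLie_iff.2 ⟨mem_so_iff.2 fun i j => ?_, fun i j hij => ?_⟩
  · simp only [rootVec, Matrix.sub_apply, Matrix.single_apply]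
    have e1 : (a = Fin.rev j ∧ b = i) ↔ (Fin.rev b = Fin.rev i ∧ Fin.rev a = j) := by
      constructor
      · rintro ⟨rfl, rfl⟩; simp
      · rintro ⟨h1, rfl⟩; simpa using Fin.rev_injective h1
    have e2 : (Fin.rev b = Fin.rev j ∧ Fin.rev a = i) ↔ (a = Fin.rev i ∧ b = j) := by
      constructor
      · rintro ⟨h1, rfl⟩; simpa using Fin.rev_injective h1
      · rintro ⟨rfl, rfl⟩; simp
    simp only [e1, e2]
    ring
  · have h1 : ¬ (a = i ∧ b = j) := by rintro ⟨rfl, rfl⟩; exact absurd h (not_lt.2 hij.le)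
    have h2 : ¬ (Fin.rev b = i ∧ Fin.rev a = j) := by
      rintro ⟨rfl, rfl⟩
      exact absurd (Fin.rev_lt_rev.1 hij) (not_lt.2 h.le)
    simp [rootVec, h1, h2]

theorem regularElt_mem_borelLie : regularElt n ∈ borelLie n := by
  refine mem_borelLie_iff.2 ⟨mem_so_iff.2 fun i j => ?_, fun i j hij => ?_⟩
  · simp only [regularElt, Matrix.diagonal_apply]
    by_cases h : Fin.rev j = i
    · have h' : Fin.rev i = j := by rw [← h, Fin.rev_rev]
      rw [if_pos h, if_pos h', ← h, Fin.rev_rev]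
      have : (j.val : ℂ) + (Fin.rev j).val = 2 * n := by
        have h3 : j.val + (Fin.rev j).val = 2 * n := by simp [Fin.val_rev]; omega
        exact_mod_cast congrArg (Nat.cast : ℕ → ℂ) h3
      linear_combination -this
    · have h' : ¬ Fin.rev i = j := by rintro rfl; simp at h
      rw [if_neg h, if_neg h', add_zero]
  · exact Matrix.diagonal_apply_ne _ hij.ne'

theorem regularElt_lie_rootVec {a b : Fin (2 * n + 1)} :
    ⁅regularElt n, rootVec a b⁆ = ((b.val : ℂ) - a.val) • rootVec a b := by
  have hr : ∀ c : Fin (2 * n + 1), ((Fin.rev c).val : ℂ) = 2 * n - c.val := by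
    intro c
    have h3 : (Fin.rev c).val + c.val = 2 * n := by simp [Fin.val_rev]; omega
    have h4 : ((Fin.rev c).val : ℂ) + c.val = 2 * n := by exact_mod_cast h3
    linear_combination h4
  ext i j
  simp only [Ring.lie_def, Matrix.sub_apply, regularElt, Matrix.diagonal_mul, Matrix.mul_diagonal,
    Matrix.smul_apply, smul_eq_mul, rootVec, Matrix.single_apply]
  by_cases h1 : a = i ∧ b = j <;> by_cases h2 : Fin.rev b = i ∧ Fin.rev a = j <;>
    simp only [h1, h2, if_true, if_false, and_self]
  · ring
  · obtain ⟨rfl, rfl⟩ := h1; ring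
  · obtain ⟨rfl, rfl⟩ := h2; rw [hr, hr]; ring
  · ring

/-- A root vector is an eigenvector of the regular element with nonzero eigenvalue `b - a`, hence
lies in `[𝔟, 𝔟]`. -/
theorem lie_rootVec_mem_borelLie {X : Mat n} (hX : X ∈ distN n) {a b : Fin (2 * n + 1)}
    (h : a < b) (i j : Fin (2 * n + 1)) (hij : j < i) : ⁅X, rootVec a b⁆ i j = 0 := by
  have h1 := (mem_borelLie_iff.1
    (hX.2 _ regularElt_mem_borelLie _ (rootVec_mem_borelLie h))).2 i j hij
  have e : ∀ (t : ℂ) (Z : Mat n), ⁅X, t • Z⁆ = t • ⁅X, Z⁆ := fun t Z => by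
    simp only [Ring.lie_def, Matrix.mul_smul, Matrix.smul_mul, smul_sub]
  rw [regularElt_lie_rootVec, e, Matrix.smul_apply, smul_eq_mul] at h1
  refine (mul_eq_zero.1 h1).resolve_left fun h0 => ?_
  have h2 : (b.val : ℂ) = a.val := sub_eq_zero.1 h0
  exact absurd (Fin.ext (by exact_mod_cast h2) : b = a) h.ne'

theorem lie_rootVec_apply (X : Mat n) (a b i j : Fin (2 * n + 1)) :
    ⁅X, rootVec a b⁆ i j = (if b = j then X i a else 0) - (if Fin.rev a = j then X i (Fin.rev b) else 0)
      - (if a = i then X b j else 0) + (if Fin.rev b = i then X (Fin.rev a) j else 0) := by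
  have h1 : ∀ c d : Fin (2 * n + 1), (X * Matrix.single c d (1 : ℂ)) i j
      = if d = j then X i c else 0 := by
    intro c d
    by_cases h : d = j
    · subst h; simp
    · simp [h, Matrix.mul_single_apply_of_ne, Ne.symm h]
  have h2 : ∀ c d : Fin (2 * n + 1), (Matrix.single c d (1 : ℂ) * X) i j
      = if c = i then X d j else 0 := by
    intro c d
    by_cases h : c = i
    · subst h; simp
    · simp [h, Matrix.single_mul_apply_of_ne, Ne.symm h]
  simp only [Ring.lie_def, rootVec, mul_sub, sub_mul, Matrix.sub_apply, h1, h2]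
  ring

/-- The elements of the distribution `𝒩(B)` only have components along the negatives of the simple
roots modulo `𝔟`. -/
theorem apply_eq_zero_of_mem_distN {X : Mat n} (hX : X ∈ distN n) {i j : Fin (2 * n + 1)}
    (h : j.val + 1 < i.val) : X i j = 0 := by
  have hi := i.isLt
  -- A bracket with a simple root vector moves the entry `(i, j)` one step towards the diagonal, and
  -- it still lies below. The default choice moves it to column `j + 1`, but if `i + j = 2n - 1` the
  -- second half of the root vector reaches the same entry; then it is moved to row `i - 1` instead.
  by_cases hc : i.val + j.val = 2 * n - 1
  · have h1 := lie_rootVec_mem_borelLie hX (a := ⟨i.val - 1, by omega⟩) (b := i)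
      (Fin.lt_def.2 (by change i.val - 1 < i.val; omega)) ⟨i.val - 1, by omega⟩ j (Fin.lt_def.2 (by simp; omega))
    have n1 : ¬ i = j := by rintro rfl; omega
    have n2 : ¬ Fin.rev (⟨i.val - 1, by omega⟩ : Fin (2 * n + 1)) = j := fun h => by
      have := congrArg Fin.val h; simp [Fin.val_rev] at this; omega
    have n3 : ¬ Fin.rev i = ⟨i.val - 1, by omega⟩ := fun h => by
      have := congrArg Fin.val h; simp [Fin.val_rev] at this; omega
    simpa [lie_rootVec_apply, n1, n2, n3] using h1
  · have h1 := lie_rootVec_mem_borelLie hX (a := j) (b := ⟨j.val + 1, by omega⟩)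
      (Fin.lt_def.2 (by simp)) i ⟨j.val + 1, by omega⟩ (Fin.lt_def.2 (by simpa using h))
    have n1 : ¬ j = i := by rintro rfl; omega
    have n2 : ¬ Fin.rev j = ⟨j.val + 1, by omega⟩ := fun h => by
      have := congrArg Fin.val h; simp [Fin.val_rev] at this; omega
    have n3 : ¬ Fin.rev (⟨j.val + 1, by omega⟩ : Fin (2 * n + 1)) = i := fun h => by
      have := congrArg Fin.val h; simp [Fin.val_rev] at this; omega
    simpa [lie_rootVec_apply, n1, n2, n3] using h1

end LieAlgebra

/-! ### The Iwasawa decomposition. -/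

section Iwasawa

variable {n : ℕ}

theorem mem_SO_iff {g : SL n} : g ∈ SO n ↔ g.1.transpose * gram n * g.1 = gram n := Iff.rfl

theorem SO_coe_mul (a b : SO n) : (a * b).1.1 = a.1.1 * b.1.1 := rfl

theorem SL_coe_inv_mul (a : SL n) : (a⁻¹).1 * a.1 = 1 := congrArg Subtype.val (inv_mul_cancel a)

theorem SL_coe_mul_inv (a : SL n) : a.1 * (a⁻¹).1 = 1 := congrArg Subtype.val (mul_inv_cancel a)

theorem diag_mul_of_isUpper {N : ℕ} {a b : Matrix (Fin N) (Fin N) ℂ} (ha : a.BlockTriangular id)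
    (hb : b.BlockTriangular id) (i : Fin N) : (a * b) i i = a i i * b i i := by
  rw [Matrix.mul_apply, Finset.sum_eq_single i]
  · intro c _ hc
    rcases lt_or_gt_of_ne hc with h | h
    · rw [ha h, zero_mul]
    · rw [hb h, mul_zero]
  · simp

theorem diag_ne_zero_of_isUpper {N : ℕ} {b : Matrix (Fin N) (Fin N) ℂ} (hb : b.BlockTriangular id)
    (hd : b.det ≠ 0) (i : Fin N) : b i i ≠ 0 := by
  rw [Matrix.det_of_isUpperTriangular hb] at hd
  exact (Finset.prod_ne_zero_iff.1 hd) i (Finset.mem_univ i)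

theorem isUpper_inv {N : ℕ} {b c : Matrix (Fin N) (Fin N) ℂ} (hb : b.BlockTriangular id)
    (h : c * b = 1) : c.BlockTriangular id := by
  have : Invertible b := invertibleOfLeftInverse b c h
  have h1 : c = b⁻¹ := (Matrix.inv_eq_left_inv h).symm
  rw [h1]
  exact Matrix.blockTriangular_inv_of_blockTriangular hb

/-- The QR decomposition, with positive diagonal. -/
theorem exists_unitary_mul_upper {N : ℕ} (g : Matrix (Fin N) (Fin N) ℂ) (hg : g.det ≠ 0) :
    ∃ q ∈ Matrix.unitaryGroup (Fin N) ℂ, ∃ b : Matrix (Fin N) (Fin N) ℂ, b.BlockTriangular id ∧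
      (∀ i, ∃ r : ℝ, 0 < r ∧ b i i = r) ∧ g = q * b := by
  let f : Fin N → EuclideanSpace ℂ (Fin N) := fun j => WithLp.toLp 2 fun a => g a j
  let e := InnerProductSpace.gramSchmidtOrthonormalBasis (𝕜 := ℂ) (by simp) f
  let q : Matrix (Fin N) (Fin N) ℂ := Matrix.of fun a i => e i a
  let b : Matrix (Fin N) (Fin N) ℂ := Matrix.of fun i j => inner ℂ (e i) (f j)
  have hb : b.BlockTriangular id := fun i j hij =>
    InnerProductSpace.gramSchmidtOrthonormalBasis_inv_triangular (𝕜 := ℂ) (by simp) f hij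
  have hq : q ∈ Matrix.unitaryGroup (Fin N) ℂ := by
    rw [Matrix.mem_unitaryGroup_iff']
    ext i j
    have h1 := orthonormal_iff_ite.1 e.orthonormal i j
    rw [PiLp.inner_apply] at h1
    simpa [Matrix.mul_apply, Matrix.star_apply, q, Matrix.one_apply, mul_comm] using h1
  have hgq : g = q * b := by
    ext a j
    have h1 := congrArg (fun v : EuclideanSpace ℂ (Fin N) => v a) (e.sum_repr' (f j))
    simp only [WithLp.ofLp_sum, Finset.sum_apply] at h1
    rw [Matrix.mul_apply]
    simpa [f, q, b, mul_comm] using h1.symm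
  have hbd : b.det ≠ 0 := by
    rw [hgq, Matrix.det_mul] at hg
    exact right_ne_zero_of_mul hg
  have hd := diag_ne_zero_of_isUpper hb hbd
  -- The phases of the diagonal of `b`, to be moved into the unitary factor.
  let u : Fin N → ℂ := fun i => b i i / ‖b i i‖
  have hu : ∀ i, u i * star (u i) = 1 := fun i => by
    have h1 : (‖b i i‖ : ℂ) ≠ 0 := by exact_mod_cast norm_ne_zero_iff.2 (hd i)
    change u i * (starRingEnd ℂ) (u i) = 1
    rw [Complex.mul_conj']
    simp only [u, norm_div, Complex.norm_real, norm_norm]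
    rw [div_self (norm_ne_zero_iff.2 (hd i))]
    simp
  have hu' : ∀ i, star (u i) * u i = 1 := fun i => by rw [mul_comm, hu]
  have hud : Matrix.diagonal (fun i => u i * star u i) = (1 : Matrix (Fin N) (Fin N) ℂ) := by
    have h1 : (fun i => u i * star u i) = fun _ => 1 := funext hu
    rw [h1, Matrix.diagonal_one]
  refine ⟨q * Matrix.diagonal u, ?_, Matrix.diagonal (star u) * b, ?_, ?_, ?_⟩
  · refine mul_mem hq ?_
    rw [Matrix.mem_unitaryGroup_iff, Matrix.star_eq_conjTranspose, Matrix.diagonal_conjTranspose,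
      Matrix.diagonal_mul_diagonal, hud]
  · exact (Matrix.blockTriangular_diagonal _).mul hb
  · intro i
    refine ⟨‖b i i‖, norm_pos_iff.2 (hd i), ?_⟩
    rw [Matrix.diagonal_mul]
    have h1 : (‖b i i‖ : ℂ) ≠ 0 := by exact_mod_cast norm_ne_zero_iff.2 (hd i)
    have h2 : b i i = u i * ‖b i i‖ := by simp only [u]; field_simp
    conv_lhs => rw [h2]
    rw [← mul_assoc, Pi.star_apply, hu', one_mul]
  · rw [Matrix.mul_assoc, ← Matrix.mul_assoc (Matrix.diagonal u), Matrix.diagonal_mul_diagonal, hud,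
      Matrix.one_mul, hgq]

/-- The inverse is both upper triangular and the conjugate transpose, so `q` is diagonal with
positive entries of modulus one. -/
theorem eq_one_of_unitary_of_upper {N : ℕ} {q : Matrix (Fin N) (Fin N) ℂ}
    (hq : q ∈ Matrix.unitaryGroup (Fin N) ℂ) (hu : q.BlockTriangular id)
    (hp : ∀ i, ∃ r : ℝ, 0 < r ∧ q i i = r) : q = 1 := by
  have h1 : (star q).BlockTriangular id := isUpper_inv hu (Matrix.mem_unitaryGroup_iff'.1 hq)
  have h2 : ∀ i j, i < j → q i j = 0 := fun i j hij => by
    have := h1 hij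
    rwa [Matrix.star_apply, star_eq_zero] at this
  ext i j
  rcases lt_trichotomy i j with h | rfl | h
  · rw [h2 i j h, Matrix.one_apply_ne h.ne]
  · obtain ⟨r, hr, hi⟩ := hp i
    have h3 := congrFun (congrFun (Matrix.mem_unitaryGroup_iff'.1 hq) i) i
    rw [diag_mul_of_isUpper h1 hu, Matrix.star_apply, hi, Matrix.one_apply_eq] at h3
    rw [hi, Matrix.one_apply_eq]
    have h4 : r * r = 1 := by
      have : (r : ℂ) * r = 1 := by simpa using h3
      exact_mod_cast this
    have : r = 1 := by nlinarith
    simp [this]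
  · rw [hu h, Matrix.one_apply_ne h.ne']

/-- Multiplication by the Gram matrix on both sides reverses both indices, which compensates the
transposition. -/
theorem isUpper_gram_transpose_gram {b : Mat n} (hb : b.BlockTriangular id) :
    (gram n * b.transpose * gram n).BlockTriangular id := by
  intro i j hij
  rw [mul_gram, gram_mul, Matrix.transpose_apply]
  exact hb (Fin.rev_lt_rev.2 hij)

/-- The Iwasawa decomposition `G = K B`. -/
theorem exists_compact_mul_upper (g : SO n) :
    ∃ k b : SO n, IsCompactElt k ∧ b.1.1.BlockTriangular id ∧ g = k * b := by
  obtain ⟨q, hq, b, hb, hpos, hg⟩ := exists_unitary_mul_upper g.1.1 (by rw [g.1.2]; exact one_ne_zero)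
  have hgs := mem_SO_iff.1 g.2
  have hdet : q.det * b.det = 1 := by rw [← Matrix.det_mul, ← hg, g.1.2]
  have hbd : b.det ≠ 0 := right_ne_zero_of_mul_eq_one hdet
  -- the inverse of `b`
  have hbi : b⁻¹ * b = 1 := Matrix.nonsing_inv_mul b (isUnit_iff_ne_zero.2 hbd)
  have hbi' : b * b⁻¹ = 1 := Matrix.mul_nonsing_inv b (isUnit_iff_ne_zero.2 hbd)
  have hiu : b⁻¹.BlockTriangular id := isUpper_inv hb hbi
  have hip : ∀ i, ∃ r : ℝ, 0 < r ∧ b⁻¹ i i = r := fun i => by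
    obtain ⟨r, hr, hi⟩ := hpos i
    have h1 : b⁻¹ i i * b i i = 1 := by rw [← diag_mul_of_isUpper hiu hb, hbi, Matrix.one_apply_eq]
    refine ⟨r⁻¹, inv_pos.2 hr, ?_⟩
    rw [hi] at h1
    rw [eq_inv_of_mul_eq_one_left h1]
    simp
  set J := gram n with hJ
  have hJJ : J * J = 1 := gram_mul_gram
  set c := J * b⁻¹.transpose * J with hc
  have hcu : c.BlockTriangular id := isUpper_gram_transpose_gram hiu
  -- By `gᵀJg = J` the unitary matrix `J qᵀ J q` is also a product of upper triangular matrices with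
  -- positive diagonal. It is therefore the identity, which says that `q` preserves `Q`: the QR
  -- factors of an orthogonal matrix are orthogonal.
  have hU : J * q.transpose * J * q = c * b⁻¹ := by
    have h1 : q = g.1.1 * b⁻¹ := by rw [hg, Matrix.mul_assoc, hbi', Matrix.mul_one]
    rw [hc, h1, Matrix.transpose_mul]
    calc _ = J * b⁻¹.transpose * (g.1.1.transpose * J * g.1.1) * b⁻¹ := by
          simp only [Matrix.mul_assoc]
      _ = _ := by rw [hgs]
  have hJu : J ∈ Matrix.unitaryGroup (Fin (2 * n + 1)) ℂ := by
    have h1 : star J = J := by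
      ext i j
      simp only [hJ, gram, Matrix.star_apply, Matrix.of_apply]
      by_cases h : j = Fin.rev i
      · subst h; simp
      · have : i ≠ Fin.rev j := by rintro rfl; simp at h
        simp [h, this]
    rw [Matrix.mem_unitaryGroup_iff, h1, hJJ]
  have hqt : q.transpose ∈ Matrix.unitaryGroup (Fin (2 * n + 1)) ℂ := by
    rw [Matrix.mem_unitaryGroup_iff]
    have h1 := congrArg Matrix.transpose (Matrix.mem_unitaryGroup_iff'.1 hq)
    rw [Matrix.transpose_mul, Matrix.transpose_one] at h1
    exact h1
  have h1 : J * q.transpose * J * q = 1 := by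
    refine eq_one_of_unitary_of_upper (mul_mem (mul_mem (mul_mem hJu hqt) hJu) hq) ?_ ?_
    · rw [hU]; exact hcu.mul hiu
    · intro i
      obtain ⟨r, hr, hi⟩ := hip i
      obtain ⟨t, ht, hti⟩ := hip (Fin.rev i)
      refine ⟨t * r, mul_pos ht hr, ?_⟩
      rw [hU, diag_mul_of_isUpper hcu hiu, hi, hc, mul_gram, gram_mul, Matrix.transpose_apply, hti]
      simp
  have hqs : q.transpose * J * q = J := by
    calc _ = (J * J) * q.transpose * J * q := by rw [hJJ, Matrix.one_mul]
      _ = J * (J * q.transpose * J * q) := by simp only [Matrix.mul_assoc]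
      _ = J := by rw [h1, Matrix.mul_one]
  -- `det b` is positive, `det q` has modulus one, and their product is one.
  have hqd : q.det = 1 := by
    choose r hr hbr using hpos
    have h2 : b.det = ((∏ i, r i : ℝ) : ℂ) := by
      rw [Matrix.det_of_isUpperTriangular hb]
      simp [hbr]
    have h3 : ‖q.det‖ = 1 := by
      have h4 := congrArg Matrix.det (Matrix.mem_unitaryGroup_iff.1 hq)
      rw [Matrix.det_mul, Matrix.star_eq_conjTranspose, Matrix.det_conjTranspose,
        Matrix.det_one] at h4
      have h5 := congrArg norm h4
      rw [norm_mul, norm_star, norm_one] at h5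
      nlinarith [norm_nonneg q.det]
    have h6 : ∏ i, r i = 1 := by
      have h7 := congrArg norm hdet
      rw [norm_mul, h3, one_mul, h2, norm_one, Complex.norm_real, Real.norm_eq_abs,
        abs_of_pos (Finset.prod_pos fun i _ => hr i)] at h7
      exact h7
    rw [h2, h6] at hdet
    simpa using hdet
  let k : SO n := ⟨⟨q, hqd⟩, hqs⟩
  refine ⟨k, k⁻¹ * g, hq, ?_, by group⟩
  have h2 : (k⁻¹ * g).1.1 = b := by
    have h3 : (k⁻¹).1.1 * q = 1 := SL_coe_inv_mul k.1
    rw [SO_coe_mul, hg, ← Matrix.mul_assoc, h3, Matrix.one_mul]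
  rw [h2]
  exact hb

end Iwasawa

/-! ### Norms on the graded pieces of a flag. -/

section GradedNorm

variable {n : ℕ}

theorem infDist_submodule_add {E : Type*} [NormedAddCommGroup E] [InnerProductSpace ℂ E]
    (K : Submodule ℂ E) {y v : E} (hy : y ∈ K) (hv : ∀ w ∈ K, inner ℂ w v = 0) :
    Metric.infDist (y + v) K = ‖v‖ := by
  refine le_antisymm ?_ ?_
  · have h := Metric.infDist_le_dist_of_mem (x := y + v) (s := (K : Set E)) hy
    rwa [dist_eq_norm, add_sub_cancel_left] at h
  · refine (Metric.le_infDist ⟨y, hy⟩).2 fun w hw => ?_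
    rw [dist_eq_norm, add_sub_right_comm]
    have h := norm_add_sq_eq_norm_sq_add_norm_sq_of_inner_eq_zero (𝕜 := ℂ) (y - w) v
      (hv _ (K.sub_mem hy hw))
    nlinarith [norm_nonneg v, norm_nonneg (y - w + v), mul_self_nonneg ‖y - w‖]

/-- The columns of `q` are an orthonormal basis adapted to the flag of `g`, so only the component of
the `j`-th column of `g` along the `j`-th column of `q` counts. -/
theorem gradedNorm_eq {g : SL n} {q b : Mat n} (hq : q ∈ Matrix.unitaryGroup (Fin (2 * n + 1)) ℂ)
    (hb : b.BlockTriangular id) (hg : g.1 = q * b) (j : Fin (2 * n + 1)) :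
    gradedNorm g j = ‖b j j‖ := by
  have hdet : q.det * b.det = 1 := by rw [← Matrix.det_mul, ← hg, g.2]
  have hbi : b⁻¹ * b = 1 := Matrix.nonsing_inv_mul b (isUnit_iff_ne_zero.2
    (right_ne_zero_of_mul_eq_one hdet))
  have hbi' : b * b⁻¹ = 1 := mul_eq_one_comm.1 hbi
  have hiu : b⁻¹.BlockTriangular id := isUpper_inv hb hbi
  let e : Fin (2 * n + 1) → EuclideanSpace ℂ (Fin (2 * n + 1)) := fun i => WithLp.toLp 2 fun a => q a i
  let f : Fin (2 * n + 1) → EuclideanSpace ℂ (Fin (2 * n + 1)) := fun i => WithLp.toLp 2 fun a => g.1 a i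
  have he : ∀ i l, inner ℂ (e i) (e l) = if i = l then 1 else 0 := fun i l => by
    have h1 := congrFun (congrFun (Matrix.mem_unitaryGroup_iff'.1 hq) i) l
    rw [Matrix.one_apply] at h1
    rw [PiLp.inner_apply, ← h1]
    simp [Matrix.mul_apply, Matrix.star_apply, e, mul_comm]
  have hf : ∀ l, f l = ∑ i, b i l • e i := fun l => by
    ext a
    simp [f, e, hg, Matrix.mul_apply, mul_comm]
  have hef : ∀ i, e i = ∑ l, b⁻¹ l i • f l := fun i => by
    have h1 : q = g.1 * b⁻¹ := by rw [hg, Matrix.mul_assoc, hbi', Matrix.mul_one]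
    ext a
    simp [f, e, Matrix.mul_apply, mul_comm, congrFun (congrFun h1 a) i]
  set K := Submodule.span ℂ {v : EuclideanSpace ℂ (Fin (2 * n + 1)) | ∃ l < j, v = f l} with hK
  have heK : ∀ i < j, e i ∈ K := fun i hi => by
    rw [hef]
    refine Submodule.sum_mem _ fun l _ => ?_
    rcases lt_or_ge l j with h | h
    · exact Submodule.smul_mem _ _ (Submodule.subset_span ⟨l, h, rfl⟩)
    · rw [hiu (lt_of_lt_of_le hi h), zero_smul]
      exact Submodule.zero_mem _
  have hsplit : f j = (∑ i ∈ Finset.univ.erase j, b i j • e i) + b j j • e j := by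
    rw [hf, Finset.sum_erase_add _ _ (Finset.mem_univ j)]
  have hy : ∑ i ∈ Finset.univ.erase j, b i j • e i ∈ K := by
    refine Submodule.sum_mem _ fun i hi => ?_
    rcases lt_or_gt_of_ne (Finset.ne_of_mem_erase hi) with h | h
    · exact Submodule.smul_mem _ _ (heK i h)
    · rw [hb h, zero_smul]
      exact Submodule.zero_mem _
  have hort : ∀ w ∈ K, inner ℂ w (b j j • e j) = 0 := by
    intro w hw
    induction hw using Submodule.span_induction with
    | mem w hw =>
      obtain ⟨l, hl, rfl⟩ := hw
      rw [hf, sum_inner]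
      refine Finset.sum_eq_zero fun i _ => ?_
      rw [inner_smul_left, inner_smul_right, he]
      split_ifs with h
      · rw [h, hb hl]; simp
      · simp
    | zero => simp
    | add x y _ _ hx hy => rw [inner_add_left, hx, hy, add_zero]
    | smul a x _ hx => rw [inner_smul_left, hx, mul_zero]
  have hn : ‖e j‖ = 1 := by
    have h1 := norm_sq_eq_re_inner (𝕜 := ℂ) (e j)
    rw [he, if_pos rfl] at h1
    have h2 : ‖e j‖ ^ 2 = 1 := by simpa using h1
    nlinarith [norm_nonneg (e j)]
  change Metric.infDist (f j) K = _
  rw [hsplit, infDist_submodule_add K hy hort, norm_smul, hn, mul_one]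

theorem exists_unitary_mul_upper_SL (g : SL n) :
    ∃ q ∈ Matrix.unitaryGroup (Fin (2 * n + 1)) ℂ, ∃ b : Mat n, b.BlockTriangular id ∧
      g.1 = q * b := by
  obtain ⟨q, hq, b, hb, -, hg⟩ := exists_unitary_mul_upper g.1 (by rw [g.2]; exact one_ne_zero)
  exact ⟨q, hq, b, hb, hg⟩

theorem gradedNorm_mul {g g' : SL n} {b : Mat n} (hb : b.BlockTriangular id) (h : g'.1 = g.1 * b)
    (j : Fin (2 * n + 1)) : gradedNorm g' j = ‖b j j‖ * gradedNorm g j := by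
  obtain ⟨q, hq, c, hc, hg⟩ := exists_unitary_mul_upper_SL g
  rw [gradedNorm_eq hq hc hg, gradedNorm_eq hq (hc.mul hb) (by rw [h, hg, Matrix.mul_assoc]),
    diag_mul_of_isUpper hc hb, norm_mul, mul_comm]

theorem gradedNorm_pos (g : SL n) (j : Fin (2 * n + 1)) : 0 < gradedNorm g j := by
  obtain ⟨q, hq, b, hb, hg⟩ := exists_unitary_mul_upper_SL g
  have hdet : q.det * b.det = 1 := by rw [← Matrix.det_mul, ← hg, g.2]
  rw [gradedNorm_eq hq hb hg]
  exact norm_pos_iff.2 (diag_ne_zero_of_isUpper hb (right_ne_zero_of_mul_eq_one hdet) j)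

/-- The Iwasawa factor `b` is upper triangular and orthogonal, so the middle entry of `bᵀJb = J`
reads `b_{nn}² = 1`. This is what identifies the forms of index `n` and `n + 1`. -/
theorem gradedNorm_middle (g : SO n) : gradedNorm g.1 (idxU n) = 1 := by
  obtain ⟨k, b, hk, hb, hg⟩ := exists_compact_mul_upper g
  rw [gradedNorm_eq hk hb (by rw [hg]; rfl)]
  have h1 := congrFun (congrFun (mem_SO_iff.1 b.2) (idxU n)) (idxU n)
  have hr : Fin.rev (idxU n) = idxU n := by ext; simp [idxU, Fin.val_rev]; omega
  rw [Matrix.mul_apply, Finset.sum_eq_single (idxU n)] at h1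
  · rw [transpose_mul_gram, hr] at h1
    have h2 : gram n (idxU n) (idxU n) = 1 := by simp [gram, hr]
    rw [h2] at h1
    have h3 := congrArg norm h1
    rw [norm_mul, norm_one] at h3
    nlinarith [norm_nonneg (b.1.1 (idxU n) (idxU n))]
  · intro c _ hc
    rw [transpose_mul_gram]
    rcases lt_or_gt_of_ne hc with h | h
    · have h2 : b.1.1 (Fin.rev c) (idxU n) = 0 :=
        hb (show idxU n < Fin.rev c by rw [← hr]; exact Fin.rev_lt_rev.2 h)
      rw [h2, zero_mul]
    · have h2 : b.1.1 c (idxU n) = 0 := hb h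
      rw [h2, mul_zero]
  · simp

/-- The squared norm of `g b_0 ∧ ⋯ ∧ g b_{k-1}`, as a product of squared norms on the quotients of the
flag. -/
noncomputable def tau (g : SL n) (k : ℕ) : ℝ :=
  ∏ j : Fin (2 * n + 1), if j.val < k then gradedNorm g j ^ 2 else 1

theorem tau_pos (g : SL n) (k : ℕ) : 0 < tau g k := by
  refine Finset.prod_pos fun j _ => ?_
  split_ifs
  · exact pow_pos (gradedNorm_pos g j) 2
  · exact one_pos

theorem tau_zero (g : SL n) : tau g 0 = 1 := by simp [tau]

theorem tau_succ (g : SL n) (j : Fin (2 * n + 1)) :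
    tau g (j.val + 1) = tau g j.val * gradedNorm g j ^ 2 := by
  have h : ∀ l : Fin (2 * n + 1), (if l.val < j.val + 1 then gradedNorm g l ^ 2 else 1)
      = (if l.val < j.val then gradedNorm g l ^ 2 else 1) *
        (if l = j then gradedNorm g l ^ 2 else 1) := by
    intro l
    rcases lt_trichotomy l j with h | rfl | h
    · have h' := Fin.lt_def.1 h
      rw [if_pos (by omega), if_pos h', if_neg h.ne, mul_one]
    · simp
    · have h' := Fin.lt_def.1 h
      rw [if_neg (by omega), if_neg (by omega), if_neg h.ne', mul_one]
  rw [tau, Finset.prod_congr rfl fun l _ => h l, Finset.prod_mul_distrib, tau]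
  simp

theorem tau_eq {g : SL n} {q b : Mat n} (hq : q ∈ Matrix.unitaryGroup (Fin (2 * n + 1)) ℂ)
    (hb : b.BlockTriangular id) (hg : g.1 = q * b) (k : ℕ) :
    tau g k = ‖∏ j : Fin (2 * n + 1), if j.val < k then b j j else 1‖ ^ 2 := by
  rw [norm_prod, ← Finset.prod_pow, tau]
  refine Finset.prod_congr rfl fun j _ => ?_
  rw [gradedNorm_eq hq hb hg]
  split_ifs <;> simp

end GradedNorm
-- Alternating maps of triangular and Hessenberg combinations.
section Alternating

variable {W E : Type*} [AddCommGroup W] [Module ℂ W] [AddCommGroup E] [Module ℂ E]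

/-- Both sides are alternating in the columns of `B`, and such a map on `ℂ^k` is determined by its
value on the standard basis. -/
theorem alternatingMap_matrix {k : ℕ} (f : W [⋀^Fin k]→ₗ[ℂ] E) (x : Fin k → W)
    (B : Matrix (Fin k) (Fin k) ℂ) :
    f (fun j => ∑ i, B i j • x i) = B.det • f x := by
  let L : (Fin k → ℂ) →ₗ[ℂ] W := Fintype.linearCombination ℂ x
  let e := Pi.basisFun ℂ (Fin k)
  let F : (Fin k → ℂ) [⋀^Fin k]→ₗ[ℂ] E := f.compLinearMap L
  let D : (Fin k → ℂ) [⋀^Fin k]→ₗ[ℂ] E :=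
    (LinearMap.toSpanSingleton ℂ E (f x)).compAlternatingMap e.det
  have h1 : ∀ i, L (e i) = x i := fun i => by
    simp [L, e, Fintype.linearCombination_apply, Pi.single_apply]
  have h2 : F = D := by
    refine Module.Basis.ext_alternating e fun v hv => ?_
    let σ : Equiv.Perm (Fin k) := Equiv.ofBijective v (Finite.injective_iff_bijective.1 hv)
    have e1 := F.map_perm e σ
    have e2 := D.map_perm e σ
    have e3 : F e = D e := by
      have e4 : F e = f x := congrArg f (funext h1)
      rw [e4]
      simp [D, e.det_self]
    rw [e3, ← e2] at e1
    exact e1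
  have h3 := congrArg (fun G => G fun j i => B i j) h2
  have h4 : e.det (fun j i => B i j) = B.det := by
    rw [Pi.basisFun_det, ← Matrix.det_transpose]
    rfl
  have h5 : D (fun j i => B i j) = B.det • f x := by
    rw [← h4]
    rfl
  rw [← h5]
  refine Eq.trans ?_ h3
  exact congrArg f (funext fun j => by simp [L, Fintype.linearCombination_apply])

/-- The derivation extending a Hessenberg matrix, applied to `y_0 ∧ ⋯ ∧ y_m`. -/
theorem alternatingMap_hessenberg {m N : ℕ} (f : W [⋀^Fin (m + 1)]→ₗ[ℂ] E) (y : Fin N → W)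
    (hm : m + 1 < N) (A : Matrix (Fin N) (Fin N) ℂ) (hA : ∀ i j, j.val + 1 < i.val → A i j = 0) :
    (∑ j : Fin (m + 1), f (Function.update (fun i => y (Fin.castLE hm.le i)) j
        (∑ a, A a (Fin.castLE hm.le j) • y a)))
      = (∑ j : Fin (m + 1), A (Fin.castLE hm.le j) (Fin.castLE hm.le j)) •
          f (fun i => y (Fin.castLE hm.le i))
        + A ⟨m + 1, hm⟩ ⟨m, by omega⟩ • f (Function.update (fun i => y (Fin.castLE hm.le i))
            (Fin.last m) (y ⟨m + 1, hm⟩)) := by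
  have h1 : ∀ j : Fin (m + 1), f (Function.update (fun i => y (Fin.castLE hm.le i)) j
        (∑ a, A a (Fin.castLE hm.le j) • y a))
      = A (Fin.castLE hm.le j) (Fin.castLE hm.le j) • f (fun i => y (Fin.castLE hm.le i))
        + if j = Fin.last m then A ⟨m + 1, hm⟩ ⟨m, by omega⟩ •
            f (Function.update (fun i => y (Fin.castLE hm.le i)) (Fin.last m) (y ⟨m + 1, hm⟩))
          else 0 := by
    intro j
    rw [f.map_update_sum]
    -- Putting `y_a` in slot `j` repeats a vector unless `a = j` or `a > m`; the Hessenberg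
    -- condition leaves only `a = m + 1`, `j = m` in the second case.
    have h2 : ∀ a : Fin N, f (Function.update (fun i => y (Fin.castLE hm.le i)) j
          (A a (Fin.castLE hm.le j) • y a))
        = (if a = Fin.castLE hm.le j then A (Fin.castLE hm.le j) (Fin.castLE hm.le j) •
            f (fun i => y (Fin.castLE hm.le i)) else 0)
          + if a = ⟨m + 1, hm⟩ then (if j = Fin.last m then A ⟨m + 1, hm⟩ ⟨m, by omega⟩ •
            f (Function.update (fun i => y (Fin.castLE hm.le i)) (Fin.last m) (y ⟨m + 1, hm⟩))
          else 0) else 0 := by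
      intro a
      rw [f.map_update_smul]
      by_cases ha : a.val < m + 1
      · have ha2 : a ≠ ⟨m + 1, hm⟩ := by rintro rfl; simp at ha
        have ha3 : a = Fin.castLE hm.le ⟨a.val, ha⟩ := rfl
        rw [if_neg ha2, add_zero]
        by_cases hj : a = Fin.castLE hm.le j
        · rw [if_pos hj, hj]
          congr 2
          exact Function.update_eq_self j fun i => y (Fin.castLE hm.le i)
        · rw [if_neg hj]
          have h3 : j ≠ ⟨a.val, ha⟩ := by rintro rfl; exact hj rfl
          have h4 := f.map_update_self (fun i => y (Fin.castLE hm.le i)) h3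
          rw [ha3, h4, smul_zero]
      · have hj : a ≠ Fin.castLE hm.le j := by
          rintro rfl; exact ha j.isLt
        rw [if_neg hj, zero_add]
        by_cases ha2 : a = ⟨m + 1, hm⟩
        · subst ha2
          rw [if_pos rfl]
          by_cases hl : j = Fin.last m
          · subst hl
            rw [if_pos rfl]
            rfl
          · rw [if_neg hl, hA _ _ (by
              have : j.val < m := Fin.val_lt_last hl
              simpa using this), zero_smul]
        · rw [if_neg ha2, hA _ _ (by
              have h5 : a.val ≠ m + 1 := fun h => ha2 (Fin.ext h)
              have := j.isLt
              simp only [Fin.val_castLE]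
              omega), zero_smul]
    rw [Finset.sum_congr rfl fun a _ => h2 a, Finset.sum_add_distrib]
    simp
  rw [Finset.sum_congr rfl fun j _ => h1 j, Finset.sum_add_distrib, Finset.sum_smul]
  simp

theorem sum_fin_of_castLE {k N : ℕ} (hk : k ≤ N) {M : Type*} [AddCommMonoid M] (F : Fin N → M)
    (h : ∀ a : Fin N, k ≤ a.val → F a = 0) : ∑ a, F a = ∑ i : Fin k, F (Fin.castLE hk i) := by
  symm
  refine Finset.sum_of_injOn (Fin.castLE hk) (Fin.castLE_injective hk).injOn (by simp) ?_ (by simp)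
  intro a _ ha
  refine h a (not_lt.1 fun hlt => ha ⟨⟨a, hlt⟩, by simp, rfl⟩)

theorem alternatingMap_upper {k N : ℕ} (f : W [⋀^Fin k]→ₗ[ℂ] E) (y : Fin N → W)
    (hk : k ≤ N) {b : Matrix (Fin N) (Fin N) ℂ} (hb : b.BlockTriangular id) :
    f (fun j => ∑ a, b a (Fin.castLE hk j) • y a)
      = (∏ j : Fin k, b (Fin.castLE hk j) (Fin.castLE hk j)) • f (fun i => y (Fin.castLE hk i)) := by
  have h1 : (fun j : Fin k => ∑ a, b a (Fin.castLE hk j) • y a) = fun j =>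
      ∑ i, (b.submatrix (Fin.castLE hk) (Fin.castLE hk)) i j • y (Fin.castLE hk i) := by
    funext j
    refine sum_fin_of_castLE hk _ fun a ha => ?_
    have h2 : b a (Fin.castLE hk j) = 0 :=
      hb (Fin.lt_def.2 (lt_of_lt_of_le j.isLt ha))
    rw [h2, zero_smul]
  have h3 : (b.submatrix (Fin.castLE hk) (Fin.castLE hk)).BlockTriangular id :=
    fun i j hij => hb (Fin.lt_def.2 (Fin.lt_def.1 hij))
  rw [h1, alternatingMap_matrix, Matrix.det_of_isUpperTriangular h3]
  rfl

/-- An upper triangular matrix applied to `y_0 ∧ ⋯ ∧ y_{m-1} ∧ y_{m+1}`. -/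
theorem alternatingMap_upper_update {m N : ℕ} (f : W [⋀^Fin (m + 1)]→ₗ[ℂ] E) (y : Fin N → W)
    (hm : m + 1 < N) {b : Matrix (Fin N) (Fin N) ℂ} (hb : b.BlockTriangular id) :
    ∃ γ : ℂ, f (Function.update (fun j => ∑ a, b a (Fin.castLE hm.le j) • y a) (Fin.last m)
        (∑ a, b a ⟨m + 1, hm⟩ • y a))
      = ((∏ j : Fin m, b (Fin.castLE (by omega) j) (Fin.castLE (by omega) j)) *
          b ⟨m + 1, hm⟩ ⟨m + 1, hm⟩) •
          f (Function.update (fun i => y (Fin.castLE hm.le i)) (Fin.last m) (y ⟨m + 1, hm⟩))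
        + γ • f (fun i => y (Fin.castLE hm.le i)) := by
  set x := Function.update (fun i => y (Fin.castLE hm.le i)) (Fin.last m) (y ⟨m + 1, hm⟩) with hx
  -- The new last column has a component along `y_{m+1}`, recorded in `B` relative to the family
  -- `x`, and components along `y_0, …, y_m`, recorded in `B'`; the determinant of `B'` is the
  -- irrelevant coefficient `γ`.
  let B : Matrix (Fin (m + 1)) (Fin (m + 1)) ℂ := Matrix.of fun i j =>
    if j = Fin.last m then (if i = Fin.last m then b ⟨m + 1, hm⟩ ⟨m + 1, hm⟩ else 0)
    else b (Fin.castLE hm.le i) (Fin.castLE hm.le j)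
  let B' : Matrix (Fin (m + 1)) (Fin (m + 1)) ℂ := Matrix.of fun i j =>
    if j = Fin.last m then b (Fin.castLE hm.le i) ⟨m + 1, hm⟩
    else b (Fin.castLE hm.le i) (Fin.castLE hm.le j)
  have hB : B.BlockTriangular id := by
    intro i j hij
    have hj : j ≠ Fin.last m := (lt_of_lt_of_le hij (Fin.le_last i)).ne
    simp only [B, Matrix.of_apply, if_neg hj]
    exact hb (Fin.lt_def.2 (Fin.lt_def.1 hij))
  have hdet : B.det = (∏ j : Fin m, b (Fin.castLE (by omega) j) (Fin.castLE (by omega) j)) *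
      b ⟨m + 1, hm⟩ ⟨m + 1, hm⟩ := by
    rw [Matrix.det_of_isUpperTriangular hB, Fin.prod_univ_castSucc]
    congr 1
    · refine Finset.prod_congr rfl fun j _ => ?_
      simp only [B, Matrix.of_apply, if_neg (Fin.castSucc_lt_last j).ne]
      rfl
    · simp [B]
  have hlow : ∀ j : Fin (m + 1), ∑ a, b a (Fin.castLE hm.le j) • y a
      = ∑ i, b (Fin.castLE hm.le i) (Fin.castLE hm.le j) • y (Fin.castLE hm.le i) := fun j =>
    sum_fin_of_castLE hm.le _ fun a ha => by
      have h2 : b a (Fin.castLE hm.le j) = 0 :=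
        hb (Fin.lt_def.2 (lt_of_lt_of_le j.isLt ha))
      rw [h2, zero_smul]
  have hsplit : ∑ a, b a ⟨m + 1, hm⟩ • y a = b ⟨m + 1, hm⟩ ⟨m + 1, hm⟩ • y ⟨m + 1, hm⟩
      + ∑ i, b (Fin.castLE hm.le i) ⟨m + 1, hm⟩ • y (Fin.castLE hm.le i) := by
    rw [← Finset.add_sum_erase _ _ (Finset.mem_univ (⟨m + 1, hm⟩ : Fin N))]
    congr 1
    let F : Fin N → W := fun a => if a = ⟨m + 1, hm⟩ then 0 else b a ⟨m + 1, hm⟩ • y a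
    have h6 := sum_fin_of_castLE hm.le F fun a ha => by
      simp only [F]
      split_ifs with h
      · rfl
      · have h2 : b a ⟨m + 1, hm⟩ = 0 := hb (Fin.lt_def.2 (by
          have : a.val ≠ m + 1 := fun h' => h (Fin.ext h')
          change m + 1 < a.val
          omega))
        rw [h2, zero_smul]
    have h7 : ∀ i : Fin (m + 1), F (Fin.castLE hm.le i)
        = b (Fin.castLE hm.le i) ⟨m + 1, hm⟩ • y (Fin.castLE hm.le i) := fun i =>
      if_neg fun h => i.isLt.ne (congrArg Fin.val h)
    rw [← Finset.sum_congr rfl fun i _ => h7 i, ← h6,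
      ← Finset.add_sum_erase _ F (Finset.mem_univ (⟨m + 1, hm⟩ : Fin N))]
    have h8 : F ⟨m + 1, hm⟩ = 0 := if_pos rfl
    rw [h8, zero_add]
    exact Finset.sum_congr rfl fun a ha => (if_neg (Finset.ne_of_mem_erase ha)).symm
  refine ⟨B'.det, ?_⟩
  rw [hsplit, f.map_update_add, ← hdet, ← alternatingMap_matrix, ← alternatingMap_matrix]
  congr 2
  · funext j
    by_cases hj : j = Fin.last m
    · subst hj
      simp [B, hx]
    · rw [Function.update_of_ne hj, hlow]
      refine Finset.sum_congr rfl fun i _ => ?_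
      simp only [B, Matrix.of_apply, if_neg hj]
      by_cases hi : i = Fin.last m
      · subst hi
        have h2 : b (Fin.castLE hm.le (Fin.last m)) (Fin.castLE hm.le j) = 0 :=
          hb (Fin.lt_def.2 (Fin.val_lt_last hj))
        rw [h2, zero_smul, zero_smul]
      · rw [hx, Function.update_of_ne hi]
  · funext j
    by_cases hj : j = Fin.last m
    · subst hj
      simp [B']
    · rw [Function.update_of_ne hj, hlow]
      simp [B', hj]


end Alternating

/-! ### Exterior powers: representatives, invariant norms and Gram determinants. -/

section Exterior

variable {n : ℕ}

theorem extAct_extVec {k : ℕ} (hk : k ≤ 2 * n + 1) (g : SL n) :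
    extAct k g (extVec n k hk)
      = exteriorPower.ιMulti ℂ k fun j a => g.1 a (Fin.castLE hk j) := by
  rw [extAct, extVec, exteriorPower.map_apply_ιMulti]
  congr 1
  funext j
  simp only [Function.comp_apply, Matrix.toLin'_apply, Matrix.mulVec_single_one]
  rfl

theorem extAct_mul {k : ℕ} (g h : SL n) (s : ⋀[ℂ]^k (V n)) :
    extAct k (g * h) s = extAct k g (extAct k h s) := by
  have h1 : (g * h).1 = g.1 * h.1 := rfl
  rw [extAct, h1, Matrix.toLin'_mul, exteriorPower.map_comp]
  rfl

theorem col_eq_sum (b : Mat n) (j : Fin (2 * n + 1)) :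
    (fun a => b a j) = ∑ a, b a j • (Pi.single a 1 : V n) := pi_eq_sum_univ' fun a => b a j

theorem extAct_extVec_of_upper {k : ℕ} (hk : k ≤ 2 * n + 1) {b : SL n}
    (hb : b.1.BlockTriangular id) :
    extAct k b (extVec n k hk)
      = (∏ j : Fin k, b.1 (Fin.castLE hk j) (Fin.castLE hk j)) • extVec n k hk := by
  rw [extAct_extVec]
  refine Eq.trans (congrArg (exteriorPower.ιMulti ℂ k) (funext fun j => col_eq_sum b.1 _)) ?_
  exact alternatingMap_upper (exteriorPower.ιMulti ℂ k) (fun a => (Pi.single a 1 : V n)) hk hb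

theorem prod_ite_lt_eq {k N : ℕ} (hk : k ≤ N) {M : Type*} [CommMonoid M] (F : Fin N → M) :
    (∏ j : Fin N, if j.val < k then F j else 1) = ∏ j : Fin k, F (Fin.castLE hk j) := by
  symm
  refine Finset.prod_of_injOn (Fin.castLE hk) (Fin.castLE_injective hk).injOn (by simp) ?_
    (by simp)
  intro a _ ha
  exact if_neg fun hlt => ha ⟨⟨a, hlt⟩, by simp, rfl⟩

theorem borelSL_isUpper {g : SL n} (hg : g ∈ borelSL n) : g.1.BlockTriangular id :=
  fun _ _ hij => apply_eq_zero_of_mem_borelSL hg hij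

/-- Two representatives differ by an element of the Borel subgroup, which acts on the highest weight
vector by a scalar. -/
theorem plucker_mk {k : ℕ} (hk : k ≤ 2 * n + 1) (g : SL n) :
    plucker k hk (g : FlV n)
      = Projectivization.mk ℂ (extAct k g (extVec n k hk)) (extAct_extVec_ne_zero hk g) := by
  obtain ⟨b, hb⟩ := QuotientGroup.mk_out_eq_mul (borelSL n) g
  rw [plucker, Projectivization.mk_eq_mk_iff']
  change ∃ a : ℂ, a • _ = extAct k (Quotient.out (g : FlV n)) (extVec n k hk)
  rw [hb, extAct_mul, extAct_extVec_of_upper hk (borelSL_isUpper b.2), map_smul]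
  exact ⟨_, rfl⟩

theorem piExt_mk {k : ℕ} (hk : k ≤ 2 * n + 1) (g : SO n) :
    piExt k hk (g : FlagSO n)
      = Projectivization.mk ℂ (extAct k g.1 (extVec n k hk)) (extAct_extVec_ne_zero hk g.1) := by
  obtain ⟨b, hb⟩ := QuotientGroup.mk_out_eq_mul (borel n) g
  rw [piExt, Projectivization.mk_eq_mk_iff']
  change ∃ a : ℂ, a • _ = extAct k (Quotient.out (g : FlagSO n) : SO n).1 (extVec n k hk)
  rw [hb]
  change ∃ a : ℂ, a • _ = extAct k (g.1 * b.1.1) (extVec n k hk)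
  have hb' : (b.1.1 : SL n).1.BlockTriangular id := borelSL_isUpper b.2
  rw [extAct_mul, extAct_extVec_of_upper hk hb', map_smul]
  exact ⟨_, rfl⟩

theorem incl_mk (g : SO n) : incl n (g : FlagSO n) = (g.1 : FlV n) := rfl

theorem piExt_eq_plucker_incl {k : ℕ} (hk : k ≤ 2 * n + 1) (P : FlagSO n) :
    piExt k hk P = plucker k hk (incl n P) := by
  obtain ⟨g, rfl⟩ := QuotientGroup.mk_surjective P
  rw [incl_mk, plucker_mk, piExt_mk]

/-- The Gram determinant of two vectors. -/
noncomputable def gramDet {E : Type*} [AddCommGroup E] [Module ℂ E] (H : InnerProductSpace.Core ℂ E)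
    (u v : E) : ℝ :=
  (H.inner u u).re * (H.inner v v).re - ‖H.inner u v‖ ^ 2

section
variable {E : Type*} [AddCommGroup E] [Module ℂ E] (H : InnerProductSpace.Core ℂ E)

theorem gramDet_nonneg (u v : E) : 0 ≤ gramDet H u v := by
  have h := @InnerProductSpace.Core.inner_mul_inner_self_le ℂ E _ _ _ H.toCore u v
  rw [InnerProductSpace.Core.norm_inner_symm v u, ← pow_two] at h
  exact sub_nonneg.2 h

theorem core_inner_smul_right (a : ℂ) (u v : E) : H.inner u (a • v) = a * H.inner u v :=
  @InnerProductSpace.Core.inner_smul_right ℂ E _ _ _ H.toCore _ _ _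

theorem core_inner_add_right (u v w : E) : H.inner u (v + w) = H.inner u v + H.inner u w :=
  @InnerProductSpace.Core.inner_add_right ℂ E _ _ _ H.toCore _ _ _

theorem core_inner_self_eq_re (u : E) : H.inner u u = ((H.inner u u).re : ℂ) := by
  have h := H.conj_inner_symm u u
  exact (Complex.conj_eq_iff_re.1 h).symm

theorem core_inner_smul_smul_re (a : ℂ) (u : E) :
    (H.inner (a • u) (a • u)).re = ‖a‖ ^ 2 * (H.inner u u).re := by
  rw [H.smul_left, core_inner_smul_right, ← mul_assoc,
    Complex.conj_mul', ← Complex.ofReal_pow, Complex.re_ofReal_mul]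

theorem gramDet_eq (u v : E) : (gramDet H u v : ℂ)
    = H.inner u u * H.inner v v - H.inner u v * H.inner v u := by
  rw [gramDet, ← H.conj_inner_symm v u, Complex.mul_conj', core_inner_self_eq_re H u,
    core_inner_self_eq_re H v]
  push_cast
  rfl

/-- A Gram determinant is insensitive to adding a multiple of `u` to `v`; this discards both the
trace part of a derivative and the unipotent part of the Borel subgroup. -/
theorem gramDet_smul_add (u v : E) (χ β γ : ℂ) :
    gramDet H (χ • u) (β • v + γ • u) = ‖χ‖ ^ 2 * ‖β‖ ^ 2 * gramDet H u v := by
  have h : (gramDet H (χ • u) (β • v + γ • u) : ℂ)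
      = ((‖χ‖ ^ 2 * ‖β‖ ^ 2 * gramDet H u v : ℝ) : ℂ) := by
    push_cast
    rw [gramDet_eq, gramDet_eq, ← Complex.mul_conj', ← Complex.mul_conj']
    simp only [H.add_left, H.smul_left, core_inner_add_right, core_inner_smul_right]
    ring
  exact_mod_cast h

end

/-- In `g = qb` the factor `q` is an isometry and `b` multiplies the vector by the product of its
first `k` diagonal entries. -/
theorem inner_extAct_extVec {k : ℕ} (hk : k ≤ 2 * n + 1) {H : InnerProductSpace.Core ℂ (⋀[ℂ]^k (V n))}
    (hH : IsInvariantExt H) (g : SO n) :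
    (H.inner (extAct k g.1 (extVec n k hk)) (extAct k g.1 (extVec n k hk))).re
      = tau g.1 k * (H.inner (extVec n k hk) (extVec n k hk)).re := by
  obtain ⟨q, b, hq, hb, rfl⟩ := exists_compact_mul_upper g
  have h1 : (q * b).1 = q.1 * b.1 := rfl
  rw [tau_eq hq hb (show (q * b).1.1 = q.1.1 * b.1.1 from rfl), prod_ite_lt_eq hk, h1, extAct_mul,
    hH q hq, extAct_extVec_of_upper hk hb]
  exact core_inner_smul_smul_re H _ _

/-- The vector `b_0 ∧ ⋯ ∧ b_{m-1} ∧ b_{m+1}`. -/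
noncomputable def extVecNext (n m : ℕ) (hm : m + 1 < 2 * n + 1) : ⋀[ℂ]^(m + 1) (V n) :=
  exteriorPower.ιMulti ℂ (m + 1) (Function.update
    (fun j => (Pi.single (Fin.castLE hm.le j) 1 : V n)) (Fin.last m) (Pi.single ⟨m + 1, hm⟩ 1))

theorem extAct_extVecNext {m : ℕ} (hm : m + 1 < 2 * n + 1) (g : SL n) :
    extAct (m + 1) g (extVecNext n m hm)
      = exteriorPower.ιMulti ℂ (m + 1) (Function.update
          (fun j a => g.1 a (Fin.castLE hm.le j)) (Fin.last m) (fun a => g.1 a ⟨m + 1, hm⟩)) := by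
  rw [extAct, extVecNext, exteriorPower.map_apply_ιMulti]
  congr 1
  funext j
  by_cases hj : j = Fin.last m
  · subst hj
    simp only [Function.comp_apply, Function.update_self, Matrix.toLin'_apply,
      Matrix.mulVec_single_one]
    rfl
  · simp only [Function.comp_apply, Function.update_of_ne hj, Matrix.toLin'_apply,
      Matrix.mulVec_single_one]
    rfl

/-- The upper triangular factor scales the first vector by `b_0 ⋯ b_m` and, modulo the first, the
second by `b_0 ⋯ b_{m-1} b_{m+1}`, where `b_j` is a diagonal entry. Moving `b_{m+1}` to the other
product turns the squared moduli into `tau_m tau_{m+2}`. -/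
theorem gramDet_extAct {m : ℕ} (hm : m + 1 < 2 * n + 1)
    {H : InnerProductSpace.Core ℂ (⋀[ℂ]^(m + 1) (V n))} (hH : IsInvariantExt H) (g : SO n) :
    gramDet H (extAct (m + 1) g.1 (extVec n (m + 1) hm.le)) (extAct (m + 1) g.1 (extVecNext n m hm))
      = tau g.1 m * tau g.1 (m + 2) *
        gramDet H (extVec n (m + 1) hm.le) (extVecNext n m hm) := by
  obtain ⟨q, b, hq, hb, rfl⟩ := exists_compact_mul_upper g
  have h1 : (q * b).1 = q.1 * b.1 := rfl
  have h2 : ∀ s t, gramDet H (extAct (m + 1) q.1 s) (extAct (m + 1) q.1 t) = gramDet H s t :=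
    fun s t => by simp only [gramDet, hH q hq]
  obtain ⟨γ, hγ⟩ := alternatingMap_upper_update (exteriorPower.ιMulti ℂ (m + 1))
    (fun a => (Pi.single a 1 : V n)) hm hb
  have h3 : extAct (m + 1) b.1 (extVecNext n m hm)
      = ((∏ j : Fin m, b.1.1 (Fin.castLE (by omega) j) (Fin.castLE (by omega) j)) *
          b.1.1 ⟨m + 1, hm⟩ ⟨m + 1, hm⟩) • extVecNext n m hm + γ • extVec n (m + 1) hm.le := by
    rw [extAct_extVecNext, col_eq_sum b.1.1,
      funext fun j : Fin (m + 1) => col_eq_sum b.1.1 (Fin.castLE hm.le j)]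
    exact hγ
  have hg : (q * b).1.1 = q.1.1 * b.1.1 := rfl
  rw [h1, extAct_mul, extAct_mul, h2, h3, extAct_extVec_of_upper hm.le hb, gramDet_smul_add]
  congr 1
  rw [← h1, tau_succ (q * b).1 ⟨m + 1, hm⟩, tau_eq hq hb hg, tau_eq hq hb hg,
    prod_ite_lt_eq (show m ≤ 2 * n + 1 by omega), prod_ite_lt_eq hm.le, gradedNorm_eq hq hb hg,
    norm_mul, mul_pow]
  ring

end Exterior
open Filter Topology in
theorem eventually_mem_frame {S : Type*} [TopologicalSpace S] {U : Set S} (hU : IsOpen U) {c : OpenPartialHomeomorph S ℂ}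
    {z : ℂ} (hz : z ∈ c.target) (hzU : c.symm z ∈ U) :
    ∀ᶠ w in 𝓝 z, w ∈ c.target ∧ c.symm w ∈ U :=
  (c.open_target.eventually_mem hz).and
    ((c.continuousAt_symm hz).eventually (hU.eventually_mem hzU))

/-! ### Local holomorphic frames of integral curves. -/

section Frames
open Filter Topology

variable {n : ℕ}

/-- The inverse of an orthogonal matrix is a rearrangement of its entries, so the inverse of a
holomorphic frame is visibly holomorphic. -/
theorem SO_inv_apply (g : SO n) (a b : Fin (2 * n + 1)) :
    (g⁻¹).1.1 a b = g.1.1 (Fin.rev b) (Fin.rev a) := by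
  have h1 : (g⁻¹).1.1 = gram n * g.1.1.transpose * gram n := by
    have h2 : g.1.1 * (g⁻¹).1.1 = 1 := SL_coe_mul_inv g.1
    calc (g⁻¹).1.1 = gram n * gram n * (g⁻¹).1.1 := by rw [gram_mul_gram, Matrix.one_mul]
      _ = gram n * (g.1.1.transpose * gram n * g.1.1) * (g⁻¹).1.1 := by
        rw [mem_SO_iff.1 g.2, Matrix.mul_assoc]
      _ = gram n * g.1.1.transpose * gram n * (g.1.1 * (g⁻¹).1.1) := by
        simp only [Matrix.mul_assoc]
      _ = _ := by rw [h2, Matrix.mul_one]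
  rw [h1, mul_gram, gram_mul, Matrix.transpose_apply]

variable {S : Type*} [TopologicalSpace S] [ChartedSpace ℂ S]

theorem hasDerivAt_frame {U : Set S} {g : S → SL n} (hg : IsHolomorphicFrame U g)
    {c : OpenPartialHomeomorph S ℂ} (hc : c ∈ IsManifold.maximalAtlas 𝓘(ℂ, ℂ) ω S)
    {z : ℂ} (hz : z ∈ c.target) (hzU : c.symm z ∈ U) (a b : Fin (2 * n + 1)) :
    HasDerivAt (fun w => (g (c.symm w)).1 a b)
      (matDeriv g (c.symm z) (mfderiv 𝓘(ℂ, ℂ) 𝓘(ℂ, ℂ) c.symm z (1 : ℂ)) a b) z := by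
  have h1 : MDifferentiableAt 𝓘(ℂ, ℂ) 𝓘(ℂ, ℂ) (fun x => (g x).1 a b) (c.symm z) :=
    (hg.2 a b).mdifferentiableAt (hg.1.mem_nhds hzU)
  have h2 : MDifferentiableAt 𝓘(ℂ, ℂ) 𝓘(ℂ, ℂ) c.symm z :=
    (contMDiffAt_symm_of_mem_maximalAtlas hc hz).mdifferentiableAt (by simp)
  let L : ℂ →L[ℂ] ℂ := (mfderiv 𝓘(ℂ, ℂ) 𝓘(ℂ, ℂ) (fun x => (g x).1 a b) (c.symm z)).comp
    (mfderiv 𝓘(ℂ, ℂ) 𝓘(ℂ, ℂ) c.symm z)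
  have h3 : HasFDerivAt (fun w => (g (c.symm w)).1 a b) L z :=
    (h1.hasMFDerivAt.comp z h2.hasMFDerivAt).hasFDerivAt
  exact h3.hasDerivAt

theorem analyticAt_frame {U : Set S} {g : S → SL n} (hg : IsHolomorphicFrame U g)
    {c : OpenPartialHomeomorph S ℂ} (hc : c ∈ IsManifold.maximalAtlas 𝓘(ℂ, ℂ) ω S)
    {z : ℂ} (hz : z ∈ c.target) (hzU : c.symm z ∈ U) (a b : Fin (2 * n + 1)) :
    AnalyticAt ℂ (fun w => (g (c.symm w)).1 a b) z := by
  refine Complex.analyticAt_iff_eventually_differentiableAt.2 ?_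
  filter_upwards [eventually_mem_frame hg.1 hz hzU] with w hw
  exact (hasDerivAt_frame hg hc hw.1 hw.2 a b).differentiableAt

/-- In a local coordinate, an integral curve of `𝒩` has a holomorphic frame `G` such that
`G⁻¹ G'` is a Hessenberg matrix. -/
theorem exists_hessenberg_frame {f : S → FlagSO n} (hf : IsHolomorphicCurve f)
    (hN : IsIntegralCurveOfN f) {c : OpenPartialHomeomorph S ℂ}
    (hc : c ∈ IsManifold.maximalAtlas 𝓘(ℂ, ℂ) ω S) {z : ℂ} (hz : z ∈ c.target) :
    ∃ (G : ℂ → SO n) (A : ℂ → Mat n), ∀ᶠ w in 𝓝 z,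
      f (c.symm w) = (G w : FlagSO n) ∧
      (∀ a b, AnalyticAt ℂ (fun w => (G w).1.1 a b) w) ∧
      (∀ a b, AnalyticAt ℂ (fun w => A w a b) w) ∧
      (∀ a b, HasDerivAt (fun w => (G w).1.1 a b) (((G w).1.1 * A w) a b) w) ∧
      ∀ i j : Fin (2 * n + 1), j.val + 1 < i.val → A w i j = 0 := by
  obtain ⟨U, g, hzU, hg⟩ := hf (c.symm z)
  let G : ℂ → SO n := fun w => g (c.symm w)
  let A : ℂ → Mat n := fun w =>
    ((G w)⁻¹ : SO n).1.1 * Matrix.of fun a b => deriv (fun w => (G w).1.1 a b) w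
  refine ⟨G, A, ?_⟩
  -- All properties are needed near `z`, not only at `z`, since the metric forms are differentiated
  -- again.
  filter_upwards [eventually_mem_frame hg.1.1 hz hzU] with w hw
  have hd := hasDerivAt_frame hg.1 hc hw.1 hw.2
  have ha := analyticAt_frame hg.1 hc hw.1 hw.2
  refine ⟨hg.2 _ hw.2, ha, fun a b => ?_, fun a b => ?_, fun i j hij => ?_⟩
  · simp only [A, Matrix.mul_apply, SO_inv_apply, Matrix.of_apply]
    exact Finset.analyticAt_fun_sum _ fun i _ => (ha _ _).mul (ha _ _).deriv
  · have h1 : (G w).1.1 * ((G w)⁻¹ : SO n).1.1 = 1 := SL_coe_mul_inv (G w).1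
    simp only [A]
    rw [← Matrix.mul_assoc, h1, Matrix.one_mul, Matrix.of_apply]
    exact (ha a b).differentiableAt.hasDerivAt
  · have h1 := hN U g hg _ hw.2 (mfderiv 𝓘(ℂ, ℂ) 𝓘(ℂ, ℂ) c.symm w (1 : ℂ))
    have h2 : A w = ((g (c.symm w))⁻¹ : SO n).1.1 * matDeriv (fun y => (g y : SL n)) (c.symm w)
        (mfderiv 𝓘(ℂ, ℂ) 𝓘(ℂ, ℂ) c.symm w (1 : ℂ)) := by
      simp only [A, G]
      congr 1
      ext a b
      exact (hd a b).deriv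
    rw [h2]
    exact apply_eq_zero_of_mem_distN h1 hij

end Frames

/-! ### The two expressions for the forms on exterior powers. -/

section Pluecker
open Filter Topology

variable {n : ℕ} {S : Type*} [TopologicalSpace S]
variable {f : S → FlagSO n} {c : OpenPartialHomeomorph S ℂ} {G : ℂ → SO n} {z : ℂ}

theorem fsForm_plucker_aux (hf : ∀ᶠ w in 𝓝 z, f (c.symm w) = (G w : FlagSO n)) {k : ℕ}
    (hk : k ≤ 2 * n + 1) :
    ∀ᶠ w in 𝓝 z, ∃ h, (plucker k hk ∘ incl n ∘ f) (c.symm w) = Projectivization.mk ℂ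
      ((exteriorPower.ιMulti ℂ k).toMultilinearMap fun j a => (G w).1.1 a (Fin.castLE hk j)) h := by
  filter_upwards [hf] with w hw
  have h1 := extAct_extVec hk (G w).1
  have h2 := extAct_extVec_ne_zero hk (G w).1
  rw [h1] at h2
  refine ⟨h2, ?_⟩
  rw [Function.comp_apply, Function.comp_apply, hw, incl_mk, plucker_mk]
  simp only [h1]
  rfl

/-- The squared norm of the section is `tau` times a constant, and the constant disappears under
`∂∂̄ log`. In particular the choice of invariant inner product is irrelevant. -/
theorem fsForm_plucker (hG : ∀ a b, AnalyticAt ℂ (fun w => (G w).1.1 a b) z)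
    (hf : ∀ᶠ w in 𝓝 z, f (c.symm w) = (G w : FlagSO n)) {k : ℕ} (hk : k ≤ 2 * n + 1)
    {H : InnerProductSpace.Core ℂ (⋀[ℂ]^k (V n))} (hH : IsInvariantExt H) :
    ContDiffAt ℝ ∞ (fun w => Real.log (tau (G w).1 k)) z ∧
    fsForm H (plucker k hk ∘ incl n ∘ f) c z = ddbar (fun w => Real.log (tau (G w).1 k)) z := by
  obtain ⟨h1, h2, -⟩ := fsForm_multilinear H (plucker k hk ∘ incl n ∘ f) c
    (exteriorPower.ιMulti ℂ k).toMultilinearMap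
    (x := fun w j a => (G w).1.1 a (Fin.castLE hk j)) (fun j a => hG _ _)
    (fsForm_plucker_aux hf hk)
  have hpos : 0 < (H.inner (extVec n k hk) (extVec n k hk)).re := by
    refine lt_of_le_of_ne (H.re_inner_nonneg _) fun h => ιMulti_single_ne_zero hk (H.definite _ ?_)
    rw [core_inner_self_eq_re]
    change (((H.inner (extVec n k hk) (extVec n k hk)).re : ℝ) : ℂ) = 0
    rw [← h, Complex.ofReal_zero]
  set C := (H.inner (extVec n k hk) (extVec n k hk)).re with hC
  have h3 : ∀ w, (H.inner
      ((exteriorPower.ιMulti ℂ k).toMultilinearMap fun j a => (G w).1.1 a (Fin.castLE hk j))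
      ((exteriorPower.ιMulti ℂ k).toMultilinearMap fun j a => (G w).1.1 a (Fin.castLE hk j))).re
      = tau (G w).1 k * C := by
    intro w
    rw [hC, ← inner_extAct_extVec hk hH, extAct_extVec]
    rfl
  have h4 : (fun w => Real.log (tau (G w).1 k)) = fun w => Real.log (H.inner
      ((exteriorPower.ιMulti ℂ k).toMultilinearMap fun j a => (G w).1.1 a (Fin.castLE hk j))
      ((exteriorPower.ιMulti ℂ k).toMultilinearMap fun j a => (G w).1.1 a (Fin.castLE hk j))).re
      + -Real.log C := by
    funext w
    rw [h3, Real.log_mul (tau_pos _ _).ne' hpos.ne']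
    ring
  rw [h4, h2, ddbar_add h1 contDiffAt_const, ddbar_const, add_zero]
  exact ⟨h1.add contDiffAt_const, rfl⟩

/-- Since `G' = GA` with `A` Hessenberg, the derivative of the section is a multiple of itself plus
a subdiagonal entry of `A` times the next vector; only the latter contributes to the Gram
determinant. -/
theorem fsForm_plucker_eq (hG : ∀ a b, AnalyticAt ℂ (fun w => (G w).1.1 a b) z)
    (hf : ∀ᶠ w in 𝓝 z, f (c.symm w) = (G w : FlagSO n)) {A : Mat n}
    (hA : ∀ i j : Fin (2 * n + 1), j.val + 1 < i.val → A i j = 0)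
    (hd : ∀ a b, HasDerivAt (fun w => (G w).1.1 a b) (((G z).1.1 * A) a b) z)
    {m : ℕ} (hm : m + 1 < 2 * n + 1)
    {H : InnerProductSpace.Core ℂ (⋀[ℂ]^(m + 1) (V n))} (hH : IsInvariantExt H) :
    fsForm H (plucker (m + 1) hm.le ∘ incl n ∘ f) c z
      = gramDet H (extVec n (m + 1) hm.le) (extVecNext n m hm) /
          (H.inner (extVec n (m + 1) hm.le) (extVec n (m + 1) hm.le)).re ^ 2 *
        (‖A ⟨m + 1, hm⟩ ⟨m, by omega⟩‖ ^ 2 *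
          (tau (G z).1 m * tau (G z).1 (m + 2) / tau (G z).1 (m + 1) ^ 2)) := by
  obtain ⟨-, -, h1⟩ := fsForm_multilinear H (plucker (m + 1) hm.le ∘ incl n ∘ f) c
    (exteriorPower.ιMulti ℂ (m + 1)).toMultilinearMap
    (x := fun w j a => (G w).1.1 a (Fin.castLE hm.le j)) (fun j a => hG _ _)
    (fsForm_plucker_aux hf hm.le)
  set g := (G z).1 with hg
  have hy := alternatingMap_hessenberg (exteriorPower.ιMulti ℂ (m + 1))
    (fun b a => g.1 a b : Fin (2 * n + 1) → V n) hm A hA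
  have hs : (exteriorPower.ιMulti ℂ (m + 1)).toMultilinearMap
      (fun j a => g.1 a (Fin.castLE hm.le j)) = extAct (m + 1) g (extVec n (m + 1) hm.le) :=
    (extAct_extVec hm.le g).symm
  have h2 := h1 (fun j => ∑ b, A b (Fin.castLE hm.le j) • fun a => g.1 a b) (fun j a => by
    have h3 := hd a (Fin.castLE hm.le j)
    rw [Matrix.mul_apply] at h3
    convert h3 using 1
    rw [Finset.sum_apply]
    exact Finset.sum_congr rfl fun b _ => mul_comm _ _) _ rfl
  rw [h2]
  have hs' : (∑ j : Fin (m + 1), (exteriorPower.ιMulti ℂ (m + 1)).toMultilinearMap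
      (Function.update (fun j a => g.1 a (Fin.castLE hm.le j)) j
        (∑ b, A b (Fin.castLE hm.le j) • fun a => g.1 a b)))
      = A ⟨m + 1, hm⟩ ⟨m, by omega⟩ • extAct (m + 1) g (extVecNext n m hm)
        + (∑ j : Fin (m + 1), A (Fin.castLE hm.le j) (Fin.castLE hm.le j)) •
          extAct (m + 1) g (extVec n (m + 1) hm.le) := by
    rw [extAct_extVecNext, ← hs]
    exact hy.trans (add_comm _ _)
  rw [hs', hs]
  have h3 := gramDet_smul_add H (extAct (m + 1) g (extVec n (m + 1) hm.le))
    (extAct (m + 1) g (extVecNext n m hm)) 1 (A ⟨m + 1, hm⟩ ⟨m, by omega⟩)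
    (∑ j : Fin (m + 1), A (Fin.castLE hm.le j) (Fin.castLE hm.le j))
  rw [one_smul, norm_one, one_pow, one_mul, hg, gramDet_extAct hm hH, ← hg] at h3
  rw [gramDet] at h3
  rw [h3, hg, inner_extAct_extVec hm.le hH]
  ring

end Pluecker
-- Generation of the orthogonal group by reflections, and lifts to the Pin group.
section CartanDieudonne

open CliffordAlgebra

variable {U : Type*} [AddCommGroup U] [Module ℂ U] (B : LinearMap.BilinForm ℂ U)

/-- The reflection in the hyperplane orthogonal to a vector `a` with `B a a = -1`. -/
noncomputable def hyperplaneReflection (a : U) : Module.End ℂ U :=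
  LinearMap.transvection ((2 : ℂ) • B a) a

/-- The products of reflections. -/
def reflectionMonoid : Submonoid (Module.End ℂ U) :=
  Submonoid.closure {T | ∃ a, B a a = -1 ∧ T = hyperplaneReflection B a}

variable {B}

theorem hyperplaneReflection_apply (a w : U) :
    hyperplaneReflection B a w = w + (2 * B a w) • a := by
  simp [hyperplaneReflection, LinearMap.transvection.apply]

theorem hyperplaneReflection_mul_self {a : U} (ha : B a a = -1) :
    hyperplaneReflection B a * hyperplaneReflection B a = 1 := by
  refine LinearMap.ext fun w => ?_
  rw [Module.End.mul_apply, hyperplaneReflection_apply, hyperplaneReflection_apply, map_add,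
    map_smul, ha, Module.End.one_apply]
  simp only [smul_eq_mul]
  module

theorem apply_hyperplaneReflection (hs : ∀ x y, B x y = B y x) {a : U} (ha : B a a = -1) (x y : U) :
    B (hyperplaneReflection B a x) (hyperplaneReflection B a y) = B x y := by
  simp only [hyperplaneReflection_apply, map_add, map_smul, LinearMap.add_apply,
    LinearMap.smul_apply, smul_eq_mul, ha, hs x a]
  ring

/-- A reflection in the direction of `d`, where `d` is not isotropic. -/
theorem exists_reflection {d : U} (hd : B d d ≠ 0) :
    ∃ a, B a a = -1 ∧ ∀ w, hyperplaneReflection B a w = w - (2 * B d w / B d d) • d := by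
  obtain ⟨t, ht⟩ := IsAlgClosed.exists_pow_nat_eq (-(B d d)⁻¹) (n := 2) (by norm_num)
  have h1 : t * t * B d d = -1 := by
    rw [← pow_two, ht, neg_mul, inv_mul_cancel₀ hd]
  refine ⟨t • d, ?_, fun w => ?_⟩
  · simp only [map_smul, LinearMap.smul_apply, smul_eq_mul]
    linear_combination h1
  · rw [hyperplaneReflection_apply, sub_eq_add_neg, ← neg_smul, smul_smul]
    congr 2
    simp only [map_smul, LinearMap.smul_apply, smul_eq_mul]
    field_simp
    linear_combination B d w * h1

theorem reflection_mem {a : U} (ha : B a a = -1) :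
    hyperplaneReflection B a ∈ reflectionMonoid B := Submonoid.subset_closure ⟨a, ha, rfl⟩

/-- Induction on the number `m` of final vectors of an orthogonal basis that `T` may move: one or
two reflections fixing the earlier vectors bring `T v_j` back to `v_j`. -/
theorem mem_reflectionMonoid_aux (hs : ∀ x y, B x y = B y x) {N : ℕ} (v : Module.Basis (Fin N) ℂ U)
    (hv : ∀ i j, i ≠ j → B (v i) (v j) = 0) (hv0 : ∀ i, B (v i) (v i) ≠ 0) (m : ℕ) :
    ∀ T : Module.End ℂ U, (∀ x y, B (T x) (T y) = B x y) →
      (∀ i : Fin N, i.val + m < N → T (v i) = v i) → T ∈ reflectionMonoid B := by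
  induction m with
  | zero =>
    intro T _ hT
    have : T = 1 := v.ext fun i => hT i (by simp)
    rw [this]
    exact one_mem _
  | succ m ih =>
    intro T hT hfix
    by_cases hm : N ≤ m
    · exact ih T hT fun i hi => absurd hi (by omega)
    let j : Fin N := ⟨N - 1 - m, by omega⟩
    -- it is enough to move `T v_j` back to `v_j`
    have key : ∀ R R' : Module.End ℂ U, R ∈ reflectionMonoid B → R' * R = 1 →
        R' ∈ reflectionMonoid B → (∀ x y, B (R x) (R y) = B x y) → R (T (v j)) = v j →
        (∀ i < j, R (v i) = v i) → T ∈ reflectionMonoid B := by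
      intro R R' _ hR'R hR' hRB hRj hRi
      have h1 : R * T ∈ reflectionMonoid B := by
        refine ih _ (fun x y => by rw [Module.End.mul_apply, Module.End.mul_apply, hRB, hT])
          fun i hi => ?_
        rcases lt_or_eq_of_le (show i ≤ j from Fin.le_def.2 (by simp only [j]; omega)) with h | h
        · have h2 := Fin.lt_def.1 h
          rw [Module.End.mul_apply, hfix i (by simp only [j] at h2; omega), hRi i h]
        · rw [h, Module.End.mul_apply, hRj]
      have h2 : T = R' * (R * T) := by rw [← mul_assoc, hR'R, one_mul]
      rw [h2]
      exact mul_mem hR' h1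
    have horth : ∀ i < j, B (T (v j)) (v i) = 0 := fun i hi => by
      have h2 := Fin.lt_def.1 hi
      have h3 := hT (v j) (v i)
      rw [hfix i (by simp only [j] at h2; omega), hv j i hi.ne'] at h3
      exact h3
    have hjj : B (T (v j)) (T (v j)) = B (v j) (v j) := hT _ _
    -- `T v_j - v_j` and `T v_j + v_j` cannot both be isotropic, as their squares add up to `4
    -- B(v_j, v_j)`. Reflecting in the difference sends `T v_j` to `v_j`; reflecting in the sum
    -- sends it to `-v_j`, and a second reflection in `v_j` corrects the sign.
    by_cases hd : B (T (v j) - v j) (T (v j) - v j) = 0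
    · have hd' : B (T (v j) + v j) (T (v j) + v j) ≠ 0 := by
        intro h0
        apply hv0 j
        simp only [map_add, map_sub, LinearMap.add_apply, LinearMap.sub_apply, hjj] at hd h0
        linear_combination (hd + h0) / 4
      obtain ⟨a, ha, har⟩ := exists_reflection hd'
      obtain ⟨b, hb, hbr⟩ := exists_reflection (hv0 j)
      refine key (hyperplaneReflection B b * hyperplaneReflection B a)
        (hyperplaneReflection B a * hyperplaneReflection B b)
        (mul_mem (reflection_mem hb) (reflection_mem ha)) ?_
        (mul_mem (reflection_mem ha) (reflection_mem hb)) (fun x y => ?_) ?_ fun i hi => ?_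
      · rw [mul_assoc, ← mul_assoc (hyperplaneReflection B b), hyperplaneReflection_mul_self hb,
          one_mul, hyperplaneReflection_mul_self ha]
      · rw [Module.End.mul_apply, Module.End.mul_apply, apply_hyperplaneReflection hs hb,
          apply_hyperplaneReflection hs ha]
      · have h1 : 2 * B (T (v j) + v j) (T (v j)) / B (T (v j) + v j) (T (v j) + v j) = 1 := by
          rw [div_eq_one_iff_eq hd']
          simp only [map_add, LinearMap.add_apply, hjj, hs (T (v j)) (v j)]
          ring
        have h2 : 2 * B (v j) (v j) / B (v j) (v j) = 2 := mul_div_cancel_right₀ _ (hv0 j)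
        rw [Module.End.mul_apply, har, h1, one_smul, sub_add_cancel_left, map_neg, hbr, h2]
        module
      · have h1 : B (T (v j) + v j) (v i) = 0 := by
          rw [map_add, LinearMap.add_apply, horth i hi, hv j i hi.ne', add_zero]
        rw [Module.End.mul_apply, har, h1, hbr]
        simp [hv j i hi.ne']
    · obtain ⟨a, ha, har⟩ := exists_reflection hd
      refine key (hyperplaneReflection B a) (hyperplaneReflection B a) (reflection_mem ha)
        (hyperplaneReflection_mul_self ha) (reflection_mem ha)
        (apply_hyperplaneReflection hs ha) ?_ fun i hi => ?_
      · have h1 : 2 * B (T (v j) - v j) (T (v j)) / B (T (v j) - v j) (T (v j) - v j) = 1 := by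
          rw [div_eq_one_iff_eq hd]
          simp only [map_sub, LinearMap.sub_apply, hjj, hs (T (v j)) (v j)]
          ring
        rw [har, h1]
        module
      · have h1 : B (T (v j) - v j) (v i) = 0 := by
          rw [map_sub, LinearMap.sub_apply, horth i hi, hv j i hi.ne', sub_zero]
        rw [har, h1]
        simp

/-- The Cartan–Dieudonné theorem over `ℂ`. -/
theorem mem_reflectionMonoid [FiniteDimensional ℂ U] (hs : ∀ x y, B x y = B y x)
    (hnd : B.SeparatingLeft) {T : Module.End ℂ U} (hT : ∀ x y, B (T x) (T y) = B x y) :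
    T ∈ reflectionMonoid B := by
  have hB : LinearMap.IsSymm B := ⟨fun x y => hs x y⟩
  obtain ⟨v, hv⟩ := LinearMap.BilinForm.exists_orthogonal_basis hB
  exact mem_reflectionMonoid_aux hs v (fun i j hij => LinearMap.isOrthoᵢ_def.1 hv i j hij)
    (hv.not_isOrtho_basis_self_of_separatingLeft hnd) (Module.finrank ℂ U) T hT
    fun i hi => absurd hi (by omega)

/-- Conjugation by a vector is minus the reflection in it, so each factor contributes one sign. The
count `m` ties this sign to the parity of `x` and to the determinant. -/
theorem exists_pinGroup_of_mem_reflectionMonoid [FiniteDimensional ℂ U]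
    (hs : ∀ x y, B x y = B y x) {T : Module.End ℂ U} (hT : T ∈ reflectionMonoid B) :
    ∃ (m : ℕ) (x : CliffordAlgebra B.toQuadraticMap), x ∈ pinGroup B.toQuadraticMap ∧
      x ∈ evenOdd B.toQuadraticMap (m : ZMod 2) ∧ LinearMap.det T = (-1) ^ m ∧
      ∀ w, x * ι B.toQuadraticMap w = (-1 : ℂ) ^ m • (ι B.toQuadraticMap (T w) * x) := by
  induction hT using Submonoid.closure_induction with
  | mem T hT =>
    obtain ⟨a, ha, rfl⟩ := hT
    have hQ : B.toQuadraticMap a = -1 := ha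
    have hsq : ι B.toQuadraticMap a * ι B.toQuadraticMap a = -1 := by
      rw [ι_sq_scalar, hQ, map_neg, map_one]
    refine ⟨1, ι B.toQuadraticMap a, ?_, ?_, ?_, fun w => ?_⟩
    · rw [pinGroup.mem_iff]
      refine ⟨?_, ?_⟩
      · let u : (CliffordAlgebra B.toQuadraticMap)ˣ := ⟨ι B.toQuadraticMap a,
          -ι B.toQuadraticMap a, by rw [mul_neg, hsq, neg_neg], by rw [neg_mul, hsq, neg_neg]⟩
        exact ⟨u, Subgroup.subset_closure ⟨a, rfl⟩, rfl⟩
      · rw [Unitary.mem_iff, star_ι, neg_mul, mul_neg, hsq, neg_neg]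
        exact ⟨rfl, rfl⟩
    · rw [Nat.cast_one]
      exact ι_mem_evenOdd_one _ a
    · rw [hyperplaneReflection, LinearMap.transvection.det]
      simp [ha]
      norm_num
    · have h1 : ι B.toQuadraticMap a * ι B.toQuadraticMap w
          = algebraMap ℂ _ (2 * B a w) - ι B.toQuadraticMap w * ι B.toQuadraticMap a := by
        rw [ι_mul_ι_comm]
        congr 2
        simp only [QuadraticMap.polar, LinearMap.BilinMap.toQuadraticMap_apply, map_add,
          LinearMap.add_apply, hs w a]
        ring
      rw [h1, hyperplaneReflection_apply, map_add, map_smul, add_mul, smul_mul_assoc, hsq,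
        Algebra.algebraMap_eq_smul_one]
      module
  | one =>
    refine ⟨0, 1, one_mem _, ?_, by simp, fun w => by simp⟩
    rw [Nat.cast_zero]
    exact (evenOdd B.toQuadraticMap 0).toAddSubmonoid.mem_carrier.1
      (one_le_evenOdd_zero _ (Submodule.one_le.1 le_rfl))
  | mul S T _ _ hS hT =>
    obtain ⟨k, x, hx1, hx2, hx3, hx4⟩ := hS
    obtain ⟨m, y, hy1, hy2, hy3, hy4⟩ := hT
    refine ⟨k + m, x * y, mul_mem hx1 hy1, ?_, ?_, fun w => ?_⟩
    · rw [Nat.cast_add]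
      exact evenOdd_mul_le _ _ _ (Submodule.mul_mem_mul hx2 hy2)
    · rw [map_mul, hx3, hy3, pow_add]
    · rw [mul_assoc, hy4, mul_smul_comm, ← mul_assoc, hx4, smul_mul_assoc, smul_smul, ← pow_add,
        add_comm m k, mul_assoc]
      rfl

end CartanDieudonne

/-! ### Surjectivity of the double cover. -/

section SpinCover

variable {n : ℕ}

theorem toBilin_gram_apply (x y : V n) :
    Matrix.toBilin' (gram n) x y = ∑ a, x a * y (Fin.rev a) := by
  rw [Matrix.toBilin'_apply']
  simp [dotProduct, Matrix.mulVec, gram]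

/-- The double cover `Spin(2n+1, ℂ) → SO(2n+1, ℂ)` is surjective. -/
theorem exists_covers (g : SO n) : ∃ x : Spin n, Covers x g := by
  set B := Matrix.toBilin' (gram n) with hBdef
  have hs : ∀ x y, B x y = B y x := fun x y => by
    rw [hBdef, toBilin_gram_apply, toBilin_gram_apply, ← Equiv.sum_comp Fin.revPerm]
    exact Finset.sum_congr rfl fun a _ => by simp [mul_comm]
  have hnd : B.SeparatingLeft := fun x hx => by
    funext a
    have h1 := hx (Pi.single (Fin.rev a) 1)
    rw [hBdef, toBilin_gram_apply] at h1
    simpa [Pi.single_apply] using h1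
  have hT : ∀ x y, B (Matrix.toLin' g.1.1 x) (Matrix.toLin' g.1.1 y) = B x y := fun x y => by
    rw [hBdef, Matrix.toBilin'_apply', Matrix.toBilin'_apply', Matrix.toLin'_apply,
      Matrix.toLin'_apply, Matrix.mulVec_mulVec, Matrix.dotProduct_mulVec, Matrix.vecMul_mulVec,
      ← Matrix.dotProduct_mulVec, ← Matrix.mul_assoc, mem_SO_iff.1 g.2]
  obtain ⟨m, x, hx1, hx2, hx3, hx4⟩ := exists_pinGroup_of_mem_reflectionMonoid
    hs (mem_reflectionMonoid hs hnd hT)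
  rw [LinearMap.det_toLin', g.1.2] at hx3
  -- Determinant one forces an even number of reflections: the lift is even, and the sign in its
  -- conjugation action vanishes.
  have hm : Even m := by
    rcases Nat.even_or_odd m with h | h
    · exact h
    · rw [h.neg_one_pow] at hx3
      norm_num at hx3
  rw [(ZMod.natCast_eq_zero_iff_even).2 hm] at hx2
  refine ⟨⟨x, spinGroup.mem_iff.2 ⟨hx1, hx2⟩⟩, fun v => ?_⟩
  have h1 := hx4 v
  rw [hm.neg_one_pow, one_smul] at h1
  exact h1

end SpinCover
-- Algebra of spinors: extreme components, the invariant form and degree.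
section Spinors

variable {n : ℕ}

/-- The contraction of spinors with a functional on `W`. -/
noncomputable def contr (n : ℕ) : Module.Dual ℂ (W n) →ₗ[ℂ] Module.End ℂ (Spinor n) :=
  CliffordAlgebra.contractLeft (Q := (0 : QuadraticForm ℂ (W n)))

/-- The parity involution of spinors. -/
noncomputable def parity (n : ℕ) : Spinor n →ₐ[ℂ] Spinor n :=
  CliffordAlgebra.involute (Q := (0 : QuadraticForm ℂ (W n)))

/-- The reversal of spinors. -/
noncomputable def rev (n : ℕ) : Spinor n →ₗ[ℂ] Spinor n :=
  CliffordAlgebra.reverse (Q := (0 : QuadraticForm ℂ (W n)))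

/-- The component of degree zero of a spinor. -/
noncomputable def bottom (n : ℕ) : Spinor n →ₐ[ℂ] ℂ := ExteriorAlgebra.algebraMapInv

theorem cliff_eq (v : V n) (s : Spinor n) :
    cliff n v s = ExteriorAlgebra.ι ℂ (partW n v) * s + v (idxU n) • parity n s
      + (2 : ℂ) • contr n (partW' n v) s := rfl

theorem spinor_induction {P : Spinor n → Prop} (h0 : ∀ r : ℂ, P (algebraMap ℂ _ r))
    (h1 : ∀ x y, P x → P y → P (x + y)) (h2 : ∀ x w, P x → P (ExteriorAlgebra.ι ℂ w * x))
    (s : Spinor n) : P s :=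
  CliffordAlgebra.left_induction (0 : QuadraticForm ℂ (W n)) h0 h1 h2 s

theorem spinor_induction_right {P : Spinor n → Prop} (h0 : ∀ r : ℂ, P (algebraMap ℂ _ r))
    (h1 : ∀ x y, P x → P y → P (x + y)) (h2 : ∀ x w, P x → P (x * ExteriorAlgebra.ι ℂ w))
    (s : Spinor n) : P s :=
  CliffordAlgebra.right_induction (0 : QuadraticForm ℂ (W n)) h0 h1 (fun w x h => h2 x w h) s

theorem contr_ι_mul (d : Module.Dual ℂ (W n)) (w : W n) (s : Spinor n) :
    contr n d (ExteriorAlgebra.ι ℂ w * s) = d w • s - ExteriorAlgebra.ι ℂ w * contr n d s :=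
  CliffordAlgebra.contractLeft_ι_mul _ _ _

theorem contr_algebraMap (d : Module.Dual ℂ (W n)) (r : ℂ) :
    contr n d (algebraMap ℂ _ r) = 0 := CliffordAlgebra.contractLeft_algebraMap _ _ _

theorem contr_one (d : Module.Dual ℂ (W n)) : contr n d 1 = 0 := CliffordAlgebra.contractLeft_one _ _

theorem contr_contr (d : Module.Dual ℂ (W n)) (s : Spinor n) : contr n d (contr n d s) = 0 :=
  CliffordAlgebra.contractLeft_contractLeft _ _

theorem contr_comm (d d' : Module.Dual ℂ (W n)) (s : Spinor n) :
    contr n d (contr n d' s) = - contr n d' (contr n d s) :=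
  CliffordAlgebra.contractLeft_comm _ _ _

theorem parity_contr (d : Module.Dual ℂ (W n)) (s : Spinor n) :
    parity n (contr n d s) = - contr n d (parity n s) := involute_contractLeft _ _

theorem contr_parity (d : Module.Dual ℂ (W n)) (s : Spinor n) :
    contr n d (parity n s) = - parity n (contr n d s) := by rw [parity_contr, neg_neg]

theorem parity_ι (w : W n) : parity n (ExteriorAlgebra.ι ℂ w) = - ExteriorAlgebra.ι ℂ w :=
  CliffordAlgebra.involute_ι _

theorem parity_parity (s : Spinor n) : parity n (parity n s) = s :=
  CliffordAlgebra.involute_involute _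

theorem rev_mul (s t : Spinor n) : rev n (s * t) = rev n t * rev n s :=
  CliffordAlgebra.reverse.map_mul _ _

theorem rev_ι (w : W n) : rev n (ExteriorAlgebra.ι ℂ w) = ExteriorAlgebra.ι ℂ w :=
  CliffordAlgebra.reverse_ι _

theorem rev_algebraMap (r : ℂ) : rev n (algebraMap ℂ _ r) = algebraMap ℂ _ r :=
  CliffordAlgebra.reverse.commutes _

theorem rev_rev (s : Spinor n) : rev n (rev n s) = s := CliffordAlgebra.reverse_reverse _

theorem rev_parity (s : Spinor n) : rev n (parity n s) = parity n (rev n s) :=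
  CliffordAlgebra.reverse_involute _

theorem bottom_ι (w : W n) : bottom n (ExteriorAlgebra.ι ℂ w) = 0 :=
  ExteriorAlgebra.lift_ι_apply _ _ _ _

theorem bottom_parity (s : Spinor n) : bottom n (parity n s) = bottom n s := by
  induction s using spinor_induction with
  | h0 r => rw [AlgHom.commutes]
  | h1 x y hx hy => rw [map_add, map_add, map_add, hx, hy]
  | h2 x w _ => rw [map_mul, map_mul, map_mul, parity_ι, map_neg, bottom_ι, neg_zero, zero_mul,
      zero_mul]

theorem bottom_rev (s : Spinor n) : bottom n (rev n s) = bottom n s := by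
  induction s using spinor_induction with
  | h0 r => rw [rev_algebraMap]
  | h1 x y hx hy => rw [map_add, map_add, map_add, hx, hy]
  | h2 x w _ => rw [rev_mul, map_mul, map_mul, rev_ι, bottom_ι, zero_mul, mul_zero]

/-- The contraction with several functionals, one after the other. -/
noncomputable def contrList (L : List (Module.Dual ℂ (W n))) : Module.End ℂ (Spinor n) :=
  (L.reverse.map (contr n)).prod

theorem contrList_nil : contrList ([] : List (Module.Dual ℂ (W n))) = 1 := by simp [contrList]

theorem contrList_cons (d : Module.Dual ℂ (W n)) (L : List (Module.Dual ℂ (W n))) :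
    contrList (d :: L) = contrList L * contr n d := by simp [contrList]

theorem contrList_contr {L : List (Module.Dual ℂ (W n))} {d : Module.Dual ℂ (W n)} (hd : d ∈ L)
    (s : Spinor n) : contrList L (contr n d s) = 0 := by
  induction L generalizing s with
  | nil => simp at hd
  | cons e L ih =>
    rw [contrList_cons, Module.End.mul_apply]
    by_cases h : d = e
    · rw [h, contr_contr, map_zero]
    · rw [contr_comm, map_neg, ih ((List.mem_cons.1 hd).resolve_left h), neg_zero]

theorem contrList_parity (L : List (Module.Dual ℂ (W n))) (s : Spinor n) :
    contrList L (parity n s) = (-1 : ℂ) ^ L.length • parity n (contrList L s) := by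
  induction L generalizing s with
  | nil => simp [contrList_nil]
  | cons d L ih =>
    rw [contrList_cons, Module.End.mul_apply, Module.End.mul_apply, contr_parity, map_neg, ih,
      List.length_cons, pow_succ]
    module

/-- The coordinate functionals of `W`. -/
noncomputable def coords (n : ℕ) : List (Module.Dual ℂ (W n)) :=
  (List.finRange n).map fun i => LinearMap.proj i

/-- The coefficient of `e_1 ∧ ⋯ ∧ e_n` of a spinor, up to a sign. -/
noncomputable def top (n : ℕ) : Spinor n →ₗ[ℂ] ℂ :=
  (bottom n).toLinearMap.comp (contrList (coords n))

theorem length_coords : (coords n).length = n := by simp [coords]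

/-- Contractions anticommute and square to zero, and `top` already contracts with every coordinate
functional. -/
theorem top_contr (d : Module.Dual ℂ (W n)) (s : Spinor n) : top n (contr n d s) = 0 := by
  have h : d = ∑ i, d (Pi.single i 1) • (LinearMap.proj i : W n →ₗ[ℂ] ℂ) := by
    refine LinearMap.ext fun w => ?_
    conv_lhs => rw [pi_eq_sum_univ' w]
    simp [LinearMap.sum_apply, mul_comm]
  rw [h, map_sum, LinearMap.sum_apply, map_sum]
  refine Finset.sum_eq_zero fun i _ => ?_
  rw [map_smul, LinearMap.smul_apply, map_smul, top, LinearMap.comp_apply, contrList_contr, map_zero,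
    smul_zero]
  exact List.mem_map.2 ⟨i, List.mem_finRange i, rfl⟩

theorem top_parity (s : Spinor n) : top n (parity n s) = (-1) ^ n * top n s := by
  rw [top, LinearMap.comp_apply, contrList_parity, map_smul, length_coords]
  exact congrArg _ (bottom_parity _)

/-- The product of the basis vectors with the indices in a list. -/
noncomputable def wedgeList (L : List (Fin n)) : Spinor n :=
  (L.map fun i => ExteriorAlgebra.ι ℂ (Pi.single i 1 : W n)).prod

theorem contr_wedgeList {L : List (Fin n)} {i : Fin n} (h : i ∉ L) :
    contr n (LinearMap.proj i) (wedgeList L) = 0 := by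
  induction L with
  | nil => exact contr_one _
  | cons j L ih =>
    rw [List.mem_cons, not_or] at h
    have h1 : wedgeList (j :: L) = ExteriorAlgebra.ι ℂ (Pi.single j 1) * wedgeList L := by
      simp [wedgeList]
    rw [h1, contr_ι_mul, ih h.2]
    simp [h.1]

theorem contrList_wedgeList {L : List (Fin n)} (h : L.Nodup) :
    contrList (L.map fun i => LinearMap.proj i) (wedgeList L) = 1 := by
  induction L with
  | nil => rw [List.map_nil, contrList_nil]; rfl
  | cons j L ih =>
    have h1 : wedgeList (j :: L) = ExteriorAlgebra.ι ℂ (Pi.single j 1) * wedgeList L := by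
      simp [wedgeList]
    rw [List.map_cons, contrList_cons, Module.End.mul_apply, h1, contr_ι_mul,
      contr_wedgeList (List.nodup_cons.1 h).1, mul_zero, sub_zero, map_smul,
      ih (List.nodup_cons.1 h).2]
    simp

theorem spinVec_eq : spinVec n = wedgeList (List.finRange n) := by
  rw [spinVec, ExteriorAlgebra.ιMulti_apply, List.ofFn_eq_map, wedgeList]

theorem top_spinVec : top n (spinVec n) = 1 := by
  rw [spinVec_eq, top, LinearMap.comp_apply, coords, contrList_wedgeList (List.nodup_finRange n)]
  exact map_one (bottom n)

theorem ι_mul_spinVec (w : W n) : ExteriorAlgebra.ι ℂ w * spinVec n = 0 := by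
  conv_lhs => rw [pi_eq_sum_univ' w]
  rw [map_sum, Finset.sum_mul]
  refine Finset.sum_eq_zero fun i _ => ?_
  rw [map_smul, smul_mul_assoc, spinVec, ExteriorAlgebra.ιMulti_apply,
    ExteriorAlgebra.ι_mul_prod_list (fun j => (Pi.single j 1 : W n)) i, smul_zero]

theorem spinVec_mul_ι (w : W n) : spinVec n * ExteriorAlgebra.ι ℂ w = 0 := by
  rw [← rev_rev (spinVec n * ExteriorAlgebra.ι ℂ w), rev_mul, rev_ι]
  have h : rev n (spinVec n)
      = (List.ofFn fun i => ExteriorAlgebra.ι ℂ (Pi.single (Fin.rev i) 1 : W n)).prod := by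
    have h1 := CliffordAlgebra.reverse_prod_map_ι (Q := (0 : QuadraticForm ℂ (W n)))
      ((List.finRange n).map fun i => (Pi.single i 1 : W n))
    rw [List.map_map, ← List.map_reverse, List.finRange_reverse, List.map_map] at h1
    rw [spinVec_eq, List.ofFn_eq_map]
    exact h1
  rw [h]
  conv_lhs => rw [pi_eq_sum_univ' w]
  rw [map_sum, Finset.sum_mul, Finset.sum_eq_zero, map_zero]
  intro i _
  have h2 := ExteriorAlgebra.ι_mul_prod_list (R := ℂ)
    (fun j => (Pi.single (Fin.rev j) 1 : W n)) (Fin.rev i)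
  rw [Fin.rev_rev] at h2
  rw [map_smul, smul_mul_assoc, h2, smul_zero]

theorem spinVec_mul (s : Spinor n) : spinVec n * s = bottom n s • spinVec n := by
  induction s using spinor_induction with
  | h0 r => rw [AlgHom.commutes, Algebra.smul_def, Algebra.commutes]; rfl
  | h1 x y hx hy => rw [mul_add, map_add, hx, hy, add_smul]
  | h2 x w _ => rw [← mul_assoc, spinVec_mul_ι, zero_mul, map_mul, bottom_ι, zero_mul, zero_smul]

theorem mul_spinVec (s : Spinor n) : s * spinVec n = bottom n s • spinVec n := by
  induction s using spinor_induction_right with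
  | h0 r => rw [AlgHom.commutes, Algebra.smul_def]; rfl
  | h1 x y hx hy => rw [add_mul, map_add, hx, hy, add_smul]
  | h2 x w _ => rw [mul_assoc, ι_mul_spinVec, mul_zero, map_mul, bottom_ι, mul_zero, zero_smul]

/-- The power of the parity involution by which the spinor pairing is twisted. -/
noncomputable def twist (n m : ℕ) : Module.End ℂ (Spinor n) := (parity n).toLinearMap ^ m

theorem twist_succ (m : ℕ) (s : Spinor n) : twist n (m + 1) s = parity n (twist n m s) := by
  rw [twist, pow_succ']; rfl

theorem twist_zero (s : Spinor n) : twist n 0 s = s := rfl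

theorem twist_ι_mul (m : ℕ) (w : W n) (s : Spinor n) : twist n m (ExteriorAlgebra.ι ℂ w * s)
    = (-1 : ℂ) ^ m • (ExteriorAlgebra.ι ℂ w * twist n m s) := by
  induction m with
  | zero => simp [twist_zero]
  | succ m ih =>
    rw [twist_succ, ih, twist_succ, map_smul, map_mul, parity_ι, pow_succ, neg_mul]
    module

theorem twist_contr (m : ℕ) (d : Module.Dual ℂ (W n)) (s : Spinor n) : twist n m (contr n d s)
    = (-1 : ℂ) ^ m • contr n d (twist n m s) := by
  induction m with
  | zero => simp [twist_zero]
  | succ m ih =>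
    rw [twist_succ, ih, twist_succ, map_smul, parity_contr, pow_succ]
    module

theorem twist_parity (m : ℕ) (s : Spinor n) : twist n m (parity n s) = parity n (twist n m s) := by
  induction m with
  | zero => rfl
  | succ m ih => rw [twist_succ, ih, twist_succ]

theorem twist_one (m : ℕ) : twist n m 1 = 1 := by
  induction m with
  | zero => rfl
  | succ m ih => rw [twist_succ, ih, map_one]

theorem bottom_twist (m : ℕ) (s : Spinor n) : bottom n (twist n m s) = bottom n s := by
  induction m with
  | zero => rfl
  | succ m ih => rw [twist_succ, bottom_parity, ih]

/-- Contraction is self-adjoint for the pairing `top (rev s * t)`. For scalar `s` both sides vanish;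
the antiderivation rule carries this through products. -/
theorem top_rev_contr_mul (d : Module.Dual ℂ (W n)) (s t : Spinor n) :
    top n (rev n (contr n d s) * t) = top n (rev n s * contr n d t) := by
  induction s using spinor_induction generalizing t with
  | h0 r =>
    rw [contr_algebraMap, map_zero, zero_mul, map_zero, rev_algebraMap, ← Algebra.smul_def, map_smul,
      top_contr, smul_zero]
  | h1 x y hx hy => simp only [map_add, add_mul, hx, hy]
  | h2 x w ih =>
    rw [contr_ι_mul, map_sub, map_smul, rev_mul, rev_mul, rev_ι, sub_mul, mul_assoc, mul_assoc,
      map_sub, ih, contr_ι_mul, mul_sub, map_sub, smul_mul_assoc, mul_smul_comm]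
    ring

/-- The invariant bilinear form on spinors. -/
noncomputable def spinForm (s t : Spinor n) : ℂ := top n (rev n (twist n n s) * t)

/-- For the untwisted pairing, exterior multiplication and contraction are self-adjoint, while
parity is self-adjoint up to `(-1)^n`. Twisting by the `n`-th power of parity gives all three parts
of Clifford multiplication the same sign. -/
theorem spinForm_cliff (v : V n) (s t : Spinor n) :
    spinForm (cliff n v s) t = (-1) ^ n * spinForm s (cliff n v t) := by
  have h1 : top n (parity n (rev n (twist n n s)) * t)
      = (-1) ^ n * top n (rev n (twist n n s) * parity n t) := by
    rw [← top_parity, map_mul (parity n), parity_parity]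
  have hq : ((-1 : ℂ) ^ n) * (-1) ^ n = 1 := by rw [← mul_pow]; norm_num
  rw [spinForm, spinForm, cliff_eq, cliff_eq]
  simp only [map_add, map_smul, twist_ι_mul, twist_parity, twist_contr, rev_mul, rev_ι, add_mul,
    mul_add, smul_mul_assoc, mul_smul_comm, rev_parity, h1, top_rev_contr_mul, smul_eq_mul, mul_assoc]
  ring

/-- An even element is a sum of products of pairs of vectors; for each pair the signs from
`spinForm_cliff` and the signs from `star` cancel separately. -/
theorem spinForm_spinRep {x : CliffordAlgebra (quadForm n)}
    (hx : x ∈ CliffordAlgebra.evenOdd (quadForm n) 0) (s t : Spinor n) :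
    spinForm (spinRep n x s) t = spinForm s (spinRep n (star x) t) := by
  have hl : ∀ v, spinRep n (CliffordAlgebra.ι (quadForm n) v) = cliff n v := fun v =>
    CliffordAlgebra.lift_ι_apply _ _ _
  have hq : ((-1 : ℂ) ^ n) * (-1) ^ n = 1 := by rw [← mul_pow]; norm_num
  induction x, hx using CliffordAlgebra.even_induction generalizing t with
  | algebraMap r =>
    rw [CliffordAlgebra.star_algebraMap, AlgHom.commutes, Module.algebraMap_end_apply,
      Module.algebraMap_end_apply, spinForm, spinForm, map_smul, map_smul, smul_mul_assoc,
      mul_smul_comm]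
  | add x y _ _ hx hy =>
    have h1 : ∀ a b c : Spinor n, spinForm (a + b) c = spinForm a c + spinForm b c :=
      fun a b c => by simp only [spinForm, map_add, add_mul]
    have h2 : ∀ a b c : Spinor n, spinForm a (b + c) = spinForm a b + spinForm a c :=
      fun a b c => by simp only [spinForm, map_add, mul_add]
    rw [star_add, map_add, map_add, LinearMap.add_apply, LinearMap.add_apply, h1, h2, hx, hy]
  | ι_mul_ι_mul v w x _ ih =>
    rw [star_mul, star_mul, CliffordAlgebra.star_ι, CliffordAlgebra.star_ι, neg_mul_neg]
    simp only [map_mul, Module.End.mul_apply, hl, spinForm_cliff, ih]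
    rw [← mul_assoc, hq, one_mul]

/-- Both sides are the invariant form evaluated on `1`, `spinVec` and `x`: pairing with `spinVec`
extracts the bottom component, pairing with `1` extracts the top one. -/
theorem bottom_star_one (x : Spin n) :
    bottom n (spinRep n (star (x : CliffordAlgebra (quadForm n))) 1)
      = top n (spinRep n (x : CliffordAlgebra (quadForm n)) (spinVec n)) := by
  have hx : star (x : CliffordAlgebra (quadForm n)) ∈ CliffordAlgebra.evenOdd (quadForm n) 0 := by
    rw [← spinGroup.coe_star]
    exact spinGroup.mem_even (star x).2
  have h := spinForm_spinRep hx 1 (spinVec n)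
  rw [star_star, spinForm, spinForm, twist_one, mul_spinVec, map_smul, top_spinVec, bottom_rev,
    bottom_twist, smul_eq_mul, mul_one, show rev n 1 = 1 from CliffordAlgebra.reverse.map_one,
    one_mul] at h
  exact h

/-- The spinors which are killed by any `k` contractions. -/
noncomputable def degLT (n : ℕ) : ℕ → Submodule ℂ (Spinor n)
  | 0 => ⊥
  | k + 1 => ⨅ d, (degLT n k).comap (contr n d)

theorem mem_degLT_succ {k : ℕ} {s : Spinor n} :
    s ∈ degLT n (k + 1) ↔ ∀ d, contr n d s ∈ degLT n k := by
  simp [degLT, Submodule.mem_iInf]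

theorem mem_degLT_zero {s : Spinor n} : s ∈ degLT n 0 ↔ s = 0 := Submodule.mem_bot ℂ

theorem degLT_le_succ (k : ℕ) : degLT n k ≤ degLT n (k + 1) := by
  induction k with
  | zero => exact bot_le
  | succ k ih => exact fun s hs => mem_degLT_succ.2 fun d => ih (mem_degLT_succ.1 hs d)

theorem ι_mul_mem_degLT {k : ℕ} {s : Spinor n} (hs : s ∈ degLT n k) (w : W n) :
    ExteriorAlgebra.ι ℂ w * s ∈ degLT n (k + 1) := by
  induction k generalizing s with
  | zero =>
    rw [mem_degLT_zero.1 hs, mul_zero]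
    exact zero_mem _
  | succ k ih =>
    refine mem_degLT_succ.2 fun d => ?_
    rw [contr_ι_mul]
    exact sub_mem (Submodule.smul_mem _ _ hs) (ih (mem_degLT_succ.1 hs d))

theorem parity_mem_degLT {k : ℕ} {s : Spinor n} (hs : s ∈ degLT n k) : parity n s ∈ degLT n k := by
  induction k generalizing s with
  | zero => rw [mem_degLT_zero.1 hs, map_zero]; exact zero_mem _
  | succ k ih =>
    refine mem_degLT_succ.2 fun d => ?_
    rw [contr_parity]
    exact neg_mem (ih (mem_degLT_succ.1 hs d))

theorem contrList_eq_zero {L : List (Module.Dual ℂ (W n))} {s : Spinor n}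
    (hs : s ∈ degLT n L.length) : contrList L s = 0 := by
  induction L generalizing s with
  | nil => rw [mem_degLT_zero.1 hs, map_zero]
  | cons d L ih => rw [contrList_cons, Module.End.mul_apply, ih (mem_degLT_succ.1 hs d)]

theorem top_eq_zero {s : Spinor n} (hs : s ∈ degLT n n) : top n s = 0 := by
  rw [top, LinearMap.comp_apply, contrList_eq_zero (by rwa [length_coords]), map_zero]

/-- Clifford multiplication raises the degree only through the `W`-component; the parity term
preserves the degree bound and contraction lowers it. -/
theorem prod_cliff_sub_mem (L : List (V n)) :
    (L.map fun v => ExteriorAlgebra.ι ℂ (partW n v)).prod ∈ degLT n (L.length + 1) ∧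
    (L.map (cliff n)).prod 1 - (L.map fun v => ExteriorAlgebra.ι ℂ (partW n v)).prod
      ∈ degLT n L.length := by
  induction L with
  | nil =>
    refine ⟨mem_degLT_succ.2 fun d => ?_, ?_⟩
    · rw [List.map_nil, List.prod_nil, contr_one]
      exact zero_mem _
    · simp
  | cons v L ih =>
    obtain ⟨h1, h2⟩ := ih
    simp only [List.map_cons, List.prod_cons, List.length_cons, Module.End.mul_apply]
    set P := (L.map (cliff n)).prod 1
    set Q := (L.map fun v => ExteriorAlgebra.ι ℂ (partW n v)).prod
    refine ⟨ι_mul_mem_degLT h1 _, ?_⟩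
    have hP : P ∈ degLT n (L.length + 1) := by
      have := add_mem (degLT_le_succ _ h2) h1
      rwa [sub_add_cancel] at this
    have h3 : cliff n v P - ExteriorAlgebra.ι ℂ (partW n v) * Q
        = ExteriorAlgebra.ι ℂ (partW n v) * (P - Q) + v (idxU n) • parity n P
          + (2 : ℂ) • contr n (partW' n v) P := by
      rw [cliff_eq, mul_sub]
      abel
    rw [h3]
    exact add_mem (add_mem (ι_mul_mem_degLT h2 _) (Submodule.smul_mem _ _ (parity_mem_degLT hP)))
      (Submodule.smul_mem _ _ (degLT_le_succ _ (mem_degLT_succ.1 hP _)))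

/-- The leading minor of size `n`. -/
noncomputable def leadMinor (M : Mat n) : ℂ := (M.submatrix idxE idxE).det

/-- The Clifford action of the product of the first `n` columns of a matrix. -/
noncomputable def colAct (M : Mat n) : Module.End ℂ (Spinor n) :=
  (List.ofFn fun j : Fin n => cliff n fun a => M a (idxE j)).prod

theorem ιMulti_cols (M : Mat n) :
    ExteriorAlgebra.ιMulti ℂ n (fun j => partW n fun a => M a (idxE j))
      = leadMinor M • spinVec n := by
  rw [leadMinor, spinVec, ← alternatingMap_matrix]
  congr 1
  funext j
  exact pi_eq_sum_univ' _

/-- In top degree only the wedge of the `W`-components of the columns survives, and that is a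
determinant. -/
theorem top_colAct_one (M : Mat n) : top n (colAct M 1) = leadMinor M := by
  have h := (prod_cliff_sub_mem (List.ofFn fun j : Fin n => fun a => M a (idxE j))).2
  rw [List.length_ofFn, List.map_ofFn, List.map_ofFn] at h
  have h1 := top_eq_zero h
  rw [map_sub, sub_eq_zero] at h1
  refine h1.trans ?_
  have h2 := ExteriorAlgebra.ιMulti_apply (R := ℂ) (fun j => partW n fun a => M a (idxE j))
  rw [ιMulti_cols] at h2
  have h3 := congrArg (top n) h2
  rw [map_smul, top_spinVec, smul_eq_mul, mul_one] at h3
  exact h3.symm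

theorem prod_mulLeft_apply {A : Type*} [Ring A] [Algebra ℂ A] (L : List A) (s : A) :
    (L.map (LinearMap.mulLeft ℂ)).prod s = L.prod * s := by
  induction L with
  | nil => simp
  | cons a L ih => simp [Module.End.mul_apply, ih, mul_assoc]

theorem idxE_lt_idxU (j : Fin n) : idxE j < idxU n := Fin.lt_def.2 j.2

theorem idxE_lt_rev_idxE (j k : Fin n) : idxE j < Fin.rev (idxE k) := by
  rw [Fin.lt_def, Fin.val_rev]
  simp only [idxE]
  omega

/-- The first `n` columns of an upper triangular matrix lie in `W`, where Clifford multiplication is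
exterior multiplication. -/
theorem colAct_of_upper {M : Mat n} (hM : M.BlockTriangular id) (s : Spinor n) :
    colAct M s = (leadMinor M * bottom n s) • spinVec n := by
  have h1 : ∀ j : Fin n, cliff n (fun a => M a (idxE j))
      = LinearMap.mulLeft ℂ (ExteriorAlgebra.ι ℂ (partW n fun a => M a (idxE j))) := by
    intro j
    refine LinearMap.ext fun t => ?_
    have e1 : M (idxU n) (idxE j) = 0 := hM (idxE_lt_idxU j)
    have e2 : partW' n (fun a => M a (idxE j)) = 0 := by
      refine LinearMap.ext fun w => ?_
      rw [partW'_apply]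
      exact Finset.sum_eq_zero fun i _ => by
        have : M (Fin.rev (idxE i)) (idxE j) = 0 := hM (idxE_lt_rev_idxE j i)
        rw [this, zero_mul]
    rw [cliff_eq, e1, e2]
    simp
  have h2 : (List.ofFn fun j : Fin n => cliff n fun a => M a (idxE j))
      = (List.ofFn fun j : Fin n => ExteriorAlgebra.ι ℂ (partW n fun a => M a (idxE j))).map
        (LinearMap.mulLeft ℂ) := by
    rw [List.map_ofFn]
    congr 1
    funext j
    exact h1 j
  rw [colAct, h2, prod_mulLeft_apply, ← ExteriorAlgebra.ιMulti_apply, ιMulti_cols, smul_mul_assoc,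
    spinVec_mul, smul_smul]

theorem leadMinor_one : leadMinor (1 : Mat n) = 1 := by
  have h : Function.Injective (idxE : Fin n → Fin (2 * n + 1)) := fun i j h =>
    Fin.ext (Fin.mk.inj h)
  rw [leadMinor, Matrix.submatrix_one _ h, Matrix.det_one]

theorem colAct_one (s : Spinor n) : colAct (1 : Mat n) s = bottom n s • spinVec n := by
  rw [colAct_of_upper Matrix.blockTriangular_one, leadMinor_one, one_mul]

end Spinors
-- The spin morphism and its Fubini–Study form.
section SpinMap

variable {n : ℕ}

theorem spinRep_ι (v : V n) : spinRep n (CliffordAlgebra.ι (quadForm n) v) = cliff n v :=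
  CliffordAlgebra.lift_ι_apply _ _ _

theorem Covers.mul {x y : Spin n} {g h : SO n} (hx : Covers x g) (hy : Covers y h) :
    Covers (x * y) (g * h) := fun v => by
  have h1 : Matrix.toLin' (g * h).1.1 v = Matrix.toLin' g.1.1 (Matrix.toLin' h.1.1 v) := by
    rw [SO_coe_mul, Matrix.toLin'_mul]; rfl
  rw [h1, Submonoid.coe_mul, mul_assoc, hy v, ← mul_assoc, hx, mul_assoc]

theorem Covers.star_inv {x : Spin n} {g : SO n} (hx : Covers x g) : Covers (star x) g⁻¹ := fun v => by
  have h1 := hx (Matrix.toLin' (g⁻¹).1.1 v)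
  have h2 : Matrix.toLin' g.1.1 (Matrix.toLin' (g⁻¹).1.1 v) = v := by
    have h3 : g.1.1 * (g⁻¹).1.1 = 1 := SL_coe_mul_inv g.1
    rw [← LinearMap.comp_apply, ← Matrix.toLin'_mul, h3, Matrix.toLin'_one, LinearMap.id_apply]
  rw [h2] at h1
  calc _ = star (x : CliffordAlgebra (quadForm n)) *
        (CliffordAlgebra.ι (quadForm n) v * x) * star (x : CliffordAlgebra (quadForm n)) := by
        rw [mul_assoc, mul_assoc, spinGroup.mul_star_self_of_mem x.2, mul_one, spinGroup.coe_star]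
    _ = _ := by
        rw [← h1, ← mul_assoc, spinGroup.coe_star_mul_self, one_mul, spinGroup.coe_star]

theorem spinRep_mul_apply (x y : Spin n) (s : Spinor n) :
    spinRep n ((x * y : Spin n) : CliffordAlgebra (quadForm n)) s
      = spinRep n (x : CliffordAlgebra (quadForm n))
        (spinRep n (y : CliffordAlgebra (quadForm n)) s) := by
  rw [Submonoid.coe_mul, map_mul, Module.End.mul_apply]

theorem spinRep_spinRep_star (x : Spin n) (s : Spinor n) :
    spinRep n (x : CliffordAlgebra (quadForm n))
      (spinRep n ((star x : Spin n) : CliffordAlgebra (quadForm n)) s) = s := by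
  rw [← spinRep_mul_apply, Submonoid.coe_mul, spinGroup.coe_star,
    spinGroup.mul_star_self_of_mem x.2,
    map_one, Module.End.one_apply]

theorem Covers.spinRep_mul_prod {x : Spin n} {g : SO n} (hx : Covers x g) (L : List (V n)) :
    spinRep n (x : CliffordAlgebra (quadForm n)) * (L.map (cliff n)).prod
      = ((L.map (Matrix.toLin' g.1.1)).map (cliff n)).prod
        * spinRep n (x : CliffordAlgebra (quadForm n)) := by
  induction L with
  | nil => simp
  | cons v L ih =>
    have h1 := congrArg (spinRep n) (hx v)
    rw [map_mul, map_mul, spinRep_ι, spinRep_ι] at h1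
    rw [List.map_cons, List.prod_cons, ← mul_assoc, h1, mul_assoc, ih, List.map_cons, List.map_cons,
      List.prod_cons, mul_assoc]

/-- The Clifford product of `e_1, …, e_n` sends any spinor `s` to `bottom s` times the highest
weight vector; conjugating by `x` replaces the `e_j` by the columns of `g`. Thus the spin line is
reached from the matrix `g` alone, without solving for `x`. -/
theorem Covers.spinRep_spinVec {x : Spin n} {g : SO n} (hx : Covers x g) (s : Spinor n) :
    bottom n s • spinRep n (x : CliffordAlgebra (quadForm n)) (spinVec n)
      = colAct g.1.1 (spinRep n (x : CliffordAlgebra (quadForm n)) s) := by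
  have h1 := congrArg (fun T => T s)
    (hx.spinRep_mul_prod (List.ofFn fun j : Fin n => fun a => (1 : Mat n) a (idxE j)))
  simp only [Module.End.mul_apply, List.map_ofFn] at h1
  have h2 : (List.ofFn (cliff n ∘ fun j : Fin n => fun a => (1 : Mat n) a (idxE j))).prod s
      = bottom n s • spinVec n := colAct_one s
  rw [h2, map_smul] at h1
  rw [h1, colAct]
  congr 4
  funext j
  refine funext fun a => ?_
  change (g.1.1 * (1 : Mat n)) a (idxE j) = g.1.1 a (idxE j)
  rw [Matrix.mul_one]

/-- Apply `spinRep_spinVec` to the spinor `star y · 1` and take top components: by `bottom_star_one`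
the scalar on the left is again the top component of `y · spinVec`. This square expresses that the
spin weight is half of `L_1 + ⋯ + L_n`. -/
theorem Covers.top_sq {y : Spin n} {u : SO n} (hy : Covers y u) :
    top n (spinRep n (y : CliffordAlgebra (quadForm n)) (spinVec n)) ^ 2 = leadMinor u.1.1 := by
  have h1 := hy.spinRep_spinVec (spinRep n ((star y : Spin n) : CliffordAlgebra (quadForm n)) 1)
  rw [spinRep_spinRep_star] at h1
  have h2 := congrArg (top n) h1
  rw [spinGroup.coe_star, map_smul, bottom_star_one, top_colAct_one, smul_eq_mul, ← pow_two] at h2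
  exact h2

theorem Covers.spinRep_spinVec_of_upper {y : Spin n} {b : SO n} (hy : Covers y b)
    (hb : b.1.1.BlockTriangular id) :
    spinRep n (y : CliffordAlgebra (quadForm n)) (spinVec n)
      = top n (spinRep n (y : CliffordAlgebra (quadForm n)) (spinVec n)) • spinVec n := by
  have h1 := hy.spinRep_spinVec 1
  rw [map_one, one_smul, colAct_of_upper hb] at h1
  have h2 := congrArg (top n) h1
  rw [map_smul, top_spinVec, smul_eq_mul, mul_one] at h2
  rw [h2]
  exact h1

theorem leadMinor_of_upper {b : Mat n} (hb : b.BlockTriangular id) :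
    leadMinor b = ∏ j : Fin (2 * n + 1), if j.val < n then b j j else 1 := by
  have h1 : (b.submatrix idxE idxE).BlockTriangular (id : Fin n → Fin n) := fun i j hij =>
    hb (Fin.lt_def.2 hij)
  rw [prod_ite_lt_eq (show n ≤ 2 * n + 1 by omega) fun j => b j j, leadMinor,
    Matrix.det_of_isUpperTriangular h1]
  rfl

/-- After Iwasawa only the upper triangular factor matters; it acts by a scalar whose square is the
product of the first `n` diagonal entries. Squaring the norm avoids choosing a square root. -/
theorem inner_spinRep_spinVec {H : InnerProductSpace.Core ℂ (Spinor n)} (hH : IsInvariantSpin H)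
    {x : Spin n} {g : SO n} (hx : Covers x g) :
    (H.inner (spinRep n (x : CliffordAlgebra (quadForm n)) (spinVec n))
      (spinRep n (x : CliffordAlgebra (quadForm n)) (spinVec n))).re ^ 2
      = tau g.1 n * (H.inner (spinVec n) (spinVec n)).re ^ 2 := by
  obtain ⟨k, b, hk, hb, hg⟩ := exists_compact_mul_upper g
  obtain ⟨y, hy⟩ := exists_covers k
  have hyx : Covers (star y * x) b := by
    have h1 := hy.star_inv.mul hx
    rwa [hg, inv_mul_cancel_left] at h1
  have h2 : spinRep n (x : CliffordAlgebra (quadForm n)) (spinVec n)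
      = spinRep n (y : CliffordAlgebra (quadForm n))
        (spinRep n ((star y * x : Spin n) : CliffordAlgebra (quadForm n)) (spinVec n)) := by
    rw [spinRep_mul_apply, spinRep_spinRep_star]
  rw [h2, hH k y hk hy, hyx.spinRep_spinVec_of_upper hb, core_inner_smul_smul_re, mul_pow,
    ← norm_pow, hyx.top_sq, leadMinor_of_upper hb, tau_eq hk hb (by rw [hg]; rfl)]

theorem piSpin_mk {x : Spin n} {g : SO n} (hx : Covers x g) :
    piSpin (g : FlagSO n) = Projectivization.mk ℂ
      (spinRep n (x : CliffordAlgebra (quadForm n)) (spinVec n)) (spinRep_spinVec_ne_zero x) := by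
  obtain ⟨g', hg', hy⟩ := Classical.epsilon_spec
    (p := fun x : Spin n => ∃ g' : SO n, (g' : FlagSO n) = (g : FlagSO n) ∧ Covers x g')
    ⟨x, g, rfl, hx⟩
  rw [piSpin, Projectivization.mk_eq_mk_iff']
  set y := Classical.epsilon fun x : Spin n =>
    ∃ g' : SO n, (g' : FlagSO n) = (g : FlagSO n) ∧ Covers x g'
  have hb : g⁻¹ * g' ∈ borel n := QuotientGroup.eq.1 hg'.symm
  have h1 : spinRep n (y : CliffordAlgebra (quadForm n)) (spinVec n)
      = spinRep n (x : CliffordAlgebra (quadForm n))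
        (spinRep n ((star x * y : Spin n) : CliffordAlgebra (quadForm n)) (spinVec n)) := by
    rw [spinRep_mul_apply, spinRep_spinRep_star]
  rw [h1, (hx.star_inv.mul hy).spinRep_spinVec_of_upper (borelSL_isUpper hb), map_smul]
  exact ⟨_, rfl⟩

/-- The Clifford action of the product of `n` vectors on a spinor. -/
noncomputable def cliffMultilinear (s : Spinor n) :
    MultilinearMap ℂ (fun _ : Fin n => V n) (Spinor n) :=
  (LinearMap.applyₗ s).compMultilinearMap
    ((MultilinearMap.mkPiAlgebraFin ℂ n (Module.End ℂ (Spinor n))).compLinearMap fun _ => cliff n)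

theorem cliffMultilinear_apply (M : Mat n) (s : Spinor n) :
    cliffMultilinear s (fun j a => M a (idxE j)) = colAct M s := by
  simp [cliffMultilinear, colAct]

open Filter Topology

variable {S : Type*} [TopologicalSpace S]
variable {f : S → FlagSO n} {c : OpenPartialHomeomorph S ℂ} {G : ℂ → SO n} {z : ℂ}

theorem analyticAt_leadMinor {F : ℂ → Mat n} (hF : ∀ a b, AnalyticAt ℂ (fun w => F w a b) z) :
    AnalyticAt ℂ (fun w => leadMinor (F w)) z := by
  simp only [leadMinor, Matrix.det_apply, Matrix.submatrix_apply]
  refine Finset.analyticAt_fun_sum _ fun σ _ => ?_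
  exact (Finset.analyticAt_fun_prod _ fun i _ => hF _ _).const_smul

/-- The Clifford product of the columns of `G w` on a fixed spinor is multilinear in those columns,
hence holomorphic, and spans the spin line. Its scale differs from that of `X w · spinVec` by a
square root of the holomorphic function `μ`, so the logarithms of the squared norms differ by the
harmonic function `log |μ|`. No continuity of the lifts `X w` is needed. -/
theorem fsForm_spin (hG : ∀ a b, AnalyticAt ℂ (fun w => (G w).1.1 a b) z)
    (hf : ∀ᶠ w in 𝓝 z, f (c.symm w) = (G w : FlagSO n))
    {H : InnerProductSpace.Core ℂ (Spinor n)} (hH : IsInvariantSpin H)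
    (hτ : ContDiffAt ℝ ∞ (fun w => Real.log (tau (G w).1 n)) z) :
    fsForm H (piSpin ∘ f) c z = 1 / 2 * ddbar (fun w => Real.log (tau (G w).1 n)) z := by
  choose X hX using fun w => exists_covers (G w)
  -- This spinor makes the section nonzero at `z`, since there `μ = 1`.
  set s := spinRep n (X z : CliffordAlgebra (quadForm n)) 1 with hs
  set μ : ℂ → ℂ := fun w => leadMinor ((G z)⁻¹ * G w).1.1 with hμ
  have hμa : AnalyticAt ℂ μ z := analyticAt_leadMinor fun a b => by
    simp only [SO_coe_mul, Matrix.mul_apply]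
    exact Finset.analyticAt_fun_sum _ fun i _ => analyticAt_const.mul (hG _ _)
  have hμz : μ z ≠ 0 := by
    have h1 : μ z = 1 := by
      rw [hμ]
      change leadMinor ((G z)⁻¹ * G z).1.1 = 1
      rw [inv_mul_cancel]
      exact leadMinor_one
    rw [h1]
    exact one_ne_zero
  -- The factor is the bottom component of `star (X w) · X z · 1`, that is, the top component of
  -- `star (X z) · X w · spinVec`; its square is a leading minor of `(G z)⁻¹ G w`.
  have hM : ∀ w, ∃ a : ℂ, a ^ 2 = μ w ∧ cliffMultilinear s (fun j b => (G w).1.1 b (idxE j))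
      = a • spinRep n (X w : CliffordAlgebra (quadForm n)) (spinVec n) := by
    intro w
    have hy := (hX z).star_inv.mul (hX w)
    refine ⟨_, hy.top_sq, ?_⟩
    have h1 := (hX w).spinRep_spinVec
      (spinRep n ((star (X w) : Spin n) : CliffordAlgebra (quadForm n)) s)
    rw [spinRep_spinRep_star] at h1
    rw [cliffMultilinear_apply, ← h1, hs, ← spinRep_mul_apply, ← bottom_star_one,
      ← spinGroup.coe_star, star_mul, star_star]
  have hev : ∀ᶠ w in 𝓝 z, ∃ h, (piSpin ∘ f) (c.symm w) = Projectivization.mk ℂ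
      (cliffMultilinear s fun j a => (G w).1.1 a (idxE j)) h := by
    filter_upwards [hf, hμa.continuousAt.eventually_ne hμz] with w hw hw0
    obtain ⟨a, ha, ha'⟩ := hM w
    have ha0 : a ≠ 0 := by
      rintro rfl
      exact hw0 (by rw [← ha]; simp)
    refine ⟨by rw [ha']; exact smul_ne_zero ha0 (spinRep_spinVec_ne_zero _), ?_⟩
    rw [Function.comp_apply, hw, piSpin_mk (hX w), Projectivization.mk_eq_mk_iff']
    exact ⟨a⁻¹, by rw [ha', inv_smul_smul₀ ha0]⟩
  obtain ⟨-, h2, -⟩ := fsForm_multilinear H (piSpin ∘ f) c (cliffMultilinear s)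
    (x := fun w j a => (G w).1.1 a (idxE j)) (fun j a => hG _ _) hev
  have hpos : ∀ v : Spinor n, v ≠ 0 → 0 < (H.inner v v).re := fun v hv => by
    refine lt_of_le_of_ne (H.re_inner_nonneg _) fun h => hv (H.definite _ ?_)
    rw [core_inner_self_eq_re]
    change (((H.inner v v).re : ℝ) : ℂ) = 0
    rw [← h, Complex.ofReal_zero]
  have hv0 : spinVec n ≠ 0 := fun h => by
    have := top_spinVec (n := n)
    rw [h, map_zero] at this
    exact zero_ne_one this
  set C := (H.inner (spinVec n) (spinVec n)).re with hC
  have h3 : (fun w => Real.log (H.inner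
      (cliffMultilinear s fun j a => (G w).1.1 a (idxE j))
      (cliffMultilinear s fun j a => (G w).1.1 a (idxE j))).re)
      =ᶠ[𝓝 z] fun w => (Real.log ‖μ w‖ + 1 / 2 * Real.log (tau (G w).1 n)) + Real.log C := by
    filter_upwards [hμa.continuousAt.eventually_ne hμz] with w hw0
    obtain ⟨a, ha, ha'⟩ := hM w
    have h4 := inner_spinRep_spinVec hH (hX w)
    have h5 := hpos _ (spinRep_spinVec_ne_zero (X w))
    rw [ha', core_inner_smul_smul_re, ← norm_pow, ha, Real.log_mul (norm_ne_zero_iff.2 hw0) h5.ne',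
      add_assoc]
    congr 1
    have h6 := congrArg Real.log h4
    rw [Real.log_pow, Real.log_mul (tau_pos _ _).ne' (pow_pos (hpos _ hv0) 2).ne', Real.log_pow] at h6
    push_cast at h6
    rw [hC]
    linarith
  rw [h2, ddbar_congr h3, ddbar_add ((contDiffAt_log_norm hμa hμz).add (contDiffAt_const.mul hτ))
    contDiffAt_const, ddbar_add (contDiffAt_log_norm hμa hμz) (contDiffAt_const.mul hτ),
    ddbar_log_norm hμa hμz, ddbar_const, ddbar_const_mul _ hτ]
  ring

end SpinMap
-- Rows of the Cartan matrices of types `A` and `B`.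
section CartanSums

theorem sum_tridiagonal {N i : ℕ} (hi : i < N) (F : ℕ → ℝ) (h0 : F 0 = 0) (x y : ℝ) :
    ∑ j : Fin N, ((if j.val = i then x else 0) + (if j.val = i + 1 then y else 0)
      - (if j.val + 1 = i then F i else 0))
      = x + (if i + 1 < N then y else 0) - F i := by
  rw [Fin.sum_univ_eq_sum_range fun j => (if j = i then x else 0) + (if j = i + 1 then y else 0)
    - (if j + 1 = i then F i else 0)]
  rw [Finset.sum_sub_distrib, Finset.sum_add_distrib, Finset.sum_ite_eq', Finset.sum_ite_eq']
  simp only [Finset.mem_range, hi, if_true]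
  congr 1
  cases i with
  | zero => simp [h0]
  | succ i =>
    simp only [Nat.add_right_cancel_iff]
    rw [Finset.sum_ite_eq', if_pos (Finset.mem_range.2 (by omega))]

theorem sum_cartanA {N : ℕ} (i : Fin N) (hi : i.val + 1 < N) (F : ℕ → ℝ) (h0 : F 0 = 0) :
    ∑ j : Fin N, (CartanMatrix.A N i j : ℝ) * F (j.val + 1)
      = 2 * F (i.val + 1) - F i.val - F (i.val + 2) := by
  have h := sum_tridiagonal i.2 F h0 (2 * F (i.val + 1)) (-F (i.val + 2))
  rw [if_pos hi] at h
  rw [show 2 * F (i.val + 1) - F i.val - F (i.val + 2)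
    = 2 * F (i.val + 1) + -F (i.val + 2) - F i.val by ring, ← h]
  refine Finset.sum_congr rfl fun j _ => ?_
  simp only [CartanMatrix.A, Matrix.of_apply]
  by_cases h1 : i = j
  · subst h1
    simp
  · have h2 : j.val ≠ i.val := fun h => h1 (Fin.ext h.symm)
    by_cases h3 : j.val = i.val + 1
    · rw [if_neg h1, if_pos (Or.inl h3.symm), if_neg h2, if_pos h3,
        if_neg (show ¬ j.val + 1 = i.val by omega), h3]
      push_cast
      ring
    · by_cases h4 : j.val + 1 = i.val
      · simp [h1, h2, h3, h4]
      · simp [h1, h2, h3, h4, Ne.symm h3]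

/-- The factor `1 / 2` on the last form turns the entry `-2` above the corner into `-1`. In the last
row `2 · (1 / 2) = 1` matches `2F_n - F_{n+1} = F_n`. -/
theorem sum_cartanB {n : ℕ} (i : Fin n) (F : ℕ → ℝ) (h0 : F 0 = 0) (hn : F (n + 1) = F n) :
    ∑ j : Fin n, (CartanMatrix.B n i j : ℝ) * ((if j.val + 1 < n then 1 else 1 / 2) * F (j.val + 1))
      = 2 * F (i.val + 1) - F i.val - F (i.val + 2) := by
  have h := sum_tridiagonal i.2 F h0 ((if i.val + 1 < n then 2 else 1) * F (i.val + 1))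
    (-F (i.val + 2))
  have e : 2 * F (i.val + 1) - F i.val - F (i.val + 2)
      = (if i.val + 1 < n then 2 else 1) * F (i.val + 1)
        + (if i.val + 1 < n then -F (i.val + 2) else 0) - F i.val := by
    by_cases hi : i.val + 1 < n
    · simp only [hi, if_true]
      ring
    · have h1 : i.val + 1 = n := by have := i.2; omega
      rw [if_neg hi, if_neg hi, show i.val + 2 = n + 1 by omega, hn, h1]
      ring
  rw [e, ← h]
  refine Finset.sum_congr rfl fun j _ => ?_
  simp only [CartanMatrix.B, Matrix.of_apply]
  by_cases h1 : i = j
  · subst h1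
    by_cases hi : i.val + 1 < n <;> simp [hi]
  · have h2 : j.val ≠ i.val := fun h => h1 (Fin.ext h.symm)
    by_cases h3 : j.val = i.val + 1
    · rw [if_neg h1, if_pos h3.symm, if_neg h2, if_pos h3, if_neg (show ¬ j.val + 1 = i.val by omega),
        h3]
      have hj := j.2
      by_cases h5 : i.val + 1 = n - 1
      · rw [if_pos h5, if_neg (show ¬ i.val + 1 + 1 < n by omega)]
        push_cast
        ring
      · rw [if_neg h5, if_pos (show i.val + 1 + 1 < n by omega)]
        push_cast
        ring
    · rw [if_neg h1, if_neg (Ne.symm h3), if_neg h2, if_neg h3]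
      by_cases h4 : j.val + 1 = i.val
      · have := i.2
        rw [if_pos h4, if_pos h4, if_pos (show j.val + 1 < n by omega), h4]
        push_cast
        ring
      · rw [if_neg h4, if_neg h4]
        simp

end CartanSums

/-! ### Curvature of the metric forms and of the root line bundles. -/

section Curvature
open Filter Topology

/-- Where the form does not vanish, its logarithm is a signed sum of the `log t` plus the harmonic
function `2 log |a|` and a constant. Only the `log t` are assumed smooth; `t` itself is recovered by
exponentiating. -/
theorem contDiffAt_and_curvature_of_eventuallyEq {h : ℂ → ℝ} {a : ℂ → ℂ} {C : ℝ} {z : ℂ}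
    {t₀ t₁ t₂ : ℂ → ℝ} (ha : AnalyticAt ℂ a z) (hC : 0 ≤ C)
    (p₀ : ∀ w, 0 < t₀ w) (p₁ : ∀ w, 0 < t₁ w) (p₂ : ∀ w, 0 < t₂ w)
    (h₀ : ContDiffAt ℝ ∞ (fun w => Real.log (t₀ w)) z)
    (h₁ : ContDiffAt ℝ ∞ (fun w => Real.log (t₁ w)) z)
    (h₂ : ContDiffAt ℝ ∞ (fun w => Real.log (t₂ w)) z)
    (hh : h =ᶠ[𝓝 z] fun w => C * (‖a w‖ ^ 2 * (t₀ w * t₂ w / t₁ w ^ 2))) :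
    ContDiffAt ℝ ∞ h z ∧ 0 ≤ h z ∧ (h z ≠ 0 → curvature h z
      = 2 * ddbar (fun w => Real.log (t₁ w)) z - ddbar (fun w => Real.log (t₀ w)) z
        - ddbar (fun w => Real.log (t₂ w)) z) := by
  have hexp : ∀ {t : ℂ → ℝ}, (∀ w, 0 < t w) → ContDiffAt ℝ ∞ (fun w => Real.log (t w)) z →
      ContDiffAt ℝ ∞ t z := fun {t} p ht => by
    have h1 := ht.exp
    simpa only [Real.exp_log (p _)] using h1
  have hz : h z = C * (‖a z‖ ^ 2 * (t₀ z * t₂ z / t₁ z ^ 2)) := hh.self_of_nhds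
  refine ⟨?_, ?_, fun hne => ?_⟩
  · refine ContDiffAt.congr_of_eventuallyEq ?_ hh
    have ha' : ContDiffAt ℝ ∞ a z := (ha.contDiffAt (n := ∞)).restrict_scalars ℝ
    exact contDiffAt_const.mul ((ha'.norm_sq ℝ).mul
      (((hexp p₀ h₀).mul (hexp p₂ h₂)).div ((hexp p₁ h₁).pow 2) (pow_pos (p₁ z) 2).ne'))
  · rw [hz]
    have := p₀ z
    have := p₁ z
    have := p₂ z
    positivity
  · have hC0 : C ≠ 0 := by
      rintro rfl
      exact hne (by rw [hz, zero_mul])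
    have ha0 : a z ≠ 0 := by
      intro h0
      exact hne (by rw [hz, h0]; simp)
    have h3 : (fun w => Real.log (h w)) =ᶠ[𝓝 z] fun w => (((Real.log C + 2 * Real.log ‖a w‖)
        + Real.log (t₀ w)) + Real.log (t₂ w)) + (-2) * Real.log (t₁ w) := by
      filter_upwards [hh, ha.continuousAt.eventually_ne ha0] with w hw hw0
      have q₀ := (p₀ w).ne'
      have q₁ := (p₁ w).ne'
      have q₂ := (p₂ w).ne'
      have q := norm_ne_zero_iff.2 hw0
      rw [hw, Real.log_mul hC0 (by positivity), Real.log_mul (by positivity) (by positivity),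
        Real.log_div (by positivity) (by positivity), Real.log_mul q₀ q₂, Real.log_pow, Real.log_pow]
      push_cast
      ring
    have hl := contDiffAt_log_norm ha ha0
    have c1 : ContDiffAt ℝ ∞ (fun w => 2 * Real.log ‖a w‖) z := contDiffAt_const.mul hl
    have c0 : ContDiffAt ℝ ∞ (fun _ : ℂ => Real.log C) z := contDiffAt_const
    rw [curvature, ddbar_congr h3, ddbar_add (((c0.add c1).add h₀).add h₂) (contDiffAt_const.mul h₁),
      ddbar_add ((c0.add c1).add h₀) h₂, ddbar_add (c0.add c1) h₀, ddbar_add c0 c1, ddbar_const,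
      ddbar_const_mul _ hl, ddbar_const_mul _ h₁, ddbar_log_norm ha ha0]
    ring

variable {n : ℕ} {S : Type*} [TopologicalSpace S] [ChartedSpace ℂ S]
variable {f : S → FlagSO n} {c : OpenPartialHomeomorph S ℂ} {G : ℂ → SO n} {z : ℂ}

theorem log_gradedNorm_sq (g : SL n) (j : Fin (2 * n + 1)) :
    Real.log (gradedNorm g j ^ 2) = Real.log (tau g (j.val + 1)) - Real.log (tau g j.val) := by
  rw [tau_succ, Real.log_mul (tau_pos _ _).ne' (pow_pos (gradedNorm_pos g j) 2).ne']
  ring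

theorem tau_middle (g : SO n) : tau g.1 (n + 1) = tau g.1 n := by
  have h := tau_succ g.1 (idxU n)
  rw [gradedNorm_middle, one_pow, mul_one] at h
  exact h

/-- An arbitrary lift `g` differs from `G` by an upper triangular factor `b` with holomorphic
nonvanishing diagonal entries. These rescale the graded norms and contribute only harmonic terms,
leaving the second difference of `log tau`. -/
theorem rootCurvature_eq (hG : ∀ᶠ w in 𝓝 z, ∀ a b, AnalyticAt ℂ (fun w => (G w).1.1 a b) w)
    (hf : ∀ᶠ w in 𝓝 z, f (c.symm w) = (G w : FlagSO n))
    (hc : c ∈ IsManifold.maximalAtlas 𝓘(ℂ, ℂ) ω S) (hz : z ∈ c.target)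
    (hτ : ∀ k, k ≤ 2 * n + 1 → ContDiffAt ℝ ∞ (fun w => Real.log (tau (G w).1 k)) z)
    {U : Set S} {g : S → SL n} (hg : IsLiftSL (incl n ∘ f) U g) (hzU : c.symm z ∈ U)
    (i : Fin (2 * n)) :
    rootCurvature g c i z = 2 * ddbar (fun w => Real.log (tau (G w).1 (i.val + 1))) z
      - ddbar (fun w => Real.log (tau (G w).1 i.val)) z
      - ddbar (fun w => Real.log (tau (G w).1 (i.val + 2))) z := by
  let b : ℂ → SL n := fun w => (G w).1⁻¹ * g (c.symm w)
  have hb : ∀ᶠ w in 𝓝 z, b w ∈ borelSL n := by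
    filter_upwards [hf, eventually_mem_frame hg.1.1 hz hzU] with w hw hwU
    have h1 := hg.2 _ hwU.2
    rw [Function.comp_apply, hw, incl_mk] at h1
    exact QuotientGroup.eq.1 h1
  have hgn : ∀ᶠ w in 𝓝 z, ∀ j, gradedNorm (g (c.symm w)) j
      = ‖(b w).1 j j‖ * gradedNorm (G w).1 j := by
    filter_upwards [hb] with w hw j
    refine gradedNorm_mul (borelSL_isUpper hw) ?_ j
    have h1 : g (c.symm w) = (G w).1 * b w := (mul_inv_cancel_left _ _).symm
    exact congrArg Subtype.val h1
  have hba : ∀ j, AnalyticAt ℂ (fun w => (b w).1 j j) z := by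
    intro j
    have h1 : (fun w => (b w).1 j j) = fun w =>
        ∑ l, (G w).1.1 (Fin.rev l) (Fin.rev j) * (g (c.symm w)).1 l j := by
      funext w
      refine (Matrix.mul_apply (M := ((G w)⁻¹).1.1) (N := (g (c.symm w)).1)).trans ?_
      exact Finset.sum_congr rfl fun l _ => by rw [SO_inv_apply]
    rw [h1]
    exact Finset.analyticAt_fun_sum _ fun l _ =>
      (hG.self_of_nhds _ _).mul (analyticAt_frame hg.1 hc hz hzU _ _)
  have hb0 : ∀ w, b w ∈ borelSL n → ∀ j, (b w).1 j j ≠ 0 := fun w hw j =>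
    diag_ne_zero_of_isUpper (borelSL_isUpper hw) (by rw [(b w).2]; exact one_ne_zero) j
  have h3 : (fun w => Real.log ((gradedNorm (g (c.symm w)) i.succ /
      gradedNorm (g (c.symm w)) i.castSucc) ^ 2)) =ᶠ[𝓝 z] fun w =>
      (((2 * Real.log ‖(b w).1 i.succ i.succ‖ + (-2) * Real.log ‖(b w).1 i.castSucc i.castSucc‖)
        + Real.log (tau (G w).1 (i.val + 2))) + (-2) * Real.log (tau (G w).1 (i.val + 1)))
        + Real.log (tau (G w).1 i.val) := by
    filter_upwards [hgn, hb] with w hw hwb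
    have q1 := norm_ne_zero_iff.2 (hb0 w hwb i.succ)
    have q2 := norm_ne_zero_iff.2 (hb0 w hwb i.castSucc)
    have e1 := log_gradedNorm_sq (G w).1 i.succ
    have e2 := log_gradedNorm_sq (G w).1 i.castSucc
    rw [Real.log_pow, Fin.val_succ] at e1
    rw [Real.log_pow, Fin.val_castSucc] at e2
    push_cast at e1 e2
    rw [Real.log_pow, hw, hw, Real.log_div (mul_ne_zero q1 (gradedNorm_pos _ _).ne')
      (mul_ne_zero q2 (gradedNorm_pos _ _).ne'), Real.log_mul q1 (gradedNorm_pos _ _).ne',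
      Real.log_mul q2 (gradedNorm_pos _ _).ne']
    push_cast
    rw [show i.val + 2 = i.val + 1 + 1 from rfl]
    linarith
  have hbz := hb.self_of_nhds
  have l1 := contDiffAt_log_norm (hba i.succ) (hb0 z hbz _)
  have l2 := contDiffAt_log_norm (hba i.castSucc) (hb0 z hbz _)
  have c1 : ContDiffAt ℝ ∞ (fun w => 2 * Real.log ‖(b w).1 i.succ i.succ‖) z :=
    contDiffAt_const.mul l1
  have c2 : ContDiffAt ℝ ∞ (fun w => (-2) * Real.log ‖(b w).1 i.castSucc i.castSucc‖) z :=
    contDiffAt_const.mul l2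
  have hi := i.2
  have t0 := hτ i.val (by omega)
  have t1 := hτ (i.val + 1) (by omega)
  have t2 := hτ (i.val + 2) (by omega)
  have c3 : ContDiffAt ℝ ∞ (fun w => (-2) * Real.log (tau (G w).1 (i.val + 1))) z :=
    contDiffAt_const.mul t1
  rw [rootCurvature, ddbar_congr h3, ddbar_add (((c1.add c2).add t2).add c3) t0,
    ddbar_add ((c1.add c2).add t2) c3, ddbar_add (c1.add c2) t2, ddbar_add c1 c2,
    ddbar_const_mul _ l1, ddbar_const_mul _ l2, ddbar_const_mul _ t1,
    ddbar_log_norm (hba i.succ) (hb0 z hbz _), ddbar_log_norm (hba i.castSucc) (hb0 z hbz _)]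
  ring

end Curvature
end LocalPlucker

/-! ### The local Plücker formulas. -/

open LocalPlucker
theorem mainTheorem2 (n : ℕ) {S : Type*} [TopologicalSpace S] [ChartedSpace ℂ S]
    [IsManifold 𝓘(ℂ, ℂ) ω S]
    -- a holomorphic integral curve of `𝒩`
    (f : S → FlagSO n) (hf : IsHolomorphicCurve f) (hN : IsIntegralCurveOfN f)
    -- `K`-invariant Hermitian inner products on the representations
    (H : ∀ k, InnerProductSpace.Core ℂ (⋀[ℂ]^k (V n))) (hH : ∀ k, IsInvariantExt (H k))
    (Hs : InnerProductSpace.Core ℂ (Spinor n)) (hHs : IsInvariantSpin Hs)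
    -- a local holomorphic coordinate, and a value `z` of it
    (c : OpenPartialHomeomorph S ℂ) (hc : c ∈ IsManifold.maximalAtlas 𝓘(ℂ, ℂ) ω S)
    (z : ℂ) (hz : z ∈ c.target) :
    -- the forms `φ_i` are smooth and nonnegative
    (∀ i : Fin n, ContDiffAt ℝ ∞ (metric H Hs f c i) z ∧ 0 ≤ metric H Hs f c i z) ∧
    -- the Plücker formulas `θ = C φ`, with the Cartan matrix `C` of type `B_n`
    (∀ i : Fin n, metric H Hs f c i z ≠ 0 →
      curvature (metric H Hs f c i) z
        = ∑ j : Fin n, (CartanMatrix.B n i j : ℝ) * metric H Hs f c j z) ∧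
    -- `θ_i` is the pullback under `i ∘ f` of the `i`-th component of `ϑ̂`, for `i = 1, …, n`
    (∀ i : Fin n, metric H Hs f c i z ≠ 0 →
      ∀ (U : Set S) (g : S → SL n), IsLiftSL (incl n ∘ f) U g → c.symm z ∈ U →
        curvature (metric H Hs f c i) z = rootCurvature g c (Fin.castLE (by omega) i) z) ∧
    -- the first `n` of the classical formulas `ϑ̂ = A φ̂` on `Fl(V)`, pulled back under `i ∘ f`
    (∀ (i : Fin n) (U : Set S) (g : S → SL n), IsLiftSL (incl n ∘ f) U g → c.symm z ∈ U →
      rootCurvature g c (Fin.castLE (by omega) i) z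
        = ∑ j : Fin (2 * n), (CartanMatrix.A (2 * n) (Fin.castLE (by omega) i) j : ℝ)
            * metricFl H (incl n ∘ f) c j z) ∧
    -- `φ̂_i = φ_i` for `i < n`
    (∀ i : Fin n, i.val + 1 < n →
      metricFl H (incl n ∘ f) c (Fin.castLE (by omega) i) z = metric H Hs f c i z) ∧
    -- `φ̂_n = 2 φ_n` and `φ̂_{n+1} = 2 φ_n`
    (∀ i : Fin n, i.val + 1 = n →
      metricFl H (incl n ∘ f) c (Fin.castLE (by omega) i) z = 2 * metric H Hs f c i z ∧
      metricFl H (incl n ∘ f) c ⟨i.val + 1, by omega⟩ z = 2 * metric H Hs f c i z) := by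
  obtain ⟨G, A, hGA⟩ := exists_hessenberg_frame hf hN hc hz
  have hfG : ∀ᶠ w in nhds z, ∀ᶠ w' in nhds w, f (c.symm w') = (G w' : FlagSO n) :=
    (hGA.mono fun w hw => hw.1).eventually_nhds
  let Φ : ℕ → ℂ → ℝ := fun k => ddbar fun w => Real.log (tau (G w).1 k)
  have hτ : ∀ k, k ≤ 2 * n + 1 → ContDiffAt ℝ ∞ (fun w => Real.log (tau (G w).1 k)) z :=
    fun k hk => (fsForm_plucker (c := c) hGA.self_of_nhds.2.1 hfG.self_of_nhds hk (hH k)).1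
  have hΦ0 : ∀ w, Φ 0 w = 0 := fun w => by
    simp only [Φ, tau_zero]
    exact ddbar_const _ _
  have hΦn : ∀ w, Φ (n + 1) w = Φ n w := fun w => by simp only [Φ, tau_middle]
  have hFl : ∀ j : Fin (2 * n), ∀ᶠ w in nhds z,
      metricFl H (incl n ∘ f) c j w = Φ (j.val + 1) w := fun j => by
    filter_upwards [hGA, hfG] with w hw hw'
    exact (fsForm_plucker hw.2.1 hw' _ (hH _)).2
  -- The index `n` is the spin representation, which accounts for the factor `1 / 2`.
  have hm : ∀ i : Fin n, ∀ᶠ w in nhds z, metric H Hs f c i w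
      = (if i.val + 1 < n then 1 else 1 / 2) * Φ (i.val + 1) w := fun i => by
    filter_upwards [hGA, hfG] with w hw hw'
    by_cases hi : i.val + 1 < n
    · rw [metric, if_pos hi, if_pos hi, one_mul]
      have h1 : piExt (i.val + 1) (by omega) ∘ f
          = plucker (i.val + 1) (by omega) ∘ incl n ∘ f :=
        funext fun x => piExt_eq_plucker_incl _ _
      rw [h1]
      exact (fsForm_plucker hw.2.1 hw' _ (hH _)).2
    · have h1 : i.val + 1 = n := by have := i.2; omega
      rw [metric, if_neg hi, if_neg hi, h1]
      exact fsForm_spin hw.2.1 hw' hHs (fsForm_plucker (c := c) hw.2.1 hw' (by omega) (hH n)).1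
  have hkey : ∀ i : Fin n, ContDiffAt ℝ ∞ (metric H Hs f c i) z ∧ 0 ≤ metric H Hs f c i z ∧
      (metric H Hs f c i z ≠ 0 → curvature (metric H Hs f c i) z
        = 2 * Φ (i.val + 1) z - Φ i.val z - Φ (i.val + 2) z) := fun i => by
    have hi := i.2
    have him : i.val + 1 < 2 * n + 1 := by omega
    -- The spin form is half of the form on `⋀^n V`, so the exterior formula covers every `i`; the
    -- half goes into the constant `C` and does not affect the curvature.
    refine contDiffAt_and_curvature_of_eventuallyEq
      (a := fun w => A w ⟨i.val + 1, him⟩ ⟨i.val, by omega⟩)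
      (t₀ := fun w => tau (G w).1 i.val) (t₁ := fun w => tau (G w).1 (i.val + 1))
      (t₂ := fun w => tau (G w).1 (i.val + 2))
      (C := (if i.val + 1 < n then 1 else 1 / 2) *
        (gramDet (H (i.val + 1)) (extVec n (i.val + 1) him.le) (extVecNext n i.val him) /
          ((H (i.val + 1)).inner (extVec n (i.val + 1) him.le)
            (extVec n (i.val + 1) him.le)).re ^ 2))
      (hGA.self_of_nhds.2.2.1 _ _) ?_ (fun _ => tau_pos _ _) (fun _ => tau_pos _ _)
      (fun _ => tau_pos _ _) (hτ _ (by omega)) (hτ _ (by omega)) (hτ _ (by omega)) ?_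
    · refine mul_nonneg (by split_ifs <;> norm_num) (div_nonneg (gramDet_nonneg _ _ _) (sq_nonneg _))
    · filter_upwards [hm i, hGA, hfG] with w hw hw1 hw2
      rw [hw, mul_assoc]
      congr 1
      refine Eq.trans ?_ (fsForm_plucker_eq hw1.2.1 hw2 hw1.2.2.2.2 hw1.2.2.2.1 him (hH _))
      exact (fsForm_plucker hw1.2.1 hw2 him.le (hH _)).2.symm
  have hroot : ∀ (i : Fin n) (U : Set S) (g : S → SL n), IsLiftSL (incl n ∘ f) U g →
      c.symm z ∈ U → rootCurvature g c (Fin.castLE (by omega) i) z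
        = 2 * Φ (i.val + 1) z - Φ i.val z - Φ (i.val + 2) z := fun i U g hg hzU =>
    rootCurvature_eq (hGA.mono fun w hw => hw.2.1) hfG.self_of_nhds hc hz hτ hg hzU _
  refine ⟨fun i => ⟨(hkey i).1, (hkey i).2.1⟩, fun i hi => ?_, fun i hi U g hg hzU => ?_,
    fun i U g hg hzU => ?_, fun i hi => ?_, fun i hi => ?_⟩
  · rw [(hkey i).2.2 hi, ← sum_cartanB i (fun k => Φ k z) (hΦ0 z) (hΦn z)]
    exact Finset.sum_congr rfl fun j _ => by rw [(hm j).self_of_nhds]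
  · rw [(hkey i).2.2 hi, hroot i U g hg hzU]
  · have hi := i.2
    have h1 := sum_cartanA (Fin.castLE (show n ≤ 2 * n by omega) i)
      (by rw [Fin.val_castLE]; omega) (fun k => Φ k z) (hΦ0 z)
    rw [hroot i U g hg hzU]
    refine h1.symm.trans (Finset.sum_congr rfl fun j _ => ?_)
    rw [(hFl j).self_of_nhds]
  · rw [(hFl _).self_of_nhds, (hm i).self_of_nhds, if_pos hi, one_mul]
    rfl
  · rw [(hFl _).self_of_nhds, (hFl _).self_of_nhds, (hm i).self_of_nhds, if_neg (by omega)]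
    have h1 : Φ (i.val + 1 + 1) z = Φ (i.val + 1) z := by rw [hi]; exact hΦn z
    rw [h1]
    refine ⟨?_, by ring⟩
    rw [Fin.val_castLE]
    ring
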